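/- **Theorem 1.6.** Let $n\ge 1$, let $\gamma_\beta(x)=(2\pi\beta)^{-n/2}e^{-|x|^2/(2\beta)}$ for $x\in\mathbb R^n$, $\beta>0$, and let $\gamma=\gamma_1$, which is also written for the measure $\gamma(x)\,dx$. For $s>0$ and measurable $g:\mathbb R^n\to[0,\infty]$ put $$P_sg(x)=\int_{\mathbb R^n}e^{-\frac{|e^{-s}x-y|^2}{2(1-e^{-2s})}}\,g(y)\,\frac{dy}{(2\pi(1-e^{-2s}))^{n/2}}\in[0,\infty],$$ and for $q<0$ and measurable $F:\mathbb R^n\to[0,\infty]$ put $\|F\|_{L^q(\gamma)}=\big(\int F^q\,d\gamma\big)^{1/q}$, with the conventions $0^{r}=\infty$ and $\infty^{r}=0$ for $r<0$. Let $s>0$ and $q<0<p$. (i) If $1-e^{2s}\le q<0<p\le 1-e^{-2s}$, then for every nonnegative even $f_0\in L^1(\mathbb R^n,dx)$, $$\Big\|P_s\Big[\Big(\frac{f_0}{\gamma}\Big)^{1/p}\Big]\Big\|_{L^q(\gamma)}\ \ge\ \Big(\int_{\mathbb R^n}f_0\,dx\Big)^{1/p},$$ and equality holds for $f_0=\gamma$.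 (ii) The range of exponents in (i) is the best possible, in the sense that $$\inf_{\beta>0}\Big\|P_s\Big[\Big(\frac{\gamma_\beta}{\gamma}\Big)^{1/p}\Big]\Big\|_{L^q(\gamma)}>0\quad\Longleftrightarrow\quad 1-e^{2s}\le q<0<p\le 1-e^{-2s}.$$ -/

import Mathlib

open MeasureTheory
open scoped ENNReal

noncomputable section

namespace SymmHC

/-- The centred Gaussian density `γ_β` on `ℝⁿ` with covariance matrix `β • id` (for `β > 0`):
`γ_β(x) = (2πβ)^(-n/2) * exp (-|x|² / (2β))`. -/
def gaussianDensity {n : ℕ} (β : ℝ) (x : EuclideanSpace ℝ (Fin n)) : ℝ :=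
  (2 * Real.pi * β) ^ (-((n : ℝ) / 2)) * Real.exp (-(‖x‖ ^ 2 / (2 * β)))

/-- The standard Gaussian density `γ(x) = (2π)^(-n/2) * exp (-|x|² / 2)` on `ℝⁿ`. -/
def stdDensity {n : ℕ} (x : EuclideanSpace ℝ (Fin n)) : ℝ :=
  (2 * Real.pi) ^ (-((n : ℝ) / 2)) * Real.exp (-(‖x‖ ^ 2 / 2))

/-- The standard Gaussian measure `dγ = γ(x) dx` on `ℝⁿ`. -/
def stdMeasure (n : ℕ) : Measure (EuclideanSpace ℝ (Fin n)) :=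
  volume.withDensity fun x => ENNReal.ofReal (stdDensity x)

/-- The Ornstein–Uhlenbeck semigroup at time `t > 0`, acting on `[0,∞]`-valued functions:
`P_t g (x) = ∫ exp (-|e^{-t} x - y|² / (2 (1 - e^{-2t}))) g(y) dy / (2π (1 - e^{-2t}))^{n/2}`.
The value `∞` is allowed. -/
def ouSemigroup {n : ℕ} (t : ℝ) (g : EuclideanSpace ℝ (Fin n) → ℝ≥0∞)
    (x : EuclideanSpace ℝ (Fin n)) : ℝ≥0∞ :=
  ∫⁻ y, ENNReal.ofReal
      (Real.exp (-(‖Real.exp (-t) • x - y‖ ^ 2 / (2 * (1 - Real.exp (-(2 * t))))))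
        / (2 * Real.pi * (1 - Real.exp (-(2 * t)))) ^ ((n : ℝ) / 2)) * g y

/-- `‖F‖_{L^q(γ)} = (∫ F^q dγ)^{1/q}` for a `[0,∞]`-valued function `F` and a real exponent
`q ≠ 0`, possibly negative. For `q < 0` the powers follow the usual conventions
`0^q = ∞` and `∞^q = 0`. -/
def gaussLpNorm {n : ℕ} (q : ℝ) (F : EuclideanSpace ℝ (Fin n) → ℝ≥0∞) : ℝ≥0∞ :=
  (∫⁻ x, F x ^ q ∂(stdMeasure n)) ^ (1 / q)

/-- The functional `f ↦ ‖P_s[(f/γ)^{1/p}]‖_{L^q(γ)}` on (a.e.) nonnegative functions on `ℝⁿ`. -/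
def hcNorm {n : ℕ} (s p q : ℝ) (f : EuclideanSpace ℝ (Fin n) → ℝ) : ℝ≥0∞ :=
  gaussLpNorm q (ouSemigroup s fun y => ENNReal.ofReal (f y / stdDensity y) ^ (1 / p))

end SymmHC

end

set_option linter.unusedSectionVars false

noncomputable section

namespace SymmHC

/-! ### Invariance of Lebesgue measure under the rotation by 45 degrees. -/

section Rotation

variable {E : Type*} [NormedAddCommGroup E] [InnerProductSpace ℝ E] [FiniteDimensional ℝ E]
  [MeasurableSpace E] [BorelSpace E]

/-! Put a = e^{-s}, r = 1/(1-a²), λ = a/(1-a²). Jensen's inequality in p and monotonicity of L^q(γ)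
norms in q reduce (i) to the endpoint p = 1-a², q = 1-a^{-2}, where 1/p = r and 1/q = 1-r. With F
the semigroup term, testing against γF^q turns the endpoint case into an inverse Brascamp–Lieb
inequality for even f, g: (∫f)^r (∫g)^r ≤ c ∬ e^{λ⟨x,y⟩} f(x)^r g(y)^r dx dy, where c gives equality
at f = g = γ (`rpow_mul_rpow_le_kernelForm`).

Let J be the form on the right without c, and I its infimum over even probability densities.
Gaussians are shown to decide I by doubling. In J(f,g)² rotate both pairs of variables by 45
degrees: the exponential still factorises, and the inner integral becomes J of the fibres x ↦
f((x+y)/√2) f((x-y)/√2) and their analogues for g. These fibres are even because f and g are, so I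
bounds the inner integral, and I·J(f₁,g₁) ≤ J(f,g)² for the densities f₁, g₁ of (X-X')/√2
(`kernelConst_mul_selfRot_le`). Pairs close enough to optimal, depending on k, therefore stay
near-optimal after k doublings, while the central limit theorem drives the doublings to Gaussians.

Two regularisations make this rigorous. The extra weight e^{δ(|x|²+|y|²)/2} in the kernel gives I >
0 and bounds fourth moments on sublevel sets: evenness replaces e^{λ⟨x,y⟩} by cosh ≥ 1, which
decouples the form. This yields convergent covariances and a central limit theorem for the array. As
that convergence is only weak, both functions are convolved with a Gaussian of variance δ²; the
mollified densities converge pointwise, Fatou's lemma applies, and the cost is a factor tending to 1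
as δ → 0 (`kernelForm_gaussConv_le`).

For limiting Gaussians a linear change of variables leaves E exp(λ⟨U,(H-1)V⟩) ≥ (det H)^{r-1}, with
H positive definite and U, V standard Gaussians of correlation a. Averaging over V given U, then
Jensen, bounds the left side below by e^{(r-1) tr(H-1)}, and log det H ≤ tr(H-1)
(`det_rpow_le_lintegral`).

For (ii), explicit Gaussians fail outside the range: if q is too small some γF^q is a positive
constant, of infinite integral; if p is too large the norms of wide Gaussians tend to 0. Inside the
range (i) gives the lower bound 1. -/

theorem lintegral_comp_smul_volume (f : E → ℝ≥0∞) (hf : Measurable f) {c : ℝ} (hc : 0 < c) :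
    ∫⁻ x, f (c • x) = ENNReal.ofReal ((c ^ Module.finrank ℝ E)⁻¹) * ∫⁻ x, f x := by
  have h := Measure.map_addHaar_smul (volume : Measure E) hc.ne'
  have h2 : ∫⁻ x, f x ∂(Measure.map (c • ·) (volume : Measure E)) = ∫⁻ x, f (c • x) :=
    lintegral_map hf (measurable_const_smul c)
  rw [← h2, h, lintegral_smul_measure, abs_of_pos (by positivity), smul_eq_mul]

/-- Invariance of the integral under the rotation `(x, y) ↦ ((x + y)/√2, (x - y)/√2)`. -/
theorem lintegral_rotation (F : E → E → ℝ≥0∞) (hF : Measurable (Function.uncurry F)) :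
    ∫⁻ y, ∫⁻ x, F ((√2)⁻¹ • (x + y)) ((√2)⁻¹ • (x - y)) = ∫⁻ x, ∫⁻ y, F x y := by
  have hc : (0 : ℝ) < (√2)⁻¹ := by positivity
  set c : ℝ := (√2)⁻¹ with hcdef
  have hc2 : (2 * c) * c = 1 := by
    rw [hcdef]; field_simp; rw [Real.sq_sqrt (by norm_num)]
  have h1 : ∀ y, ∫⁻ x, F (c • (x + y)) (c • (x - y)) =
      ∫⁻ x, F (c • x) (c • (x - (2 : ℝ) • y)) := by
    intro y
    rw [← lintegral_add_right_eq_self (fun x => F (c • x) (c • (x - (2 : ℝ) • y))) y]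
    refine lintegral_congr fun x => ?_
    congr 2
    module
  have h2 : ∀ x, ∫⁻ y, F (c • x) (c • (x - (2 : ℝ) • y)) =
      ENNReal.ofReal (((2 * c) ^ Module.finrank ℝ E)⁻¹) * ∫⁻ y, F (c • x) y := by
    intro x
    rw [← lintegral_sub_left_eq_self (fun y => F (c • x) y) (c • x),
      ← lintegral_comp_smul_volume (fun y => F (c • x) (c • x - y)) (by fun_prop) (by positivity)]
    refine lintegral_congr fun y => ?_
    congr 1
    module
  simp_rw [h1]
  rw [lintegral_lintegral_swap (by fun_prop)]
  simp_rw [h2]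
  rw [lintegral_const_mul _ (by fun_prop),
    lintegral_comp_smul_volume (fun x => ∫⁻ y, F x y) (by fun_prop) hc, ← mul_assoc,
    ← ENNReal.ofReal_mul (by positivity), ← mul_inv, ← mul_pow, hc2]
  simp

end Rotation

/-! ### The bilinear form, its infimum, and the doubling inequality. -/

section Doubling

variable {E : Type*} [NormedAddCommGroup E] [InnerProductSpace ℝ E] [FiniteDimensional ℝ E]
  [MeasurableSpace E] [BorelSpace E]

/-- The kernel `exp (lam ⟪x, y⟫ + δ (|x|² + |y|²) / 2)`. -/
def expKernel (lam δ : ℝ) (x y : E) : ℝ≥0∞ :=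
  ENNReal.ofReal (Real.exp (lam * inner ℝ x y + δ * (‖x‖ ^ 2 + ‖y‖ ^ 2) / 2))

/-- The form `∫∫ exp (lam ⟪x, y⟫ + δ (|x|² + |y|²) / 2) f(x)^r g(y)^r dx dy`. -/
def kernelForm (lam δ r : ℝ) (f g : E → ℝ≥0∞) : ℝ≥0∞ :=
  ∫⁻ x, ∫⁻ y, expKernel lam δ x y * (f x ^ r * g y ^ r)

/-- If `f` is the density of a random vector `X` and `X'` is an independent copy of `X`, this is
the density of `(X - X')/√2`. -/
def selfRot (f : E → ℝ≥0∞) (y : E) : ℝ≥0∞ :=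
  ∫⁻ x, f ((√2)⁻¹ • (x + y)) * f ((√2)⁻¹ • (x - y))

/-- Even probability densities. -/
structure IsEvenDensity (f : E → ℝ≥0∞) : Prop where
  measurable : Measurable f
  even : ∀ x, f (-x) = f x
  lintegral_eq_one : ∫⁻ x, f x = 1

/-- The infimum of `kernelForm` over even probability densities. -/
def kernelConst (E : Type*) [NormedAddCommGroup E] [InnerProductSpace ℝ E] [FiniteDimensional ℝ E]
    [MeasurableSpace E] [BorelSpace E] (lam δ r : ℝ) : ℝ≥0∞ :=
  ⨅ (f : E → ℝ≥0∞) (g : E → ℝ≥0∞) (_ : IsEvenDensity f) (_ : IsEvenDensity g),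
    kernelForm lam δ r f g

@[fun_prop]
theorem measurable_expKernel (lam δ : ℝ) :
    Measurable (fun z : E × E => expKernel lam δ z.1 z.2) := by
  unfold expKernel; fun_prop

@[fun_prop]
theorem measurable_expKernel_comp {α : Type*} [MeasurableSpace α] (lam δ : ℝ) {u v : α → E}
    (hu : Measurable u) (hv : Measurable v) :
    Measurable (fun a => expKernel lam δ (u a) (v a)) :=
  (measurable_expKernel lam δ).comp (hu.prodMk hv)

@[fun_prop]
theorem measurable_selfRot {f : E → ℝ≥0∞} (hf : Measurable f) : Measurable (selfRot f) := by
  unfold selfRot; fun_prop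

theorem selfRot_isEvenDensity {f : E → ℝ≥0∞} (hf : IsEvenDensity f) :
    IsEvenDensity (selfRot f) := by
  have hm := hf.measurable
  refine ⟨measurable_selfRot hm, fun y => ?_, ?_⟩
  · unfold selfRot
    refine lintegral_congr fun x => ?_
    rw [mul_comm, ← sub_eq_add_neg, sub_neg_eq_add]
  · unfold selfRot
    rw [lintegral_rotation (fun a b => f a * f b) (by fun_prop)]
    simp_rw [lintegral_const_mul _ hm, hf.lintegral_eq_one, mul_one, hf.lintegral_eq_one]

theorem kernelConst_le {lam δ r : ℝ} {f g : E → ℝ≥0∞} (hf : IsEvenDensity f)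
    (hg : IsEvenDensity g) : kernelConst E lam δ r ≤ kernelForm lam δ r f g :=
  iInf_le_of_le f <| iInf_le_of_le g <| iInf_le_of_le hf <| iInf_le _ hg

/-- The exponent is a quadratic form built from inner products, so its sum over two copies does not
change when one rotation acts on both pairs of vectors. -/
theorem expKernel_rotation (lam δ : ℝ) (x y u v : E) :
    expKernel lam δ ((√2)⁻¹ • (x + y)) ((√2)⁻¹ • (u + v)) *
      expKernel lam δ ((√2)⁻¹ • (x - y)) ((√2)⁻¹ • (u - v)) =
      expKernel lam δ y v * expKernel lam δ x u := by
  unfold expKernel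
  rw [← ENNReal.ofReal_mul (by positivity), ← ENNReal.ofReal_mul (by positivity), ← Real.exp_add,
    ← Real.exp_add]
  congr 2
  have hs : (√2)⁻¹ * (√2)⁻¹ = (1 / 2 : ℝ) := by
    rw [← mul_inv, Real.mul_self_sqrt (by norm_num)]; norm_num
  have hs' : (√2)⁻¹ ^ 2 = (1 / 2 : ℝ) := by rw [sq, hs]
  simp only [norm_smul, mul_pow, Real.norm_eq_abs, sq_abs, hs', inner_smul_left, inner_smul_right,
    inner_add_left, inner_add_right, inner_sub_left, inner_sub_right, conj_trivial,
    norm_add_sq_real, norm_sub_sq_real]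
  linear_combination (2 * lam * inner ℝ x u + 2 * lam * inner ℝ y v) * hs

theorem kernelForm_const_mul (lam δ : ℝ) {r : ℝ} (hr : 0 ≤ r) (a b : ℝ≥0∞) {f g : E → ℝ≥0∞}
    (hf : Measurable f) (hg : Measurable g) :
    kernelForm lam δ r (fun x => a * f x) (fun x => b * g x) =
      a ^ r * b ^ r * kernelForm lam δ r f g := by
  unfold kernelForm
  rw [← lintegral_const_mul _ (by fun_prop)]
  refine lintegral_congr fun x => ?_
  rw [← lintegral_const_mul _ (by fun_prop)]
  refine lintegral_congr fun y => ?_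
  rw [ENNReal.mul_rpow_of_nonneg _ _ hr, ENNReal.mul_rpow_of_nonneg _ _ hr]
  ring

theorem isEvenDensity_normalize {f : E → ℝ≥0∞} (hf : Measurable f) (hfe : ∀ x, f (-x) = f x)
    (h0 : ∫⁻ x, f x ≠ 0) (hfin : ∫⁻ x, f x ≠ ∞) :
    IsEvenDensity (fun x => (∫⁻ x, f x)⁻¹ * f x) := by
  refine ⟨by fun_prop, fun x => by rw [hfe], ?_⟩
  rw [lintegral_const_mul _ hf, ENNReal.inv_mul_cancel h0 hfin]

/-- Homogeneity of degree r in each argument. The fibres met in the doubling argument are not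
normalised and may have mass zero, a trivial case since r > 0. -/
theorem kernelConst_mul_le (lam δ : ℝ) {r : ℝ} (hr : 0 < r) {f g : E → ℝ≥0∞}
    (hf : Measurable f) (hg : Measurable g) (hfe : ∀ x, f (-x) = f x) (hge : ∀ x, g (-x) = g x)
    (hfin : ∫⁻ x, f x ≠ ∞) (hgin : ∫⁻ x, g x ≠ ∞) :
    kernelConst E lam δ r * ((∫⁻ x, f x) ^ r * (∫⁻ x, g x) ^ r) ≤ kernelForm lam δ r f g := by
  by_cases hf0 : ∫⁻ x, f x = 0
  · simp [hf0, ENNReal.zero_rpow_of_pos hr]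
  by_cases hg0 : ∫⁻ x, g x = 0
  · simp [hg0, ENNReal.zero_rpow_of_pos hr]
  have h := kernelConst_le (lam := lam) (δ := δ) (r := r)
    (isEvenDensity_normalize hf hfe hf0 hfin) (isEvenDensity_normalize hg hge hg0 hgin)
  rw [kernelForm_const_mul _ _ hr.le _ _ hf hg] at h
  set A := ∫⁻ x, f x
  set B := ∫⁻ x, g x
  have hA : A⁻¹ ^ r * A ^ r = 1 := by
    rw [← ENNReal.mul_rpow_of_nonneg _ _ hr.le, ENNReal.inv_mul_cancel hf0 hfin, ENNReal.one_rpow]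
  have hB : B⁻¹ ^ r * B ^ r = 1 := by
    rw [← ENNReal.mul_rpow_of_nonneg _ _ hr.le, ENNReal.inv_mul_cancel hg0 hgin, ENNReal.one_rpow]
  calc _ ≤ A⁻¹ ^ r * B⁻¹ ^ r * kernelForm lam δ r f g * (A ^ r * B ^ r) := by gcongr
    _ = (A⁻¹ ^ r * A ^ r) * (B⁻¹ ^ r * B ^ r) * kernelForm lam δ r f g := by ring
    _ = _ := by rw [hA, hB, one_mul, one_mul]

/-- The square is the form of the tensor squares on E × E. After rotating the two f-variables into
(x, y) and the two g-variables into (u, v), the kernel splits and the integral over (x, u) is the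
form of the fibres over y and v. -/
theorem kernelForm_mul_self (lam δ : ℝ) {r : ℝ} (hr : 0 < r) {f g : E → ℝ≥0∞}
    (hf : Measurable f) (hg : Measurable g) :
    kernelForm lam δ r f g * kernelForm lam δ r f g =
      ∫⁻ y, ∫⁻ v, expKernel lam δ y v *
        kernelForm lam δ r (fun x => f ((√2)⁻¹ • (x + y)) * f ((√2)⁻¹ • (x - y)))
          (fun u => g ((√2)⁻¹ • (u + v)) * g ((√2)⁻¹ • (u - v))) := by
  set L : E → ℝ≥0∞ := fun x => ∫⁻ y, expKernel lam δ x y * g y ^ r with hL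
  have hLm : Measurable L := by fun_prop
  have hJ : kernelForm lam δ r f g = ∫⁻ x, f x ^ r * L x := by
    unfold kernelForm
    refine lintegral_congr fun x => ?_
    rw [hL, ← lintegral_const_mul _ (by fun_prop)]
    refine lintegral_congr fun y => by ring
  have hLL : ∀ a b, L a * L b = ∫⁻ c, ∫⁻ d, (expKernel lam δ a c * g c ^ r) *
      (expKernel lam δ b d * g d ^ r) := by
    intro a b
    rw [hL, ← lintegral_mul_const _ (by fun_prop)]
    refine lintegral_congr fun c => ?_
    rw [← lintegral_const_mul _ (by fun_prop)]
  have hJJ : kernelForm lam δ r f g * kernelForm lam δ r f g =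
      ∫⁻ a, ∫⁻ b, (f a ^ r * L a) * (f b ^ r * L b) := by
    rw [hJ, ← lintegral_mul_const _ (by fun_prop)]
    refine lintegral_congr fun c => ?_
    rw [← lintegral_const_mul _ (by fun_prop)]
  rw [hJJ, ← lintegral_rotation (fun a b => (f a ^ r * L a) * (f b ^ r * L b)) (by fun_prop)]
  refine lintegral_congr fun y => ?_
  have : ∀ x, f ((√2)⁻¹ • (x + y)) ^ r * L ((√2)⁻¹ • (x + y)) *
      (f ((√2)⁻¹ • (x - y)) ^ r * L ((√2)⁻¹ • (x - y))) =
      ∫⁻ v, ∫⁻ u, expKernel lam δ y v * (expKernel lam δ x u *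
        ((f ((√2)⁻¹ • (x + y)) * f ((√2)⁻¹ • (x - y))) ^ r *
          (g ((√2)⁻¹ • (u + v)) * g ((√2)⁻¹ • (u - v))) ^ r)) := by
    intro x
    rw [show ∀ p q p' q' : ℝ≥0∞, p * q * (p' * q') = (p * p') * (q * q') by intros; ring, hLL,
      ← lintegral_rotation (fun c d => (expKernel lam δ _ c * g c ^ r) *
      (expKernel lam δ _ d * g d ^ r)) (by fun_prop), ← lintegral_const_mul _ (by fun_prop)]
    refine lintegral_congr fun v => ?_
    rw [← lintegral_const_mul _ (by fun_prop)]
    refine lintegral_congr fun u => ?_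
    rw [show ∀ t a q b q' : ℝ≥0∞, t * (a * q * (b * q')) = (a * b) * (t * (q * q'))
      by intros; ring, expKernel_rotation, ENNReal.mul_rpow_of_nonneg _ _ hr.le,
      ENNReal.mul_rpow_of_nonneg _ _ hr.le]
    ring
  simp_rw [this]
  rw [lintegral_lintegral_swap (by fun_prop)]
  refine lintegral_congr fun v => ?_
  unfold kernelForm
  rw [← lintegral_const_mul _ (by fun_prop)]
  refine lintegral_congr fun x => ?_
  rw [← lintegral_const_mul _ (by fun_prop)]

theorem ae_selfRot_ne_top {f : E → ℝ≥0∞} (hf : IsEvenDensity f) : ∀ᵐ y, selfRot f y ≠ ∞ := by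
  have h := selfRot_isEvenDensity hf
  filter_upwards [ae_lt_top h.measurable (by rw [h.lintegral_eq_one]; simp)] with y hy
  exact hy.ne

/-- Negating x exchanges the two factors up to sign. This is why doubling stays within the class of
even functions. -/
theorem even_fiber {f : E → ℝ≥0∞} (hf : ∀ x, f (-x) = f x) (y x : E) :
    f ((√2)⁻¹ • (-x + y)) * f ((√2)⁻¹ • (-x - y)) =
      f ((√2)⁻¹ • (x + y)) * f ((√2)⁻¹ • (x - y)) := by
  rw [← hf ((√2)⁻¹ • (-x + y)), ← hf ((√2)⁻¹ • (-x - y)), mul_comm]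
  congr 2 <;> module

/-- The doubling inequality. -/
theorem kernelConst_mul_selfRot_le (lam δ : ℝ) {r : ℝ} (hr : 0 < r) {f g : E → ℝ≥0∞}
    (hf : IsEvenDensity f) (hg : IsEvenDensity g) :
    kernelConst E lam δ r * kernelForm lam δ r (selfRot f) (selfRot g) ≤
      kernelForm lam δ r f g * kernelForm lam δ r f g := by
  have hfm := hf.measurable
  have hgm := hg.measurable
  rw [kernelForm_mul_self lam δ hr hf.measurable hg.measurable]
  conv_lhs => unfold kernelForm
  rw [← lintegral_const_mul _ (by fun_prop)]
  refine lintegral_mono_ae ?_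
  filter_upwards [ae_selfRot_ne_top hf] with y hy
  rw [← lintegral_const_mul _ (by fun_prop)]
  refine lintegral_mono_ae ?_
  filter_upwards [ae_selfRot_ne_top hg] with v hv
  have := kernelConst_mul_le lam δ hr (E := E)
    (f := fun x => f ((√2)⁻¹ • (x + y)) * f ((√2)⁻¹ • (x - y)))
    (g := fun u => g ((√2)⁻¹ • (u + v)) * g ((√2)⁻¹ • (u - v)))
    (by fun_prop) (by fun_prop) (even_fiber hf.even y) (even_fiber hg.even v) hy hv
  calc _ = expKernel lam δ y v * (kernelConst E lam δ r * (selfRot f y ^ r * selfRot g v ^ r)) := by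
        ring
    _ ≤ _ := by gcongr; exact this

theorem iterate_selfRot_isEvenDensity {f : E → ℝ≥0∞} (hf : IsEvenDensity f) (k : ℕ) :
    IsEvenDensity (selfRot^[k] f) := by
  induction k with
  | zero => exact hf
  | succ k ih => rw [Function.iterate_succ_apply']; exact selfRot_isEvenDensity ih

/-- Divided by the square of the infimum, the doubling inequality says that one step at most squares
the ratio to the infimum. -/
theorem kernelForm_iterate_selfRot_le (lam δ : ℝ) {r : ℝ} (hr : 0 < r) {f g : E → ℝ≥0∞}
    (hf : IsEvenDensity f) (hg : IsEvenDensity g) (h0 : kernelConst E lam δ r ≠ 0)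
    (htop : kernelConst E lam δ r ≠ ∞) (k : ℕ) :
    kernelForm lam δ r (selfRot^[k] f) (selfRot^[k] g) / kernelConst E lam δ r ≤
      (kernelForm lam δ r f g / kernelConst E lam δ r) ^ (2 ^ k) := by
  induction k with
  | zero => simp
  | succ k ih =>
    have h := kernelConst_mul_selfRot_le lam δ hr (iterate_selfRot_isEvenDensity hf k)
      (iterate_selfRot_isEvenDensity hg k)
    rw [← Function.iterate_succ_apply' selfRot, ← Function.iterate_succ_apply' selfRot] at h
    rw [pow_succ, pow_mul]
    refine le_trans ?_ (pow_le_pow_left₀ (zero_le) ih 2)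
    set I := kernelConst E lam δ r
    rw [ENNReal.div_le_iff h0 htop, sq, ENNReal.div_eq_inv_mul]
    calc _ = I⁻¹ * (I * kernelForm lam δ r (selfRot^[k + 1] f) (selfRot^[k + 1] g)) := by
          rw [← mul_assoc, ENNReal.inv_mul_cancel h0 htop, one_mul]
      _ ≤ I⁻¹ * (kernelForm lam δ r (selfRot^[k] f) (selfRot^[k] g) *
          kernelForm lam δ r (selfRot^[k] f) (selfRot^[k] g)) := by gcongr
      _ = (I⁻¹ * I) * (I⁻¹ * (kernelForm lam δ r (selfRot^[k] f) (selfRot^[k] g) *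
          kernelForm lam δ r (selfRot^[k] f) (selfRot^[k] g))) := by
          rw [ENNReal.inv_mul_cancel h0 htop, one_mul]
      _ = _ := by ring

end Doubling

/-! ### Positivity of the infimum and moment bounds, from evenness and the weight. -/

section Coercivity

variable {E : Type*} [NormedAddCommGroup E] [InnerProductSpace ℝ E] [FiniteDimensional ℝ E]
  [MeasurableSpace E] [BorelSpace E]

/-- The weighted integral `∫ exp (δ |x|² / 2) f(x)^r dx`. -/
def weightedMass (δ r : ℝ) (f : E → ℝ≥0∞) : ℝ≥0∞ :=
  ∫⁻ x, ENNReal.ofReal (Real.exp (δ * ‖x‖ ^ 2 / 2)) * f x ^ r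

theorem lintegral_exp_neg_mul_sq_norm_lt_top {c : ℝ} (hc : 0 < c) :
    ∫⁻ x : E, ENNReal.ofReal (Real.exp (-c * ‖x‖ ^ 2)) < ∞ := by
  have h := GaussianFourier.integral_rexp_neg_mul_sq_norm (V := E) hc
  have hi : Integrable (fun v : E => Real.exp (-c * ‖v‖ ^ 2)) := by
    refine not_imp_comm.mp integral_undef ?_
    rw [h]
    positivity
  exact hi.lintegral_lt_top

/-- This is cosh ≥ 1. -/
theorem two_mul_weights_le (lam δ : ℝ) (x y : E) :
    2 * (ENNReal.ofReal (Real.exp (δ * ‖x‖ ^ 2 / 2)) *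
      ENNReal.ofReal (Real.exp (δ * ‖y‖ ^ 2 / 2))) ≤
      expKernel lam δ x y + expKernel lam δ (-x) y := by
  unfold expKernel
  rw [← ENNReal.ofReal_mul (by positivity), ← ENNReal.ofReal_add (by positivity) (by positivity),
    show (2 : ℝ≥0∞) = ENNReal.ofReal 2 by simp, ← ENNReal.ofReal_mul (by positivity)]
  apply ENNReal.ofReal_le_ofReal
  rw [← Real.exp_add, inner_neg_left, norm_neg,
    show lam * inner ℝ x y + δ * (‖x‖ ^ 2 + ‖y‖ ^ 2) / 2 =
      lam * inner ℝ x y + (δ * ‖x‖ ^ 2 / 2 + δ * ‖y‖ ^ 2 / 2) by ring,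
    show lam * -inner ℝ x y + δ * (‖x‖ ^ 2 + ‖y‖ ^ 2) / 2 =
      -(lam * inner ℝ x y) + (δ * ‖x‖ ^ 2 / 2 + δ * ‖y‖ ^ 2 / 2) by ring,
    Real.exp_add (lam * _), Real.exp_add (-_)]
  have h1 := Real.one_le_cosh (lam * inner ℝ x y)
  rw [Real.cosh_eq] at h1
  nlinarith [Real.exp_pos (δ * ‖x‖ ^ 2 / 2 + δ * ‖y‖ ^ 2 / 2)]

/-- Evenness of f permits averaging the kernel over x and -x, which removes the coupling term.
Evenness of one function is enough. -/
theorem weightedMass_mul_le_kernelForm (lam δ : ℝ) {r : ℝ} {f g : E → ℝ≥0∞}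
    (hf : Measurable f) (hg : Measurable g) (hfe : ∀ x, f (-x) = f x) :
    weightedMass δ r f * weightedMass δ r g ≤ kernelForm lam δ r f g := by
  have h1 : kernelForm lam δ r f g = ∫⁻ x, ∫⁻ y, expKernel lam δ (-x) y * (f x ^ r * g y ^ r) := by
    conv_lhs => unfold kernelForm
    rw [← lintegral_neg_eq_self]
    simp_rw [hfe]
  have h2 : kernelForm lam δ r f g + kernelForm lam δ r f g =
      ∫⁻ x, ∫⁻ y, (expKernel lam δ x y + expKernel lam δ (-x) y) * (f x ^ r * g y ^ r) := by
    conv_lhs => rw [h1]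
    conv_lhs => rw [← h1]
    conv_lhs => enter [2]; rw [h1]
    unfold kernelForm
    rw [← lintegral_add_left (by fun_prop)]
    refine lintegral_congr fun x => ?_
    rw [← lintegral_add_left (by fun_prop)]
    simp_rw [add_mul]
  have h3 : 2 * (weightedMass δ r f * weightedMass δ r g) ≤
      kernelForm lam δ r f g + kernelForm lam δ r f g := by
    rw [h2]
    unfold weightedMass
    rw [← lintegral_mul_const _ (by fun_prop), ← lintegral_const_mul _ (by fun_prop)]
    refine lintegral_mono fun x => ?_
    rw [← lintegral_const_mul _ (by fun_prop), ← lintegral_const_mul _ (by fun_prop)]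
    refine lintegral_mono fun y => ?_
    calc _ = 2 * (ENNReal.ofReal (Real.exp (δ * ‖x‖ ^ 2 / 2)) *
          ENNReal.ofReal (Real.exp (δ * ‖y‖ ^ 2 / 2))) * (f x ^ r * g y ^ r) := by ring
      _ ≤ _ := by gcongr; exact two_mul_weights_le lam δ x y
  rw [← two_mul] at h3
  exact (ENNReal.mul_le_mul_iff_right (by simp) (by simp)).1 h3

/-- If a exceeds t, then 1 ≤ (a/t)^{r-1}, and multiplying by a gives the second term. With t a
Gaussian profile this trades mass for the weighted integral of f^r. -/
theorem le_add_rpow_mul {r : ℝ} (hr : 1 ≤ r) {t : ℝ} (ht : 0 < t) (a : ℝ≥0∞) :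
    a ≤ ENNReal.ofReal t + ENNReal.ofReal (t ^ (1 - r)) * a ^ r := by
  rcases le_total a (ENNReal.ofReal t) with h | h
  · exact h.trans le_self_add
  · have h0 : ENNReal.ofReal t ≠ 0 := by simpa using ht
    have hmul : ENNReal.ofReal (t ^ (1 - r)) * ENNReal.ofReal t ^ (r - 1) = 1 := by
      rw [← ENNReal.ofReal_rpow_of_pos ht, ← ENNReal.rpow_add _ _ h0 (by simp)]
      simp
    calc a = ENNReal.ofReal (t ^ (1 - r)) * (ENNReal.ofReal t ^ (r - 1) * a) := by
          rw [← mul_assoc, hmul, one_mul]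
      _ ≤ ENNReal.ofReal (t ^ (1 - r)) * (a ^ (r - 1) * a ^ (1 : ℝ)) := by
          rw [ENNReal.rpow_one]
          gcongr
      _ = ENNReal.ofReal (t ^ (1 - r)) * a ^ r := by
          rw [← ENNReal.rpow_add_of_nonneg _ _ (by linarith) zero_le_one, sub_add_cancel]
      _ ≤ _ := le_add_self

theorem lintegral_mul_le_weighted {r : ℝ} (hr : 1 ≤ r) {m : E → ℝ≥0∞} (f : E → ℝ≥0∞)
    (hm : Measurable m) {η : ℝ} (hη : 0 < η) (c : ℝ) :
    ∫⁻ x, m x * f x ≤ (∫⁻ x, m x * ENNReal.ofReal (η * Real.exp (-c * ‖x‖ ^ 2))) +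
      ∫⁻ x, m x * (ENNReal.ofReal (η ^ (1 - r) * Real.exp (c * (r - 1) * ‖x‖ ^ 2)) * f x ^ r) := by
  rw [← lintegral_add_left (by fun_prop)]
  refine lintegral_mono fun x => ?_
  rw [← mul_add]
  gcongr
  have h := le_add_rpow_mul hr (t := η * Real.exp (-c * ‖x‖ ^ 2)) (by positivity) (f x)
  rwa [Real.mul_rpow hη.le (by positivity), ← Real.exp_mul,
    show -c * ‖x‖ ^ 2 * (1 - r) = c * (r - 1) * ‖x‖ ^ 2 by ring] at h

theorem exists_le_weightedMass {δ r : ℝ} (hδ : 0 < δ) (hr : 1 < r) :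
    ∃ w : ℝ≥0∞, w ≠ 0 ∧ w ≠ ∞ ∧ ∀ f : E → ℝ≥0∞, IsEvenDensity f → w ≤ weightedMass δ r f := by
  have hr1 : 0 < r - 1 := by linarith
  -- With this c one has c(r-1) = δ/2, so the second term carries exactly the weight of
  -- `weightedMass`; η below makes the first term at most 1/2, leaving half of the unit mass to the
  -- second.
  set c := δ / (2 * (r - 1)) with hc
  have hc0 : 0 < c := by positivity
  set G := ∫⁻ x : E, ENNReal.ofReal (Real.exp (-c * ‖x‖ ^ 2)) with hG
  have hGt : G < ∞ := lintegral_exp_neg_mul_sq_norm_lt_top hc0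
  set η : ℝ := 1 / (2 * (G.toReal + 1)) with hη
  have hη0 : 0 < η := by positivity
  have hηG : ENNReal.ofReal η * G ≤ 2⁻¹ := by
    rw [← ENNReal.ofReal_toReal hGt.ne, ← ENNReal.ofReal_mul hη0.le,
      show (2 : ℝ≥0∞)⁻¹ = ENNReal.ofReal (1 / 2) by rw [one_div, ENNReal.ofReal_inv_of_pos] <;> simp]
    apply ENNReal.ofReal_le_ofReal
    rw [hη, div_mul_eq_mul_div, div_le_div_iff₀ (by positivity) (by positivity)]
    nlinarith [ENNReal.toReal_nonneg (a := G)]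
  have hp : 0 < η ^ (1 - r) := by positivity
  refine ⟨(ENNReal.ofReal (η ^ (1 - r)))⁻¹ * 2⁻¹, ?_, ?_, fun f hf => ?_⟩
  · simp
  · refine ENNReal.mul_ne_top (ENNReal.inv_ne_top.2 (by simpa using hp)) (by simp)
  have h := lintegral_mul_le_weighted hr.le (m := 1) f measurable_one hη0 c
  simp only [Pi.one_apply, one_mul, hf.lintegral_eq_one] at h
  simp_rw [ENNReal.ofReal_mul hη0.le, ENNReal.ofReal_mul hp.le] at h
  rw [lintegral_const_mul _ (by fun_prop)] at h
  simp_rw [mul_assoc] at h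
  have hfm := hf.measurable
  rw [lintegral_const_mul _ (by fun_prop)] at h
  have hcr : ∀ x : E, c * ((r - 1) * ‖x‖ ^ 2) = δ * ‖x‖ ^ 2 / 2 := by
    intro x; rw [hc]; field_simp
  simp_rw [hcr] at h
  change 1 ≤ ENNReal.ofReal η * G + ENNReal.ofReal (η ^ (1 - r)) * weightedMass δ r f at h
  have h2 : (2 : ℝ≥0∞)⁻¹ ≤ ENNReal.ofReal (η ^ (1 - r)) * weightedMass δ r f := by
    have h3 : (2 : ℝ≥0∞)⁻¹ + 2⁻¹ ≤ 2⁻¹ + ENNReal.ofReal (η ^ (1 - r)) * weightedMass δ r f := by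
      rw [ENNReal.inv_two_add_inv_two]
      exact h.trans (by gcongr)
    exact (ENNReal.add_le_add_iff_left (by simp)).1 h3
  calc _ ≤ (ENNReal.ofReal (η ^ (1 - r)))⁻¹ *
        (ENNReal.ofReal (η ^ (1 - r)) * weightedMass δ r f) := by gcongr
    _ = _ := by
      rw [← mul_assoc, ENNReal.inv_mul_cancel (by simpa using hp) (by simp), one_mul]

theorem sq_le_exp_mul {a : ℝ} (ha : 0 < a) {s : ℝ} (hs : 0 ≤ s) :
    s ^ 2 ≤ 2 / a ^ 2 * Real.exp (a * s) := by
  have h := Real.quadratic_le_exp_of_nonneg (x := a * s) (by positivity)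
  have h2 : 2 / a ^ 2 * ((a * s) ^ 2 / 2) = s ^ 2 := by field_simp
  rw [← h2]
  have : 0 ≤ a * s := by positivity
  gcongr
  linarith

theorem exists_fourthMoment_le {δ r : ℝ} (hδ : 0 < δ) (hr : 1 < r) :
    ∃ a b : ℝ≥0∞, a ≠ ∞ ∧ b ≠ ∞ ∧ ∀ f : E → ℝ≥0∞, IsEvenDensity f →
      ∫⁻ x, ENNReal.ofReal (‖x‖ ^ 4) * f x ≤ a + b * weightedMass δ r f := by
  have hr1 : 0 < r - 1 := by linarith
  -- Now c(r-1) = δ/4, only half of the available exponent δ/2; the other half absorbs |x|⁴.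
  set c := δ / (4 * (r - 1)) with hc
  have hc0 : 0 < c := by positivity
  refine ⟨∫⁻ x : E, ENNReal.ofReal (‖x‖ ^ 4) * ENNReal.ofReal (1 * Real.exp (-c * ‖x‖ ^ 2)),
    ENNReal.ofReal (2 / (δ / 4) ^ 2), ?_, by simp, fun f hf => ?_⟩
  · refine ne_top_of_le_ne_top (b := ENNReal.ofReal (2 / (c / 2) ^ 2) *
      ∫⁻ x : E, ENNReal.ofReal (Real.exp (-(c / 2) * ‖x‖ ^ 2)))
      (ENNReal.mul_ne_top (by simp) (lintegral_exp_neg_mul_sq_norm_lt_top (by positivity)).ne) ?_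
    rw [← lintegral_const_mul _ (by fun_prop)]
    refine lintegral_mono fun x => ?_
    rw [← ENNReal.ofReal_mul (by positivity), ← ENNReal.ofReal_mul (by positivity)]
    apply ENNReal.ofReal_le_ofReal
    have h := sq_le_exp_mul (a := c / 2) (by positivity) (sq_nonneg ‖x‖)
    calc ‖x‖ ^ 4 * (1 * Real.exp (-c * ‖x‖ ^ 2)) =
          (‖x‖ ^ 2) ^ 2 * Real.exp (-c * ‖x‖ ^ 2) := by ring
      _ ≤ 2 / (c / 2) ^ 2 * Real.exp (c / 2 * ‖x‖ ^ 2) * Real.exp (-c * ‖x‖ ^ 2) := by gcongr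
      _ = _ := by rw [mul_assoc, ← Real.exp_add]; ring_nf
  · have hfm := hf.measurable
    refine (lintegral_mul_le_weighted hr.le f (by fun_prop) one_pos c).trans ?_
    gcongr
    unfold weightedMass
    rw [← lintegral_const_mul _ (by fun_prop)]
    refine lintegral_mono fun x => ?_
    rw [← mul_assoc, ← mul_assoc]
    refine mul_le_mul' ?_ le_rfl
    rw [← ENNReal.ofReal_mul (by positivity), ← ENNReal.ofReal_mul (by positivity)]
    apply ENNReal.ofReal_le_ofReal
    have h := sq_le_exp_mul (a := δ / 4) (by positivity) (sq_nonneg ‖x‖)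
    calc ‖x‖ ^ 4 * (1 ^ (1 - r) * Real.exp (c * (r - 1) * ‖x‖ ^ 2)) =
          (‖x‖ ^ 2) ^ 2 * Real.exp (δ / 4 * ‖x‖ ^ 2) := by
          rw [Real.one_rpow, show c * (r - 1) = δ / 4 by rw [hc]; field_simp]; ring
      _ ≤ 2 / (δ / 4) ^ 2 * Real.exp (δ / 4 * ‖x‖ ^ 2) * Real.exp (δ / 4 * ‖x‖ ^ 2) := by gcongr
      _ = _ := by rw [mul_assoc, ← Real.exp_add]; ring_nf

theorem kernelForm_swap (lam δ r : ℝ) {f g : E → ℝ≥0∞} (hf : Measurable f) (hg : Measurable g) :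
    kernelForm lam δ r f g = kernelForm lam δ r g f := by
  unfold kernelForm
  rw [lintegral_lintegral_swap (by fun_prop)]
  refine lintegral_congr fun y => lintegral_congr fun x => ?_
  rw [mul_comm (f x ^ r)]
  unfold expKernel
  rw [real_inner_comm, add_comm (‖x‖ ^ 2)]

/-- The decoupled lower bound is a product of two weighted masses, each bounded below uniformly over
densities. -/
theorem kernelConst_ne_zero (lam : ℝ) {δ r : ℝ} (hδ : 0 < δ) (hr : 1 < r) :
    kernelConst E lam δ r ≠ 0 := by
  obtain ⟨w, hw0, hwt, hw⟩ := exists_le_weightedMass (E := E) hδ hr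
  have : w * w ≤ kernelConst E lam δ r := by
    refine le_iInf fun f => le_iInf fun g => le_iInf fun hf => le_iInf fun hg => ?_
    exact (mul_le_mul' (hw f hf) (hw g hg)).trans
      (weightedMass_mul_le_kernelForm lam δ hf.measurable hg.measurable hf.even)
  exact (lt_of_lt_of_le (by simpa [pos_iff_ne_zero] using hw0) this).ne'

/-- Sublevel sets of `kernelForm` have bounded fourth moments. -/
theorem exists_fourthMoment_bound (lam : ℝ) {δ r : ℝ} (hδ : 0 < δ) (hr : 1 < r) {L : ℝ≥0∞}
    (hL : L ≠ ∞) :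
    ∃ M : ℝ≥0∞, M ≠ ∞ ∧ ∀ f g : E → ℝ≥0∞, IsEvenDensity f → IsEvenDensity g →
      kernelForm lam δ r f g ≤ L → ∫⁻ x, ENNReal.ofReal (‖x‖ ^ 4) * f x ≤ M := by
  obtain ⟨w, hw0, hwt, hw⟩ := exists_le_weightedMass (E := E) hδ hr
  obtain ⟨a, b, ha, hb, h⟩ := exists_fourthMoment_le (E := E) hδ hr
  refine ⟨a + b * (L / w), by finiteness, fun f g hf hg hfg => (h f hf).trans ?_⟩
  gcongr
  rw [ENNReal.le_div_iff_mul_le (Or.inl hw0) (Or.inl hwt)]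
  refine le_trans ?_ hfg
  refine le_trans ?_ (weightedMass_mul_le_kernelForm lam δ hf.measurable hg.measurable hf.even)
  gcongr
  exact hw g hg

end Coercivity

/-! ### Characteristic functions and the central limit theorem. -/

section CosineTransform

variable {E : Type*} [NormedAddCommGroup E] [InnerProductSpace ℝ E] [FiniteDimensional ℝ E]
  [MeasurableSpace E] [BorelSpace E]

/-- The real part `∫ cos ⟪ξ, z⟫ dμ(z)` of the characteristic function. -/
def cosTransform (μ : Measure E) (ξ : E) : ℝ := ∫ z, Real.cos (inner ℝ ξ z) ∂μ

theorem IsEvenDensity.isProbabilityMeasure {f : E → ℝ≥0∞} (hf : IsEvenDensity f) :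
    IsProbabilityMeasure (volume.withDensity f) :=
  ⟨by rw [withDensity_apply _ MeasurableSet.univ, Measure.restrict_univ, hf.lintegral_eq_one]⟩

theorem integrable_cos_inner (μ : Measure E) [IsFiniteMeasure μ] (ξ : E) :
    Integrable (fun z => Real.cos (inner ℝ ξ z)) μ :=
  Integrable.of_bound (by fun_prop) 1 (Filter.Eventually.of_forall fun z => by
    simpa using Real.abs_cos_le_one _)

theorem integrable_sin_inner (μ : Measure E) [IsFiniteMeasure μ] (ξ : E) :
    Integrable (fun z => Real.sin (inner ℝ ξ z)) μ :=
  Integrable.of_bound (by fun_prop) 1 (Filter.Eventually.of_forall fun z => by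
    simpa using Real.abs_sin_le_one _)

theorem abs_cosTransform_le_one (μ : Measure E) [IsProbabilityMeasure μ] (ξ : E) :
    |cosTransform μ ξ| ≤ 1 := by
  have := norm_integral_le_of_norm_le_const (μ := μ) (f := fun z => Real.cos (inner ℝ ξ z)) (C := 1)
    (Filter.Eventually.of_forall fun z => by simpa using Real.abs_cos_le_one _)
  simpa [cosTransform] using this

theorem IsEvenDensity.map_neg {f : E → ℝ≥0∞} (hf : IsEvenDensity f) :
    (volume.withDensity f).map (fun z => -z) = volume.withDensity f := by
  have hfm := hf.measurable
  ext s hs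
  rw [Measure.map_apply measurable_neg hs, withDensity_apply _ (measurable_neg hs),
    withDensity_apply _ hs, ← lintegral_indicator (measurable_neg hs), ← lintegral_indicator hs,
    ← lintegral_neg_eq_self]
  refine lintegral_congr fun z => ?_
  by_cases h : z ∈ s <;> simp [Set.indicator, h, hf.even]

theorem IsEvenDensity.integral_sin_eq_zero {f : E → ℝ≥0∞} (hf : IsEvenDensity f) (ξ : E) :
    ∫ z, Real.sin (inner ℝ ξ z) ∂(volume.withDensity f) = 0 := by
  have h : ∫ z, Real.sin (inner ℝ ξ z) ∂(volume.withDensity f) =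
      -∫ z, Real.sin (inner ℝ ξ z) ∂(volume.withDensity f) := by
    conv_lhs => rw [← hf.map_neg]
    rw [integral_map (by fun_prop) (by fun_prop)]
    simp [inner_neg_right, integral_neg]
  linarith

theorem withDensity_selfRot {f : E → ℝ≥0∞} (hf : IsEvenDensity f) :
    volume.withDensity (selfRot f) =
      ((volume.withDensity f).prod (volume.withDensity f)).map
        (fun z : E × E => (√2)⁻¹ • (z.1 - z.2)) := by
  have hfm := hf.measurable
  have := hf.isProbabilityMeasure
  ext s hs
  have hm : Measurable (fun z : E × E => (√2)⁻¹ • (z.1 - z.2)) := by fun_prop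
  have hs' : Measurable (s.indicator (fun _ => (1 : ℝ≥0∞))) := measurable_const.indicator hs
  have h1 : ∀ y x : E, (√2)⁻¹ • ((√2)⁻¹ • (x + y) - (√2)⁻¹ • (x - y)) = y := by
    intro y x
    have : (√2)⁻¹ * (√2)⁻¹ = (1 / 2 : ℝ) := by
      rw [← mul_inv, Real.mul_self_sqrt (by norm_num)]; norm_num
    rw [← smul_sub, smul_smul, this]
    module
  rw [Measure.map_apply hm hs, withDensity_apply _ hs, ← lintegral_indicator hs,
    ← lintegral_indicator_one (hm hs), lintegral_prod _ (measurable_one.indicator (hm hs)).aemeasurable]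
  calc ∫⁻ y, s.indicator (selfRot f) y
      = ∫⁻ y, ∫⁻ x, s.indicator (fun _ => (1 : ℝ≥0∞))
          ((√2)⁻¹ • ((√2)⁻¹ • (x + y) - (√2)⁻¹ • (x - y))) *
          (f ((√2)⁻¹ • (x + y)) * f ((√2)⁻¹ • (x - y))) := by
        refine lintegral_congr fun y => ?_
        simp_rw [h1]
        rw [lintegral_const_mul _ (by fun_prop)]
        by_cases h : y ∈ s <;> simp [h, selfRot]
    _ = ∫⁻ a, ∫⁻ b, s.indicator (fun _ => (1 : ℝ≥0∞)) ((√2)⁻¹ • (a - b)) * (f a * f b) :=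
        lintegral_rotation (fun a b => s.indicator (fun _ => (1 : ℝ≥0∞)) ((√2)⁻¹ • (a - b)) *
          (f a * f b)) (by fun_prop)
    _ = _ := by
        have hmi : Measurable fun z : E × E => ((fun z : E × E => (√2)⁻¹ • (z.1 - z.2)) ⁻¹'
            s).indicator (1 : E × E → ℝ≥0∞) z := measurable_one.indicator (hm hs)
        rw [lintegral_withDensity_eq_lintegral_mul _ hfm (by fun_prop)]
        refine lintegral_congr fun a => ?_
        rw [Pi.mul_apply, lintegral_withDensity_eq_lintegral_mul _ hfm (by fun_prop),
          ← lintegral_const_mul _ (by fun_prop)]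
        refine lintegral_congr fun b => ?_
        rw [Pi.mul_apply]
        by_cases h : (√2)⁻¹ • (a - b) ∈ s <;> simp [Set.indicator, h]

/-- For independent X, X' the characteristic function of (X-X')/√2 is a product; the sine terms of
cos(α-β) vanish by evenness. -/
theorem cosTransform_selfRot {f : E → ℝ≥0∞} (hf : IsEvenDensity f) (ξ : E) :
    cosTransform (volume.withDensity (selfRot f)) ξ =
      cosTransform (volume.withDensity f) ((√2)⁻¹ • ξ) ^ 2 := by
  have := hf.isProbabilityMeasure
  unfold cosTransform
  rw [withDensity_selfRot hf, integral_map (by fun_prop) (by fun_prop)]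
  have h1 : ∀ z : E × E, Real.cos (inner ℝ ξ ((√2)⁻¹ • (z.1 - z.2))) =
      Real.cos (inner ℝ ((√2)⁻¹ • ξ) z.1) * Real.cos (inner ℝ ((√2)⁻¹ • ξ) z.2) +
      Real.sin (inner ℝ ((√2)⁻¹ • ξ) z.1) * Real.sin (inner ℝ ((√2)⁻¹ • ξ) z.2) := by
    intro z
    rw [← Real.cos_sub]
    simp [inner_smul_left, inner_smul_right, inner_sub_right, mul_sub]
  simp_rw [h1]
  rw [integral_add ((integrable_cos_inner _ _).mul_prod (integrable_cos_inner _ _))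
    ((integrable_sin_inner _ _).mul_prod (integrable_sin_inner _ _)),
    integral_prod_mul (fun z => Real.cos (inner ℝ ((√2)⁻¹ • ξ) z))
      (fun z => Real.cos (inner ℝ ((√2)⁻¹ • ξ) z)),
    integral_prod_mul (fun z => Real.sin (inner ℝ ((√2)⁻¹ • ξ) z))
      (fun z => Real.sin (inner ℝ ((√2)⁻¹ • ξ) z)), hf.integral_sin_eq_zero]
  ring

theorem cosTransform_iterate_selfRot {f : E → ℝ≥0∞} (hf : IsEvenDensity f) (k : ℕ) (ξ : E) :
    cosTransform (volume.withDensity (selfRot^[k] f)) ξ =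
      cosTransform (volume.withDensity f) ((√2)⁻¹ ^ k • ξ) ^ (2 ^ k) := by
  induction k generalizing ξ with
  | zero => simp
  | succ k ih =>
    rw [Function.iterate_succ_apply', cosTransform_selfRot (iterate_selfRot_isEvenDensity hf k), ih,
      ← pow_mul, smul_smul, ← pow_succ, ← pow_succ]

/-- Taylor's bound for |t| ≤ 1; for larger t every term is dominated by t⁴. The constant 3 is not
optimised, but the bound is global, so it can be integrated without truncation. -/
theorem abs_cos_sub_le (t : ℝ) : |Real.cos t - (1 - t ^ 2 / 2)| ≤ 3 * t ^ 4 := by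
  rcases le_total |t| 1 with h | h
  · refine (Real.cos_bound h).trans ?_
    have : |t| ^ 4 = t ^ 4 := by rw [← abs_pow, abs_of_nonneg (by positivity)]
    rw [this]
    nlinarith [show 0 ≤ t ^ 4 by positivity]
  · have h1 := Real.abs_cos_le_one t
    have h2 : 1 ≤ t ^ 2 := by rw [← sq_abs]; nlinarith
    have h3 : t ^ 2 ≤ t ^ 4 := by nlinarith
    rw [abs_le] at h1 ⊢
    constructor <;> linarith

theorem integrable_inner_sq {μ : Measure E} [IsFiniteMeasure μ]
    (hμ : Integrable (fun z => ‖z‖ ^ 4) μ) (u v : E) :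
    Integrable (fun z => inner ℝ u z * inner ℝ v z) μ := by
  refine Integrable.mono' (((hμ.add (integrable_const 1)).const_mul (‖u‖ * ‖v‖)))
    (by fun_prop) (Filter.Eventually.of_forall fun z => ?_)
  rw [norm_mul]
  have h1 : ‖z‖ ^ 2 ≤ ‖z‖ ^ 4 + 1 := by nlinarith [sq_nonneg (‖z‖ ^ 2 - 1), sq_nonneg (‖z‖ ^ 2)]
  calc _ ≤ (‖u‖ * ‖z‖) * (‖v‖ * ‖z‖) := by
        gcongr <;> exact norm_inner_le_norm _ _
    _ = (‖u‖ * ‖v‖) * ‖z‖ ^ 2 := by ring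
    _ ≤ _ := by simp only [Pi.add_apply]; gcongr

theorem abs_cosTransform_sub_le {μ : Measure E} [IsProbabilityMeasure μ]
    (hμ : Integrable (fun z => ‖z‖ ^ 4) μ) (ξ : E) :
    |cosTransform μ ξ - (1 - (∫ z, inner ℝ ξ z * inner ℝ ξ z ∂μ) / 2)| ≤
      3 * ‖ξ‖ ^ 4 * ∫ z, ‖z‖ ^ 4 ∂μ := by
  have hq := integrable_inner_sq hμ ξ ξ
  have h1 : cosTransform μ ξ - (1 - (∫ z, inner ℝ ξ z * inner ℝ ξ z ∂μ) / 2) =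
      ∫ z, (Real.cos (inner ℝ ξ z) - (1 - (inner ℝ ξ z * inner ℝ ξ z) / 2)) ∂μ := by
    have h2 : Integrable (fun z => 1 - (inner ℝ ξ z * inner ℝ ξ z : ℝ) / 2) μ :=
      (integrable_const _).sub (hq.div_const _)
    rw [integral_sub (integrable_cos_inner μ ξ) h2,
      integral_sub (integrable_const _) (hq.div_const _), integral_div]
    simp [cosTransform]
  rw [h1, ← integral_const_mul]
  refine (abs_integral_le_integral_abs).trans ?_
  refine integral_mono_of_nonneg (Filter.Eventually.of_forall fun z => abs_nonneg _)
    (hμ.const_mul _) (Filter.Eventually.of_forall fun z => ?_)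
  have h2 := abs_cos_sub_le (inner ℝ ξ z)
  have h3 : (inner ℝ ξ z : ℝ) ^ 4 ≤ (‖ξ‖ * ‖z‖) ^ 4 := by
    have := pow_le_pow_left₀ (abs_nonneg _) (abs_real_inner_le_norm ξ z) 4
    rwa [← abs_pow, abs_of_nonneg (by positivity)] at this
  simp only
  rw [← sq]
  calc _ ≤ _ := h2
    _ ≤ 3 * (‖ξ‖ * ‖z‖) ^ 4 := by gcongr
    _ = _ := by ring

theorem abs_pow_sub_pow_le_mul {a b : ℝ} (ha : |a| ≤ 1) (hb : |b| ≤ 1) (N : ℕ) :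
    |a ^ N - b ^ N| ≤ N * |a - b| := by
  induction N with
  | zero => simp
  | succ N ih =>
    have h : a ^ (N + 1) - b ^ (N + 1) = a * (a ^ N - b ^ N) + (a - b) * b ^ N := by ring
    have hbN : |b ^ N| ≤ 1 := by rw [abs_pow]; exact pow_le_one₀ (abs_nonneg _) hb
    rw [h]
    refine (abs_add_le _ _).trans ?_
    rw [abs_mul, abs_mul]
    push_cast
    nlinarith [abs_nonneg (a ^ N - b ^ N), abs_nonneg (a - b)]

/-- A central limit theorem for triangular arrays, in terms of cosine transforms. -/
theorem tendsto_cosTransform_pow {μ : ℕ → Measure E} (hp : ∀ j, IsProbabilityMeasure (μ j))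
    (hμ : ∀ j, Integrable (fun z => ‖z‖ ^ 4) (μ j)) {M : ℝ} (hM : ∀ j, ∫ z, ‖z‖ ^ 4 ∂(μ j) ≤ M)
    {k : ℕ → ℕ} (hk : Filter.Tendsto k Filter.atTop Filter.atTop) (ξ : E) {Q : ℝ}
    (hQ : Filter.Tendsto (fun j => ∫ z, inner ℝ ξ z * inner ℝ ξ z ∂(μ j)) Filter.atTop (nhds Q)) :
    Filter.Tendsto (fun j => cosTransform (μ j) ((√2)⁻¹ ^ k j • ξ) ^ (2 ^ k j)) Filter.atTop
      (nhds (Real.exp (-Q / 2))) := by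
  set q : ℕ → ℝ := fun j => ∫ z, inner ℝ ξ z * inner ℝ ξ z ∂(μ j) with hq
  have hq0 : ∀ j, 0 ≤ q j := fun j => integral_nonneg fun z => mul_self_nonneg _
  have hN : Filter.Tendsto (fun j => ((2 : ℝ) ^ k j)⁻¹) Filter.atTop (nhds 0) :=
    tendsto_inv_atTop_zero.comp
      ((tendsto_pow_atTop_atTop_of_one_lt (by norm_num : (1 : ℝ) < 2)).comp hk)
  have hexp : Filter.Tendsto (fun j => Real.exp (-q j / 2)) Filter.atTop
      (nhds (Real.exp (-Q / 2))) := by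
    exact (Real.continuous_exp.tendsto _).comp ((hQ.neg).div_const 2)
  have ht : Filter.Tendsto (fun j => q j / 2 * ((2 : ℝ) ^ k j)⁻¹) Filter.atTop (nhds 0) := by
    simpa using (hQ.div_const 2).mul hN
  have hbound : Filter.Tendsto (fun j => (3 * ‖ξ‖ ^ 4 * M + (q j / 2) ^ 2) * ((2 : ℝ) ^ k j)⁻¹)
      Filter.atTop (nhds 0) := by
    simpa using (((hQ.div_const 2).pow 2).const_add (3 * ‖ξ‖ ^ 4 * M)).mul hN
  have hdiff : Filter.Tendsto (fun j => cosTransform (μ j) ((√2)⁻¹ ^ k j • ξ) ^ (2 ^ k j) -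
      Real.exp (-q j / 2)) Filter.atTop (nhds 0) := by
    refine squeeze_zero_norm' ?_ hbound
    filter_upwards [ht.eventually_le_const (show (0 : ℝ) < 1 by norm_num)] with j hj
    have := hp j
    set N : ℝ := 2 ^ k j with hNdef
    have hN0 : 0 < N := by positivity
    set t := q j / 2 * N⁻¹ with htdef
    have ht0 : 0 ≤ t := by have := hq0 j; positivity
    have hs2 : ((√2)⁻¹ ^ k j) ^ 2 = N⁻¹ := by
      rw [← pow_mul, mul_comm, pow_mul, inv_pow, Real.sq_sqrt (by norm_num), inv_pow]
    have h1 := abs_cosTransform_sub_le (hμ j) ((√2)⁻¹ ^ k j • ξ)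
    have h2 : (∫ z, inner ℝ ((√2)⁻¹ ^ k j • ξ) z * inner ℝ ((√2)⁻¹ ^ k j • ξ) z ∂(μ j)) / 2 = t := by
      simp_rw [inner_smul_left, conj_trivial, show ∀ a b : ℝ, a * b * (a * b) = a ^ 2 * (b * b) by
        intros; ring, hs2]
      rw [integral_const_mul, htdef, hq]
      ring
    have h3 : ‖(√2)⁻¹ ^ k j • ξ‖ ^ 4 = N⁻¹ ^ 2 * ‖ξ‖ ^ 4 := by
      rw [norm_smul, mul_pow, Real.norm_eq_abs, abs_of_pos (by positivity), ← hs2]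
      ring
    rw [h2, h3] at h1
    have h4 : |Real.exp (-t) - (1 - t)| ≤ t ^ 2 := by
      have := Real.abs_exp_sub_one_sub_id_le (x := -t) (by rw [abs_neg, abs_of_nonneg ht0]; exact hj)
      rwa [show Real.exp (-t) - 1 - -t = Real.exp (-t) - (1 - t) by ring, neg_sq] at this
    have h5 : Real.exp (-q j / 2) = Real.exp (-t) ^ (2 ^ k j) := by
      rw [← Real.exp_nat_mul]
      congr 1
      push_cast
      rw [← hNdef, htdef]
      field_simp
    rw [h5, Real.norm_eq_abs]
    refine (abs_pow_sub_pow_le_mul (abs_cosTransform_le_one _ _) (by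
      rw [Real.abs_exp]; exact Real.exp_le_one_iff.2 (by linarith)) _).trans ?_
    push_cast
    rw [← hNdef]
    -- Each factor differs from e^{-t} by O(N⁻²), uniformly in j by the fourth moment bound, so the
    -- N-th powers differ by O(N⁻¹).
    have h6 : |cosTransform (μ j) ((√2)⁻¹ ^ k j • ξ) - Real.exp (-t)| ≤
        3 * (N⁻¹ ^ 2 * ‖ξ‖ ^ 4) * M + t ^ 2 := by
      refine (abs_sub_le _ (1 - t) _).trans ?_
      rw [abs_sub_comm (1 - t)]
      refine add_le_add (h1.trans ?_) h4
      gcongr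
      exact hM j
    calc _ ≤ N * (3 * (N⁻¹ ^ 2 * ‖ξ‖ ^ 4) * M + t ^ 2) := by gcongr
      _ = _ := by rw [htdef]; field_simp
  simpa using hdiff.add hexp

end CosineTransform

/-! ### Covariance matrices and extraction of a Gaussian limit. -/

section Covariance

variable {n : ℕ}

local notation "𝔼" => EuclideanSpace ℝ (Fin n)

/-- The second moment matrix. -/
def secondMoment (μ : Measure 𝔼) : Matrix (Fin n) (Fin n) ℝ :=
  Matrix.of fun i k => ∫ z, z i * z k ∂μ

theorem inner_single_eq (i : Fin n) (z : 𝔼) :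
    inner ℝ (EuclideanSpace.single i (1 : ℝ)) z = z i := by
  simp [EuclideanSpace.inner_single_left]

theorem integrable_coord_mul {μ : Measure 𝔼} [IsFiniteMeasure μ]
    (hμ : Integrable (fun z => ‖z‖ ^ 4) μ) (i k : Fin n) :
    Integrable (fun z : 𝔼 => z i * z k) μ := by
  simpa [inner_single_eq] using
    integrable_inner_sq hμ (EuclideanSpace.single i (1 : ℝ)) (EuclideanSpace.single k (1 : ℝ))

theorem integral_inner_sq_eq {μ : Measure 𝔼} [IsFiniteMeasure μ]
    (hμ : Integrable (fun z => ‖z‖ ^ 4) μ) (ξ : 𝔼) :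
    ∫ z, inner ℝ ξ z * inner ℝ ξ z ∂μ = ξ.ofLp ⬝ᵥ (secondMoment μ).mulVec ξ.ofLp := by
  have h1 : ∀ z : 𝔼, inner ℝ ξ z * inner ℝ ξ z = ∑ i, ∑ k, ξ i * (ξ k * (z i * z k)) := by
    intro z
    rw [PiLp.inner_apply, Finset.sum_mul_sum]
    refine Finset.sum_congr rfl fun i _ => Finset.sum_congr rfl fun k _ => ?_
    simp
    ring
  simp_rw [h1]
  rw [integral_finsetSum _ fun i _ => integrable_finsetSum _ fun k _ =>
    ((integrable_coord_mul hμ i k).const_mul _).const_mul _]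
  simp only [dotProduct, Matrix.mulVec, secondMoment, Matrix.of_apply, Finset.mul_sum]
  refine Finset.sum_congr rfl fun i _ => ?_
  rw [integral_finsetSum _ fun k _ => ((integrable_coord_mul hμ i k).const_mul _).const_mul _]
  refine Finset.sum_congr rfl fun k _ => ?_
  rw [integral_const_mul, integral_const_mul]
  ring

theorem abs_secondMoment_le {μ : Measure 𝔼} [IsProbabilityMeasure μ]
    (hμ : Integrable (fun z => ‖z‖ ^ 4) μ) (i k : Fin n) :
    |secondMoment μ i k| ≤ ∫ z, ‖z‖ ^ 4 ∂μ + 1 := by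
  have h2 : ∫ z, ‖z‖ ^ 4 ∂μ + 1 = ∫ z, (‖z‖ ^ 4 + 1) ∂μ := by
    rw [integral_add hμ (integrable_const _)]; simp
  rw [h2]
  refine (abs_integral_le_integral_abs).trans ?_
  refine integral_mono_of_nonneg (Filter.Eventually.of_forall fun z => abs_nonneg _)
    (hμ.add (integrable_const _)) (Filter.Eventually.of_forall fun z => ?_)
  have h1 : ‖z‖ ^ 2 ≤ ‖z‖ ^ 4 + 1 := by nlinarith [sq_nonneg (‖z‖ ^ 2 - 1), sq_nonneg (‖z‖ ^ 2)]
  simp only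
  rw [abs_mul]
  calc _ ≤ ‖z‖ * ‖z‖ := by
        gcongr <;> exact PiLp.norm_apply_le z _
    _ = ‖z‖ ^ 2 := by ring
    _ ≤ _ := h1

theorem integrable_norm_pow_four {f : 𝔼 → ℝ≥0∞} (hf : IsEvenDensity f) {M : ℝ≥0∞} (hM : M ≠ ∞)
    (h : ∫⁻ x, ENNReal.ofReal (‖x‖ ^ 4) * f x ≤ M) :
    Integrable (fun z => ‖z‖ ^ 4) (volume.withDensity f) ∧
      ∫ z, ‖z‖ ^ 4 ∂(volume.withDensity f) ≤ M.toReal := by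
  have hfm := hf.measurable
  have h1 : ∫⁻ z, ENNReal.ofReal (‖z‖ ^ 4) ∂(volume.withDensity f) ≤ M := by
    rw [lintegral_withDensity_eq_lintegral_mul _ hfm (by fun_prop)]
    refine le_trans (le_of_eq (lintegral_congr fun x => ?_)) h
    rw [Pi.mul_apply, mul_comm]
  have hnn : 0 ≤ᵐ[volume.withDensity f] fun z : 𝔼 => ‖z‖ ^ 4 :=
    Filter.Eventually.of_forall fun z => by positivity
  refine ⟨⟨by fun_prop, ?_⟩, ?_⟩
  · rw [hasFiniteIntegral_iff_ofReal hnn]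
    exact lt_of_le_of_lt h1 hM.lt_top
  · rw [integral_eq_lintegral_of_nonneg_ae hnn (by fun_prop)]
    exact ENNReal.toReal_mono hM h1

theorem posSemidef_of_tendsto {μ : ℕ → Measure 𝔼} (hp : ∀ j, IsProbabilityMeasure (μ j))
    (hμ : ∀ j, Integrable (fun z => ‖z‖ ^ 4) (μ j)) {A : Matrix (Fin n) (Fin n) ℝ}
    (hA : ∀ i k, Filter.Tendsto (fun j => secondMoment (μ j) i k) Filter.atTop (nhds (A i k))) :
    A.PosSemidef ∧ ∀ ξ : 𝔼, Filter.Tendsto (fun j => ∫ z, inner ℝ ξ z * inner ℝ ξ z ∂(μ j))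
      Filter.atTop (nhds (ξ.ofLp ⬝ᵥ A.mulVec ξ.ofLp)) := by
  have hlim : ∀ ξ : 𝔼, Filter.Tendsto (fun j => ∫ z, inner ℝ ξ z * inner ℝ ξ z ∂(μ j))
      Filter.atTop (nhds (ξ.ofLp ⬝ᵥ A.mulVec ξ.ofLp)) := by
    intro ξ
    have := hp
    simp_rw [fun j => integral_inner_sq_eq (hμ j) ξ]
    simp only [dotProduct, Matrix.mulVec]
    exact tendsto_finsetSum _ fun i _ => (tendsto_finsetSum _ fun k _ =>
      (hA i k).mul_const _).const_mul _
  refine ⟨Matrix.PosSemidef.of_dotProduct_mulVec_nonneg ?_ ?_, hlim⟩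
  · ext i k
    rw [Matrix.conjTranspose_apply, star_trivial]
    refine tendsto_nhds_unique (hA k i) ?_
    simpa [secondMoment, mul_comm] using hA i k
  · intro x
    refine ge_of_tendsto' (hlim (WithLp.toLp 2 x)) fun j => ?_
    exact integral_nonneg fun z => mul_self_nonneg _

/-- Along a subsequence, the `j`-fold doublings of `f j` and `g j` converge to Gaussians. -/
theorem exists_subseq_tendsto_cosTransform {f g : ℕ → 𝔼 → ℝ≥0∞} (hf : ∀ j, IsEvenDensity (f j))
    (hg : ∀ j, IsEvenDensity (g j)) {M : ℝ≥0∞} (hM : M ≠ ∞)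
    (hfM : ∀ j, ∫⁻ x, ENNReal.ofReal (‖x‖ ^ 4) * f j x ≤ M)
    (hgM : ∀ j, ∫⁻ x, ENNReal.ofReal (‖x‖ ^ 4) * g j x ≤ M) :
    ∃ φ : ℕ → ℕ, StrictMono φ ∧ ∃ A B : Matrix (Fin n) (Fin n) ℝ, A.PosSemidef ∧ B.PosSemidef ∧
      (∀ ξ, Filter.Tendsto
        (fun j => cosTransform (volume.withDensity (selfRot^[φ j] (f (φ j)))) ξ) Filter.atTop
        (nhds (Real.exp (-(ξ.ofLp ⬝ᵥ A.mulVec ξ.ofLp) / 2)))) ∧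
      (∀ ξ, Filter.Tendsto
        (fun j => cosTransform (volume.withDensity (selfRot^[φ j] (g (φ j)))) ξ) Filter.atTop
        (nhds (Real.exp (-(ξ.ofLp ⬝ᵥ B.mulVec ξ.ofLp) / 2)))) := by
  have hpf := fun j => (hf j).isProbabilityMeasure
  have hpg := fun j => (hg j).isProbabilityMeasure
  have hif := fun j => integrable_norm_pow_four (hf j) hM (hfM j)
  have hig := fun j => integrable_norm_pow_four (hg j) hM (hgM j)
  set X : ℕ → (Fin n → Fin n → ℝ) × (Fin n → Fin n → ℝ) := fun j =>
    (fun i k => secondMoment (volume.withDensity (f j)) i k,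
      fun i k => secondMoment (volume.withDensity (g j)) i k) with hX
  have hbd : ∀ j, X j ∈ Metric.closedBall (0 : (Fin n → Fin n → ℝ) × (Fin n → Fin n → ℝ))
      (M.toReal + 1) := by
    intro j
    have hM0 : 0 ≤ M.toReal + 1 := by positivity
    rw [mem_closedBall_zero_iff, Prod.norm_def, max_le_iff]
    constructor <;> refine (pi_norm_le_iff_of_nonneg hM0).2 fun i =>
      (pi_norm_le_iff_of_nonneg hM0).2 fun k => ?_
    · exact (abs_secondMoment_le (hif j).1 i k).trans (by linarith [(hif j).2])
    · exact (abs_secondMoment_le (hig j).1 i k).trans (by linarith [(hig j).2])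
  -- Bolzano–Weierstrass for the pair of covariance matrices of the undoubled densities, bounded by
  -- the fourth moments. The limits may be degenerate; later mollification repairs this.
  obtain ⟨AB, -, φ, hφ, hlim⟩ := tendsto_subseq_of_bounded Metric.isBounded_closedBall hbd
  have hA : ∀ i k, Filter.Tendsto (fun j => secondMoment (volume.withDensity (f (φ j))) i k)
      Filter.atTop (nhds (AB.1 i k)) := fun i k =>
    tendsto_pi_nhds.1 (tendsto_pi_nhds.1 ((continuous_fst.tendsto _).comp hlim) i) k
  have hB : ∀ i k, Filter.Tendsto (fun j => secondMoment (volume.withDensity (g (φ j))) i k)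
      Filter.atTop (nhds (AB.2 i k)) := fun i k =>
    tendsto_pi_nhds.1 (tendsto_pi_nhds.1 ((continuous_snd.tendsto _).comp hlim) i) k
  obtain ⟨hAp, hAl⟩ := posSemidef_of_tendsto (A := Matrix.of AB.1) (fun j => hpf (φ j))
    (fun j => (hif (φ j)).1) hA
  obtain ⟨hBp, hBl⟩ := posSemidef_of_tendsto (A := Matrix.of AB.2) (fun j => hpg (φ j))
    (fun j => (hig (φ j)).1) hB
  refine ⟨φ, hφ, Matrix.of AB.1, Matrix.of AB.2, hAp, hBp, fun ξ => ?_, fun ξ => ?_⟩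
  · simp_rw [fun j => cosTransform_iterate_selfRot (hf (φ j)) (φ j) ξ]
    exact tendsto_cosTransform_pow (fun j => hpf (φ j)) (fun j => (hif (φ j)).1)
      (fun j => (hif (φ j)).2) hφ.tendsto_atTop ξ (hAl ξ)
  · simp_rw [fun j => cosTransform_iterate_selfRot (hg (φ j)) (φ j) ξ]
    exact tendsto_cosTransform_pow (fun j => hpg (φ j)) (fun j => (hig (φ j)).1)
      (fun j => (hig (φ j)).2) hφ.tendsto_atTop ξ (hBl ξ)

end Covariance

/-! ### Gaussian densities, Fourier inversion and mollified densities. -/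

section GaussianDensity

variable {n : ℕ}

local notation "𝔼" => EuclideanSpace ℝ (Fin n)

@[fun_prop]
theorem continuous_gaussianDensity (β : ℝ) : Continuous (gaussianDensity (n := n) β) := by
  unfold gaussianDensity; fun_prop

@[fun_prop]
theorem continuous_stdDensity : Continuous (stdDensity (n := n)) := by
  unfold stdDensity; fun_prop

@[fun_prop]
theorem measurable_gaussianDensity (β : ℝ) : Measurable (gaussianDensity (n := n) β) :=
  (continuous_gaussianDensity β).measurable

@[fun_prop]
theorem measurable_stdDensity : Measurable (stdDensity (n := n)) :=
  continuous_stdDensity.measurable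

theorem gaussianDensity_pos {β : ℝ} (hβ : 0 < β) (x : 𝔼) : 0 < gaussianDensity β x := by
  unfold gaussianDensity; positivity

theorem stdDensity_pos (x : 𝔼) : 0 < stdDensity x := by
  unfold stdDensity; positivity

theorem stdDensity_eq_gaussianDensity (x : 𝔼) : stdDensity x = gaussianDensity 1 x := by
  simp [stdDensity, gaussianDensity]

theorem gaussianDensity_neg (β : ℝ) (x : 𝔼) : gaussianDensity β (-x) = gaussianDensity β x := by
  simp [gaussianDensity]

theorem two_pi_inv_pow_mul {β : ℝ} (hβ : 0 < β) :
    ((2 * Real.pi) ^ n)⁻¹ * (Real.pi / (β / 2)) ^ ((n : ℝ) / 2) =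
      (2 * Real.pi * β) ^ (-((n : ℝ) / 2)) := by
  have hpi := Real.pi_pos
  rw [show Real.pi / (β / 2) = 2 * Real.pi / β by field_simp, Real.div_rpow (by positivity) hβ.le,
    Real.rpow_neg (by positivity), Real.mul_rpow (by positivity) hβ.le]
  have h : (2 * Real.pi) ^ n = (2 * Real.pi) ^ ((n : ℝ) / 2) * (2 * Real.pi) ^ ((n : ℝ) / 2) := by
    rw [← Real.rpow_add (by positivity), add_halves, Real.rpow_natCast]
  rw [h]
  have : (0 : ℝ) < (2 * Real.pi) ^ ((n : ℝ) / 2) := by positivity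
  have : (0 : ℝ) < β ^ ((n : ℝ) / 2) := by positivity
  field_simp

theorem integrable_exp_neg_mul_sq_norm {b : ℝ} (hb : 0 < b) :
    Integrable (fun v : 𝔼 => Real.exp (-b * ‖v‖ ^ 2)) := by
  refine not_imp_comm.mp integral_undef ?_
  rw [GaussianFourier.integral_rexp_neg_mul_sq_norm hb]
  have := Real.pi_pos
  positivity

theorem integral_cos_mul_exp {b : ℝ} (hb : 0 < b) (x : 𝔼) :
    ∫ ξ : 𝔼, Real.cos (inner ℝ ξ x) * Real.exp (-b * ‖ξ‖ ^ 2) =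
      (Real.pi / b) ^ ((n : ℝ) / 2) * Real.exp (-(‖x‖ ^ 2 / (4 * b))) := by
  have hpi := Real.pi_pos
  have h := GaussianFourier.integral_cexp_neg_mul_sq_norm_add_of_euclideanSpace (b := (b : ℂ))
    (by simpa using hb) Complex.I x
  have hre := congrArg Complex.re h
  have hint : Integrable fun v : 𝔼 => Complex.exp (-b * ‖v‖ ^ 2 + Complex.I * (inner ℝ x v : ℝ)) := by
    refine (integrable_exp_neg_mul_sq_norm (n := n) hb).mono' (by fun_prop)
      (Filter.Eventually.of_forall fun v => ?_)
    rw [Complex.norm_exp]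
    apply le_of_eq
    congr 1
    simp [← Complex.ofReal_pow]
  rw [← RCLike.re_eq_complex_re, ← integral_re hint] at hre
  convert! hre using 1
  · refine integral_congr_ae (Filter.Eventually.of_forall fun v => ?_)
    simp only [RCLike.re_eq_complex_re]
    rw [Complex.exp_re]
    simp [← Complex.ofReal_pow, mul_comm, real_inner_comm]
  · rw [RCLike.re_eq_complex_re, ← Complex.ofReal_div]
    rw [show ((Fintype.card (Fin n) : ℂ) / 2) = (((n : ℝ) / 2 : ℝ) : ℂ) by simp,
      ← Complex.ofReal_cpow (by positivity), Complex.re_ofReal_mul]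
    congr 1
    rw [Complex.I_sq, show (-1 * (‖x‖ : ℂ) ^ 2 / (4 * b)) = ((-(‖x‖ ^ 2 / (4 * b)) : ℝ) : ℂ) by
      push_cast; ring, Complex.exp_ofReal_re]

theorem integral_gaussianDensity {β : ℝ} (hβ : 0 < β) :
    ∫ x : 𝔼, gaussianDensity β x = 1 := by
  have hpi := Real.pi_pos
  have h := integral_cos_mul_exp (n := n) (b := (2 * β)⁻¹) (by positivity) 0
  simp only [inner_zero_right, Real.cos_zero, one_mul, norm_zero] at h
  unfold gaussianDensity
  rw [integral_const_mul]
  simp_rw [show ∀ x : 𝔼, -(‖x‖ ^ 2 / (2 * β)) = -(2 * β)⁻¹ * ‖x‖ ^ 2 by intro x; ring]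
  rw [h, show Real.pi / (2 * β)⁻¹ = 2 * Real.pi * β by field_simp,
    Real.rpow_neg (by positivity)]
  have : (0 : ℝ) < (2 * Real.pi * β) ^ ((n : ℝ) / 2) := by positivity
  simp [this.ne']

theorem integrable_gaussianDensity {β : ℝ} (hβ : 0 < β) :
    Integrable (gaussianDensity (n := n) β) := by
  refine not_imp_comm.mp integral_undef ?_
  rw [integral_gaussianDensity hβ]
  exact one_ne_zero

theorem lintegral_gaussianDensity {β : ℝ} (hβ : 0 < β) :
    ∫⁻ x : 𝔼, ENNReal.ofReal (gaussianDensity β x) = 1 := by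
  rw [← ofReal_integral_eq_lintegral_ofReal (integrable_gaussianDensity hβ)
    (Filter.Eventually.of_forall fun x => (gaussianDensity_pos hβ x).le),
    integral_gaussianDensity hβ, ENNReal.ofReal_one]

theorem gaussianDensity_eq_integral_cos {β : ℝ} (hβ : 0 < β) (x : 𝔼) :
    gaussianDensity β x =
      ((2 * Real.pi) ^ n)⁻¹ * ∫ ξ : 𝔼, Real.cos (inner ℝ ξ x) * Real.exp (-(β / 2) * ‖ξ‖ ^ 2) := by
  rw [integral_cos_mul_exp (by positivity), ← mul_assoc, two_pi_inv_pow_mul hβ, gaussianDensity]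
  congr 4
  ring

/-- Convolution with the centred Gaussian of variance `ε`. -/
def gaussConv (ε : ℝ) (f : 𝔼 → ℝ≥0∞) (x : 𝔼) : ℝ≥0∞ :=
  ∫⁻ z, f z * ENNReal.ofReal (gaussianDensity ε (x - z))

@[fun_prop]
theorem measurable_gaussConv (ε : ℝ) {f : 𝔼 → ℝ≥0∞} (hf : Measurable f) :
    Measurable (gaussConv ε f) := by
  unfold gaussConv; fun_prop

theorem gaussianDensity_le {β : ℝ} (hβ : 0 < β) (x : 𝔼) :
    gaussianDensity β x ≤ (2 * Real.pi * β) ^ (-((n : ℝ) / 2)) := by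
  have hpi := Real.pi_pos
  unfold gaussianDensity
  refine mul_le_of_le_one_right (by positivity) (Real.exp_le_one_iff.2 ?_)
  have : 0 ≤ ‖x‖ ^ 2 / (2 * β) := by positivity
  linarith

/-- Write the Gaussian as a Fourier integral and use Fubini: a mollified density is a function of
the cosine transform alone, with an integrable Gaussian factor. -/
theorem gaussConv_eq_ofReal {ε : ℝ} (hε : 0 < ε) {f : 𝔼 → ℝ≥0∞} (hf : IsEvenDensity f) (x : 𝔼) :
    gaussConv ε f x = ENNReal.ofReal (((2 * Real.pi) ^ n)⁻¹ * ∫ ξ : 𝔼,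
      Real.cos (inner ℝ ξ x) * cosTransform (volume.withDensity f) ξ *
        Real.exp (-(ε / 2) * ‖ξ‖ ^ 2)) := by
  have hfm := hf.measurable
  have := hf.isProbabilityMeasure
  set μ := volume.withDensity f with hμ
  have hi : Integrable (fun z => gaussianDensity ε (x - z)) μ :=
    Integrable.of_bound (by fun_prop) _ (Filter.Eventually.of_forall fun z => by
      rw [Real.norm_of_nonneg (gaussianDensity_pos hε _).le]; exact gaussianDensity_le hε _)
  have h1 : gaussConv ε f x = ENNReal.ofReal (∫ z, gaussianDensity ε (x - z) ∂μ) := by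
    rw [ofReal_integral_eq_lintegral_ofReal hi
      (Filter.Eventually.of_forall fun x => (gaussianDensity_pos hε _).le), hμ,
      lintegral_withDensity_eq_lintegral_mul _ hfm (by fun_prop)]
    rfl
  rw [h1]
  congr 1
  simp_rw [gaussianDensity_eq_integral_cos hε, integral_const_mul]
  congr 1
  have hprod : Integrable (Function.uncurry fun (z ξ : 𝔼) =>
      Real.cos (inner ℝ ξ (x - z)) * Real.exp (-(ε / 2) * ‖ξ‖ ^ 2)) (μ.prod volume) := by
    refine (((integrable_const (1 : ℝ)).mul_prod
      (integrable_exp_neg_mul_sq_norm (n := n) (b := ε / 2) (by positivity)))).mono'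
      (by unfold Function.uncurry; fun_prop) (Filter.Eventually.of_forall fun p => ?_)
    rw [Function.uncurry, norm_mul]
    refine mul_le_mul ?_ (by simp) (norm_nonneg _) zero_le_one
    simpa using Real.abs_cos_le_one _
  rw [integral_integral_swap hprod]
  refine integral_congr_ae (Filter.Eventually.of_forall fun ξ => ?_)
  simp only
  rw [integral_mul_const]
  congr 1
  simp_rw [inner_sub_right, Real.cos_sub]
  rw [integral_add ((integrable_cos_inner μ ξ).const_mul _)
    ((integrable_sin_inner μ ξ).const_mul _), integral_const_mul, integral_const_mul,
    hf.integral_sin_eq_zero, mul_zero, add_zero]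
  rfl

/-- Cosine transforms are bounded by 1, so the Gaussian factor dominates. Mollification thus
upgrades weak convergence to pointwise convergence of densities. -/
theorem tendsto_gaussConv {ε : ℝ} (hε : 0 < ε) {f : ℕ → 𝔼 → ℝ≥0∞} (hf : ∀ j, IsEvenDensity (f j))
    {φ : 𝔼 → ℝ} (h : ∀ ξ, Filter.Tendsto (fun j => cosTransform (volume.withDensity (f j)) ξ)
      Filter.atTop (nhds (φ ξ))) (x : 𝔼) :
    Filter.Tendsto (fun j => gaussConv ε (f j) x) Filter.atTop
      (nhds (ENNReal.ofReal (((2 * Real.pi) ^ n)⁻¹ * ∫ ξ : 𝔼,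
        Real.cos (inner ℝ ξ x) * φ ξ * Real.exp (-(ε / 2) * ‖ξ‖ ^ 2)))) := by
  simp_rw [fun j => gaussConv_eq_ofReal hε (hf j) x]
  refine ENNReal.tendsto_ofReal (Filter.Tendsto.const_mul _ ?_)
  refine tendsto_integral_of_dominated_convergence (fun ξ => Real.exp (-(ε / 2) * ‖ξ‖ ^ 2))
    (fun j => ?_) (integrable_exp_neg_mul_sq_norm (by positivity)) (fun j => ?_) ?_
  · have := (hf j).isProbabilityMeasure
    have hm : StronglyMeasurable (cosTransform (volume.withDensity (f j))) := by
      unfold cosTransform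
      exact (Continuous.stronglyMeasurable (by fun_prop :
        Continuous (Function.uncurry fun (ξ z : 𝔼) => Real.cos (inner ℝ ξ z)))).integral_prod_right
    have := hm.measurable
    fun_prop
  · have := (hf j).isProbabilityMeasure
    refine Filter.Eventually.of_forall fun ξ => ?_
    rw [norm_mul, norm_mul]
    refine (mul_le_of_le_one_left (norm_nonneg _) ?_).trans (by simp)
    refine mul_le_one₀ ?_ (norm_nonneg _) ?_
    · simpa using Real.abs_cos_le_one _
    · simpa using abs_cosTransform_le_one _ ξ
  · exact Filter.Eventually.of_forall fun ξ => ((h ξ).const_mul _).mul_const _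

end GaussianDensity

/-! ### Factorisation of covariances and linear changes of variables. -/

section LinearAlgebra

variable {n : ℕ}

local notation "𝔼" => EuclideanSpace ℝ (Fin n)
local notation "𝕄" => Matrix (Fin n) (Fin n) ℝ

open scoped MatrixOrder in
theorem exists_posDef_mul_self {A : 𝕄} (hA : A.PosDef) : ∃ H : 𝕄, H.PosDef ∧ H * H = A := by
  have h0 : 0 ≤ A := Matrix.nonneg_iff_posSemidef.2 hA.posSemidef
  have hs : CFC.sqrt A * CFC.sqrt A = A := CFC.sqrt_mul_sqrt_self A h0
  refine ⟨CFC.sqrt A, ?_, hs⟩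
  have hp : (CFC.sqrt A).PosSemidef := Matrix.nonneg_iff_posSemidef.1 (CFC.sqrt_nonneg A)
  rw [hp.posDef_iff_det_ne_zero]
  intro h
  have := hA.det_pos
  rw [← hs, Matrix.det_mul, h] at this
  simp at this

/-- Two positive definite matrices can be written as `SᵀS` and `DᵀD` with `SDᵀ` positive
definite. -/
theorem exists_factorization {A B : 𝕄} (hA : A.PosDef) (hB : B.PosDef) :
    ∃ S D : 𝕄, S.det ≠ 0 ∧ D.det ≠ 0 ∧ A = S.transpose * S ∧ B = D.transpose * D ∧
      (S * D.transpose).PosDef := by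
  obtain ⟨S, hS, hSA⟩ := exists_posDef_mul_self hA
  have hST : S.transpose = S := by
    simpa [Matrix.conjTranspose_eq_transpose_of_trivial] using hS.isHermitian.eq
  have hSd : S.det ≠ 0 := hS.det_pos.ne'
  have hSu : IsUnit S.det := isUnit_iff_ne_zero.2 hSd
  have hSBS : (S * B * S).PosDef := by
    have := hB.conjTranspose_mul_mul_same (B := S)
      (Matrix.mulVec_injective_iff_isUnit.2 ((Matrix.isUnit_iff_isUnit_det S).2 hSu))
    rwa [Matrix.conjTranspose_eq_transpose_of_trivial, hST] at this
  -- The factor D in B = DᵀD is free up to an orthogonal matrix on the left. Taking H = (SBS)^{1/2}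
  -- and D = HS⁻¹ gives SDᵀ = H.
  obtain ⟨H, hH, hHS⟩ := exists_posDef_mul_self hSBS
  have hHT : H.transpose = H := by
    simpa [Matrix.conjTranspose_eq_transpose_of_trivial] using hH.isHermitian.eq
  have hDT : (H * S⁻¹).transpose = S⁻¹ * H := by
    rw [Matrix.transpose_mul, hHT, Matrix.transpose_nonsing_inv, hST]
  refine ⟨S, H * S⁻¹, hSd, ?_, by rw [hST, hSA], ?_, ?_⟩
  · rw [Matrix.det_mul]
    refine mul_ne_zero hH.det_pos.ne' ?_
    rw [Matrix.det_nonsing_inv]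
    simpa using hSd
  · rw [hDT, Matrix.mul_assoc, ← Matrix.mul_assoc H, hHS]
    rw [Matrix.mul_assoc S B S, Matrix.mul_assoc S, Matrix.mul_assoc B,
      Matrix.mul_nonsing_inv _ hSu, Matrix.mul_one, ← Matrix.mul_assoc,
      Matrix.nonsing_inv_mul _ hSu, Matrix.one_mul]
  · rw [hDT, ← Matrix.mul_assoc, Matrix.mul_nonsing_inv _ hSu, Matrix.one_mul]
    exact hH

/-- Sum log x ≤ x - 1 over the eigenvalues. -/
theorem log_det_le_trace_sub {H : 𝕄} (hH : H.PosDef) : Real.log H.det ≤ (H - 1).trace := by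
  have h1 := hH.isHermitian.det_eq_prod_eigenvalues
  have h2 := hH.isHermitian.trace_eq_sum_eigenvalues
  simp only [RCLike.ofReal_real_eq_id, id] at h1 h2
  rw [Matrix.trace_sub, h1, h2, Matrix.trace_one, Real.log_prod fun i _ => (hH.eigenvalues_pos i).ne']
  calc _ ≤ ∑ i, (hH.isHermitian.eigenvalues i - 1) :=
        Finset.sum_le_sum fun i _ => Real.log_le_sub_one_of_pos (hH.eigenvalues_pos i)
    _ = _ := by simp

theorem det_toEuclideanLin (B : 𝕄) : LinearMap.det (Matrix.toEuclideanLin B) = B.det := by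
  rw [Matrix.toEuclideanLin_eq_toLin_orthonormal, LinearMap.det_toLin]

theorem inner_toEuclideanLin_transpose (B : 𝕄) (ξ u : 𝔼) :
    inner ℝ ξ (Matrix.toEuclideanLin B.transpose u) = inner ℝ (Matrix.toEuclideanLin B ξ) u := by
  simp only [EuclideanSpace.inner_eq_star_dotProduct, star_trivial, Matrix.ofLp_toLpLin,
    Matrix.toLin'_apply]
  rw [dotProduct_comm, Matrix.dotProduct_mulVec, Matrix.vecMul_transpose, dotProduct_comm]

theorem norm_toEuclideanLin_sq (B : 𝕄) (ξ : 𝔼) :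
    ‖Matrix.toEuclideanLin B ξ‖ ^ 2 = ξ.ofLp ⬝ᵥ (B.transpose * B).mulVec ξ.ofLp := by
  rw [← real_inner_self_eq_norm_sq, ← inner_toEuclideanLin_transpose]
  simp only [EuclideanSpace.inner_eq_star_dotProduct, star_trivial, Matrix.ofLp_toLpLin,
    Matrix.toLin'_apply]
  rw [dotProduct_comm, Matrix.mulVec_mulVec]

theorem map_toEuclideanLin_volume {B : 𝕄} (hB : B.det ≠ 0) :
    Measure.map (Matrix.toEuclideanLin B) (volume : Measure 𝔼) =
      ENNReal.ofReal |B.det|⁻¹ • volume := by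
  have := Measure.map_linearMap_addHaar_eq_smul_addHaar (volume : Measure 𝔼)
    (f := Matrix.toEuclideanLin B) (by rwa [det_toEuclideanLin])
  rw [this, det_toEuclideanLin, abs_inv]

@[fun_prop]
theorem continuous_toEuclideanLin (B : 𝕄) : Continuous (Matrix.toEuclideanLin B) :=
  LinearMap.continuous_of_finiteDimensional _

theorem lintegral_comp_toEuclideanLin {B : 𝕄} (hB : B.det ≠ 0) {f : 𝔼 → ℝ≥0∞} (hf : Measurable f) :
    ∫⁻ x, f x = ENNReal.ofReal |B.det| * ∫⁻ u, f (Matrix.toEuclideanLin B u) := by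
  rw [← lintegral_map hf (continuous_toEuclideanLin B).measurable, map_toEuclideanLin_volume hB,
    lintegral_smul_measure, smul_eq_mul, ← mul_assoc, ← ENNReal.ofReal_mul (abs_nonneg _),
    mul_inv_cancel₀ (abs_ne_zero.2 hB), ENNReal.ofReal_one, one_mul]

theorem integral_comp_toEuclideanLin {B : 𝕄} (hB : B.det ≠ 0) {f : 𝔼 → ℝ} (hf : Continuous f) :
    ∫ ξ, f (Matrix.toEuclideanLin B ξ) = |B.det|⁻¹ * ∫ x, f x := by
  rw [← integral_map (continuous_toEuclideanLin B).measurable.aemeasurable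
    hf.aestronglyMeasurable, map_toEuclideanLin_volume hB,
    integral_smul_measure, smul_eq_mul, ENNReal.toReal_ofReal (by positivity)]

/-- The density of a centred Gaussian with covariance `BᵀB`, at the point `Bᵀu`. -/
theorem integral_cos_gaussian_transpose {A B : 𝕄} {ε : ℝ} (hB : B.det ≠ 0)
    (hAB : A + ε • (1 : 𝕄) = B.transpose * B) (u : 𝔼) :
    ((2 * Real.pi) ^ n)⁻¹ * ∫ ξ : 𝔼,
      Real.cos (inner ℝ ξ (Matrix.toEuclideanLin B.transpose u)) *
        Real.exp (-(ξ.ofLp ⬝ᵥ A.mulVec ξ.ofLp) / 2) * Real.exp (-(ε / 2) * ‖ξ‖ ^ 2) =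
      |B.det|⁻¹ * stdDensity u := by
  have h1 : ∀ ξ : 𝔼, Real.cos (inner ℝ ξ (Matrix.toEuclideanLin B.transpose u)) *
        Real.exp (-(ξ.ofLp ⬝ᵥ A.mulVec ξ.ofLp) / 2) * Real.exp (-(ε / 2) * ‖ξ‖ ^ 2) =
      (fun η : 𝔼 => Real.cos (inner ℝ η u) * Real.exp (-(1 / 2) * ‖η‖ ^ 2))
        (Matrix.toEuclideanLin B ξ) := by
    intro ξ
    have hn : ‖ξ‖ ^ 2 = ξ.ofLp ⬝ᵥ ξ.ofLp := by
      rw [← real_inner_self_eq_norm_sq, EuclideanSpace.inner_eq_star_dotProduct, star_trivial]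
    simp only
    rw [mul_assoc, ← Real.exp_add, inner_toEuclideanLin_transpose, norm_toEuclideanLin_sq, ← hAB,
      hn, Matrix.add_mulVec, Matrix.smul_mulVec, Matrix.one_mulVec, dotProduct_add, dotProduct_smul,
      smul_eq_mul]
    ring_nf
  rw [integral_congr_ae (Filter.Eventually.of_forall h1),
    integral_comp_toEuclideanLin hB
      (f := fun η : 𝔼 => Real.cos (inner ℝ η u) * Real.exp (-(1 / 2) * ‖η‖ ^ 2)) (by fun_prop),
    stdDensity_eq_gaussianDensity,
    gaussianDensity_eq_integral_cos one_pos]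
  ring

end LinearAlgebra

/-! ### The standard Gaussian measure and Jensen's inequality for quadratic exponents. -/

section StandardGaussian

variable {n : ℕ}

local notation "𝔼" => EuclideanSpace ℝ (Fin n)

theorem lintegral_stdMeasure {h : 𝔼 → ℝ≥0∞} (hh : Measurable h) :
    ∫⁻ x, h x ∂(stdMeasure n) = ∫⁻ x, ENNReal.ofReal (stdDensity x) * h x := by
  unfold stdMeasure
  rw [lintegral_withDensity_eq_lintegral_mul _ (by fun_prop) hh]
  rfl

instance : IsProbabilityMeasure (stdMeasure n) :=
  ⟨by
    rw [stdMeasure, withDensity_apply _ MeasurableSet.univ, Measure.restrict_univ]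
    simp_rw [stdDensity_eq_gaussianDensity]
    exact lintegral_gaussianDensity one_pos⟩

theorem stdMeasure_eq_stdGaussian : stdMeasure n = ProbabilityTheory.stdGaussian 𝔼 := by
  have hpi := Real.pi_pos
  apply Measure.ext_of_charFun (E := 𝔼)
  ext t
  rw [ProbabilityTheory.charFun_stdGaussian, charFun_apply]
  unfold stdMeasure
  rw [integral_withDensity_eq_integral_toReal_smul (by fun_prop) (by simp)]
  have h := GaussianFourier.integral_cexp_neg_mul_sq_norm_add_of_euclideanSpace (b := (1 / 2 : ℂ))
    (by norm_num) Complex.I t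
  have h2 : ∀ x : 𝔼, (ENNReal.ofReal (stdDensity x)).toReal • Complex.exp ((inner ℝ x t : ℝ) * Complex.I)
      = (((2 * Real.pi) ^ (-((n : ℝ) / 2)) : ℝ) : ℂ) *
        Complex.exp (-(1 / 2) * ‖x‖ ^ 2 + Complex.I * (inner ℝ t x : ℝ)) := by
    intro x
    rw [ENNReal.toReal_ofReal (stdDensity_pos x).le, stdDensity, Complex.real_smul,
      Complex.ofReal_mul, mul_assoc, Complex.ofReal_exp, ← Complex.exp_add, real_inner_comm]
    congr 2
    push_cast
    ring
  simp_rw [h2]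
  rw [integral_const_mul, h, ← mul_assoc]
  have h3 : (((2 * Real.pi) ^ (-((n : ℝ) / 2)) : ℝ) : ℂ) *
      ((Real.pi : ℂ) / (1 / 2)) ^ ((Fintype.card (Fin n) : ℂ) / 2) = 1 := by
    rw [show ((Fintype.card (Fin n) : ℂ) / 2) = (((n : ℝ) / 2 : ℝ) : ℂ) by simp,
      show ((Real.pi : ℂ) / (1 / 2)) = ((2 * Real.pi : ℝ) : ℂ) by push_cast; ring,
      ← Complex.ofReal_cpow (by positivity), ← Complex.ofReal_mul, ← Real.rpow_add (by positivity)]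
    simp
  rw [h3, one_mul, Complex.I_sq]
  congr 1
  ring

theorem memLp_id_stdMeasure : MemLp id 2 (stdMeasure n) := by
  rw [stdMeasure_eq_stdGaussian]
  exact ProbabilityTheory.IsGaussian.memLp_two_id

theorem integrable_inner_mul_inner (u v : 𝔼) :
    Integrable (fun z => inner ℝ u z * inner ℝ v z) (stdMeasure n) := by
  have h : ∀ u : 𝔼, MemLp (fun z => inner ℝ u z) 2 (stdMeasure n) := fun u =>
    memLp_id_stdMeasure.const_inner u
  exact (h u).integrable_mul (h v)

theorem integral_inner_mul_inner (u v : 𝔼) :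
    ∫ z, inner ℝ u z * inner ℝ v z ∂(stdMeasure n) = inner ℝ u v := by
  have h := ProbabilityTheory.covarianceBilin_apply (memLp_id_stdMeasure (n := n)) u v
  rw [stdMeasure_eq_stdGaussian] at h ⊢
  rw [ProbabilityTheory.covarianceBilin_stdGaussian] at h
  simp only [id, ProbabilityTheory.integral_id_stdGaussian, sub_zero] at h
  rw [← h]
  rfl

theorem integrable_quadratic (N : Matrix (Fin n) (Fin n) ℝ) :
    Integrable (fun z : 𝔼 => inner ℝ z (Matrix.toEuclideanLin N z)) (stdMeasure n) ∧
      ∫ z : 𝔼, inner ℝ z (Matrix.toEuclideanLin N z) ∂(stdMeasure n) = N.trace := by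
  have h1 : ∀ z : 𝔼, inner ℝ z (Matrix.toEuclideanLin N z) =
      ∑ i, ∑ k, N i k * (inner ℝ (EuclideanSpace.single i (1 : ℝ)) z *
        inner ℝ (EuclideanSpace.single k (1 : ℝ)) z) := by
    intro z
    rw [PiLp.inner_apply]
    refine Finset.sum_congr rfl fun i _ => ?_
    simp only [inner_single_eq, Matrix.ofLp_toLpLin, Matrix.toLin'_apply, Matrix.mulVec, dotProduct,
      RCLike.inner_apply, conj_trivial, Finset.sum_mul]
    exact Finset.sum_congr rfl fun k _ => by ring
  have hi : ∀ i k : Fin n, Integrable (fun z : 𝔼 => N i k *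
      (inner ℝ (EuclideanSpace.single i (1 : ℝ)) z *
        inner ℝ (EuclideanSpace.single k (1 : ℝ)) z)) (stdMeasure n) :=
    fun i k => (integrable_inner_mul_inner _ _).const_mul _
  simp_rw [h1]
  refine ⟨integrable_finsetSum _ fun i _ => integrable_finsetSum _ fun k _ => hi i k, ?_⟩
  rw [integral_finsetSum _ fun i _ => integrable_finsetSum _ fun k _ => hi i k]
  simp_rw [fun i => integral_finsetSum Finset.univ fun k _ => hi i k, integral_const_mul,
    integral_inner_mul_inner, inner_single_eq]
  simp [Matrix.trace, PiLp.single_apply]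

theorem ofReal_integral_le_lintegral {α : Type*} [MeasurableSpace α] {μ : Measure α} {f : α → ℝ}
    (hf : Integrable f μ) : ENNReal.ofReal (∫ x, f x ∂μ) ≤ ∫⁻ x, ENNReal.ofReal (f x) ∂μ := by
  rw [integral_eq_lintegral_pos_part_sub_lintegral_neg_part hf]
  exact (ENNReal.ofReal_le_ofReal (sub_le_self _ ENNReal.toReal_nonneg)).trans
    ENNReal.ofReal_toReal_le

/-- Jensen's inequality, with tr N the mean of the quadratic form. The proof integrates the tangent
line of exp at the mean, so the exponential itself need not be integrable. -/
theorem exp_trace_le_lintegral (N : Matrix (Fin n) (Fin n) ℝ) (t : ℝ) :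
    ENNReal.ofReal (Real.exp (t * N.trace)) ≤
      ∫⁻ z : 𝔼, ENNReal.ofReal (Real.exp (t * inner ℝ z (Matrix.toEuclideanLin N z)))
        ∂(stdMeasure n) := by
  obtain ⟨hi, htr⟩ := integrable_quadratic N
  set τ := t * N.trace with hτ
  have hint : ∫ z : 𝔼, Real.exp τ * (1 + t * inner ℝ z (Matrix.toEuclideanLin N z) - τ)
      ∂(stdMeasure n) = Real.exp τ := by
    have h1 : Integrable (fun z : 𝔼 => 1 + t * inner ℝ z (Matrix.toEuclideanLin N z))
        (stdMeasure n) := (integrable_const _).add (hi.const_mul _)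
    rw [integral_const_mul, integral_sub h1 (integrable_const _), integral_add (integrable_const _) (hi.const_mul _), integral_const_mul,
      htr]
    simp [hτ]
  rw [← hint]
  have hI : Integrable (fun z : 𝔼 => Real.exp τ *
      (1 + t * inner ℝ z (Matrix.toEuclideanLin N z) - τ)) (stdMeasure n) :=
    (((integrable_const _).add (hi.const_mul _)).sub (integrable_const _)).const_mul _
  refine (ofReal_integral_le_lintegral hI).trans ?_
  refine lintegral_mono fun z => ENNReal.ofReal_le_ofReal ?_
  have h := Real.add_one_le_exp (t * inner ℝ z (Matrix.toEuclideanLin N z) - τ)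
  calc _ ≤ Real.exp τ * Real.exp (t * inner ℝ z (Matrix.toEuclideanLin N z) - τ) := by
        gcongr; linarith
    _ = _ := by rw [← Real.exp_add]; congr 1; ring

end StandardGaussian

/-! ### The sharp inequality for a pair of centred Gaussians. -/

section GaussianPair

variable {n : ℕ}

local notation "𝔼" => EuclideanSpace ℝ (Fin n)

/-- The normalisation turning `exp (lam ⟪u, v⟫) γ(u)^r γ(v)^r` into the density of a pair of
standard Gaussians with correlation `a`, where `r = 1 / (1 - a²)` and `lam = a / (1 - a²)`. -/
def mehlerConst (n : ℕ) (a : ℝ) : ℝ :=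
  (2 * Real.pi) ^ (-((n : ℝ) / 2)) * (2 * Real.pi * (1 - a ^ 2)) ^ (-((n : ℝ) / 2)) *
    (((2 * Real.pi) ^ (-((n : ℝ) / 2))) ^ (1 - a ^ 2)⁻¹ *
      ((2 * Real.pi) ^ (-((n : ℝ) / 2))) ^ (1 - a ^ 2)⁻¹)⁻¹

theorem mehlerConst_pos {a : ℝ} (ha : 0 < 1 - a ^ 2) : 0 < mehlerConst n a := by
  have := Real.pi_pos
  unfold mehlerConst; positivity

/-- Completing the square. The right side is the joint density of U and V = aU + √(1-a²) Z, which is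
how the exponents r and λ arise. -/
theorem mehler_identity {a : ℝ} (ha : 0 < 1 - a ^ 2) (u v : 𝔼) :
    mehlerConst n a * (Real.exp (a / (1 - a ^ 2) * inner ℝ u v) *
      (stdDensity u ^ (1 - a ^ 2)⁻¹ * stdDensity v ^ (1 - a ^ 2)⁻¹)) =
      stdDensity u * gaussianDensity (1 - a ^ 2) (v - a • u) := by
  have hpi := Real.pi_pos
  have hP : 0 < (2 * Real.pi) ^ (-((n : ℝ) / 2)) := by positivity
  unfold mehlerConst stdDensity gaussianDensity
  rw [Real.mul_rpow hP.le (Real.exp_pos _).le, Real.mul_rpow hP.le (Real.exp_pos _).le,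
    ← Real.exp_mul, ← Real.exp_mul]
  have hPr : 0 < ((2 * Real.pi) ^ (-((n : ℝ) / 2))) ^ (1 - a ^ 2)⁻¹ := by positivity
  set P := (2 * Real.pi) ^ (-((n : ℝ) / 2))
  set Pr := P ^ (1 - a ^ 2)⁻¹
  have hexp : Real.exp (a / (1 - a ^ 2) * inner ℝ u v) *
      (Real.exp (-(‖u‖ ^ 2 / 2) * (1 - a ^ 2)⁻¹) * Real.exp (-(‖v‖ ^ 2 / 2) * (1 - a ^ 2)⁻¹)) =
      Real.exp (-(‖u‖ ^ 2 / 2)) * Real.exp (-(‖v - a • u‖ ^ 2 / (2 * (1 - a ^ 2)))) := by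
    rw [← Real.exp_add, ← Real.exp_add, ← Real.exp_add]
    congr 1
    rw [norm_sub_sq_real, norm_smul, mul_pow, Real.norm_eq_abs, sq_abs, inner_smul_right,
      real_inner_comm]
    field_simp
    ring
  calc _ = (2 * Real.pi) ^ (-((n : ℝ) / 2)) * (2 * Real.pi * (1 - a ^ 2)) ^ (-((n : ℝ) / 2)) *
        ((Pr * Pr)⁻¹ * (Pr * Pr)) * (Real.exp (a / (1 - a ^ 2) * inner ℝ u v) *
      (Real.exp (-(‖u‖ ^ 2 / 2) * (1 - a ^ 2)⁻¹) * Real.exp (-(‖v‖ ^ 2 / 2) * (1 - a ^ 2)⁻¹))) := by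
        ring
    _ = _ := by
        rw [hexp, inv_mul_cancel₀ (by positivity)]
        ring

/-- A nonnegative function with an even weight: averaging `exp` of a linear form gives at least
the total mass. -/
theorem one_le_lintegral_exp_inner {β : ℝ} (hβ : 0 < β) (w : 𝔼) :
    1 ≤ ∫⁻ v : 𝔼, ENNReal.ofReal (Real.exp (inner ℝ w v) * gaussianDensity β v) := by
  have h1 : ∫⁻ v : 𝔼, ENNReal.ofReal (Real.exp (inner ℝ w v) * gaussianDensity β v) =
      ∫⁻ v : 𝔼, ENNReal.ofReal (Real.exp (-inner ℝ w v) * gaussianDensity β v) := by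
    rw [← lintegral_neg_eq_self]
    simp_rw [gaussianDensity_neg, inner_neg_right]
  have h2 : 2 * (1 : ℝ≥0∞) ≤
      2 * ∫⁻ v : 𝔼, ENNReal.ofReal (Real.exp (inner ℝ w v) * gaussianDensity β v) := by
    rw [two_mul (∫⁻ v : 𝔼, _)]
    conv_rhs => enter [2]; rw [h1]
    rw [← lintegral_add_left (by fun_prop), ← lintegral_gaussianDensity (n := n) hβ,
      ← lintegral_const_mul _ (by fun_prop)]
    refine lintegral_mono fun v => ?_
    have hg := gaussianDensity_pos hβ v
    rw [two_mul, ← ENNReal.ofReal_add hg.le hg.le, ← ENNReal.ofReal_add (by positivity) (by positivity)]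
    apply ENNReal.ofReal_le_ofReal
    have h := Real.one_le_cosh (inner ℝ w v)
    rw [Real.cosh_eq] at h
    nlinarith
  exact (ENNReal.mul_le_mul_iff_right (by simp) (by simp)).1 h2

/-- The integral is E exp(λ⟨U,(H-1)V⟩) for standard Gaussians of correlation a. Given U, the noise
in V has mean zero and contributes a factor at least 1, leaving exp(λa⟨U,(H-1)U⟩) with λa = r-1;
Jensen and the determinant–trace bound finish. -/
theorem det_rpow_le_lintegral {a : ℝ} (ha : 0 < 1 - a ^ 2) {H : Matrix (Fin n) (Fin n) ℝ}
    (hH : H.PosDef) :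
    ENNReal.ofReal (H.det ^ ((1 - a ^ 2)⁻¹ - 1)) ≤ ∫⁻ u : 𝔼, ∫⁻ v : 𝔼,
      ENNReal.ofReal (mehlerConst n a) * (ENNReal.ofReal
        (Real.exp (a / (1 - a ^ 2) * inner ℝ u (Matrix.toEuclideanLin H v))) *
        (ENNReal.ofReal (stdDensity u) ^ (1 - a ^ 2)⁻¹ *
          ENNReal.ofReal (stdDensity v) ^ (1 - a ^ 2)⁻¹)) := by
  set r := (1 - a ^ 2)⁻¹ with hr
  set lam := a / (1 - a ^ 2) with hlam
  have hHT : H.transpose = H := by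
    simpa [Matrix.conjTranspose_eq_transpose_of_trivial] using hH.isHermitian.eq
  have hla : lam * a = r - 1 := by rw [hlam, hr]; field_simp; ring
  have hr1 : 0 ≤ r - 1 := by
    rw [sub_nonneg, hr]
    exact (one_le_inv₀ ha).2 (by nlinarith)
  have hN1 : ∀ v : 𝔼, Matrix.toEuclideanLin (H - 1) v = Matrix.toEuclideanLin H v - v := by
    intro v
    ext i
    simp
  have hNs : ∀ u v : 𝔼, inner ℝ u (Matrix.toEuclideanLin (H - 1) v) =
      inner ℝ (Matrix.toEuclideanLin (H - 1) u) v := by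
    intro u v
    rw [← inner_toEuclideanLin_transpose, Matrix.transpose_sub, hHT, Matrix.transpose_one]
  have hpt : ∀ u v : 𝔼, ENNReal.ofReal (mehlerConst n a) * (ENNReal.ofReal
        (Real.exp (lam * inner ℝ u (Matrix.toEuclideanLin H v))) *
        (ENNReal.ofReal (stdDensity u) ^ r * ENNReal.ofReal (stdDensity v) ^ r)) =
      ENNReal.ofReal (stdDensity u) * ENNReal.ofReal
        (Real.exp (lam * inner ℝ u (Matrix.toEuclideanLin (H - 1) v)) *
          gaussianDensity (1 - a ^ 2) (v - a • u)) := by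
    intro u v
    rw [ENNReal.ofReal_rpow_of_pos (stdDensity_pos u), ENNReal.ofReal_rpow_of_pos (stdDensity_pos v),
      ← ENNReal.ofReal_mul (by have := stdDensity_pos u; positivity),
      ← ENNReal.ofReal_mul (by positivity), ← ENNReal.ofReal_mul (mehlerConst_pos ha).le,
      ← ENNReal.ofReal_mul (stdDensity_pos u).le]
    congr 1
    have h := mehler_identity ha u v
    rw [hN1, inner_sub_right, mul_sub, Real.exp_sub]
    rw [← mul_left_inj' (Real.exp_pos (lam * inner ℝ u v)).ne']
    calc _ = Real.exp (lam * inner ℝ u (Matrix.toEuclideanLin H v)) *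
          (mehlerConst n a * (Real.exp (lam * inner ℝ u v) *
            (stdDensity u ^ r * stdDensity v ^ r))) := by ring
      _ = _ := by rw [h]; field_simp
  simp_rw [hpt]
  have hin : ∀ u : 𝔼, ENNReal.ofReal (stdDensity u) * ENNReal.ofReal
      (Real.exp ((r - 1) * inner ℝ u (Matrix.toEuclideanLin (H - 1) u))) ≤
      ∫⁻ v : 𝔼, ENNReal.ofReal (stdDensity u) * ENNReal.ofReal
        (Real.exp (lam * inner ℝ u (Matrix.toEuclideanLin (H - 1) v)) *
          gaussianDensity (1 - a ^ 2) (v - a • u)) := by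
    intro u
    rw [lintegral_const_mul _ (by fun_prop)]
    gcongr
    rw [← lintegral_add_right_eq_self _ (a • u)]
    have h1 := one_le_lintegral_exp_inner (n := n) ha (lam • Matrix.toEuclideanLin (H - 1) u)
    calc _ ≤ ENNReal.ofReal (Real.exp ((r - 1) * inner ℝ u (Matrix.toEuclideanLin (H - 1) u))) *
          ∫⁻ v : 𝔼, ENNReal.ofReal (Real.exp (inner ℝ (lam • Matrix.toEuclideanLin (H - 1) u) v) *
            gaussianDensity (1 - a ^ 2) v) := le_mul_of_one_le_right' h1
      _ = _ := by
        rw [← lintegral_const_mul _ (by fun_prop)]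
        refine lintegral_congr fun v => ?_
        rw [← ENNReal.ofReal_mul (by positivity), ← mul_assoc, ← Real.exp_add, map_add,
          add_sub_cancel_right, inner_add_right, hNs u v, map_smul, inner_smul_right,
          inner_smul_left, conj_trivial, ← hla]
        congr 3
        ring
  refine le_trans ?_ (lintegral_mono hin)
  rw [← lintegral_stdMeasure (by fun_prop)]
  refine le_trans ?_ (exp_trace_le_lintegral (H - 1) (r - 1))
  apply ENNReal.ofReal_le_ofReal
  rw [Real.rpow_def_of_pos hH.det_pos, mul_comm]
  apply Real.exp_le_exp.2
  gcongr
  exact log_det_le_trace_sub hH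

/-- Substituting x = Sᵀu, y = Dᵀv makes both functions standard and couples u, v through H = SDᵀ.
The Jacobians and the r-th powers of the normalisations leave (det H)^{1-r}, exactly offset by
`det_rpow_le_lintegral`. -/
theorem one_le_kernelForm_gaussian {a : ℝ} (ha : 0 < 1 - a ^ 2)
    {S D : Matrix (Fin n) (Fin n) ℝ} (hS : S.det ≠ 0) (hD : D.det ≠ 0)
    (hSD : (S * D.transpose).PosDef) {F G : 𝔼 → ℝ≥0∞} (hFm : Measurable F) (hGm : Measurable G)
    (hF : ∀ u, F (Matrix.toEuclideanLin S.transpose u) =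
      ENNReal.ofReal (|S.det|⁻¹ * stdDensity u))
    (hG : ∀ v, G (Matrix.toEuclideanLin D.transpose v) =
      ENNReal.ofReal (|D.det|⁻¹ * stdDensity v)) :
    1 ≤ ENNReal.ofReal (mehlerConst n a) *
      kernelForm (a / (1 - a ^ 2)) 0 (1 - a ^ 2)⁻¹ F G := by
  set r := (1 - a ^ 2)⁻¹ with hr
  set lam := a / (1 - a ^ 2) with hlam
  have hr0 : 0 < r := by positivity
  have hST : S.transpose.det ≠ 0 := by rwa [Matrix.det_transpose]
  have hDT : D.transpose.det ≠ 0 := by rwa [Matrix.det_transpose]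
  have hS0 : 0 < |S.det| := abs_pos.2 hS
  have hD0 : 0 < |D.det| := abs_pos.2 hD
  have hdet : |S.det| * |D.det| = (S * D.transpose).det := by
    rw [← abs_of_pos hSD.det_pos, Matrix.det_mul, Matrix.det_transpose, abs_mul]
  have hdp := hSD.det_pos
  have hform : kernelForm lam 0 r F G =
      ENNReal.ofReal ((S * D.transpose).det ^ (1 - r)) * ∫⁻ u : 𝔼, ∫⁻ v : 𝔼, ENNReal.ofReal
        (Real.exp (lam * inner ℝ u (Matrix.toEuclideanLin (S * D.transpose) v))) *
        (ENNReal.ofReal (stdDensity u) ^ r * ENNReal.ofReal (stdDensity v) ^ r) := by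
    unfold kernelForm
    rw [lintegral_comp_toEuclideanLin hST (by fun_prop)]
    simp_rw [fun x => lintegral_comp_toEuclideanLin hDT (f := fun y => expKernel lam 0 x y *
      (F x ^ r * G y ^ r)) (by fun_prop)]
    rw [Matrix.det_transpose, Matrix.det_transpose, ← lintegral_const_mul _ (by fun_prop),
      ← lintegral_const_mul _ (by fun_prop)]
    refine lintegral_congr fun u => ?_
    rw [← lintegral_const_mul _ (by fun_prop), ← lintegral_const_mul _ (by fun_prop),
      ← lintegral_const_mul _ (by fun_prop)]
    refine lintegral_congr fun v => ?_
    have hu := stdDensity_pos u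
    have hv := stdDensity_pos v
    have hin : inner ℝ (Matrix.toEuclideanLin S.transpose u) (Matrix.toEuclideanLin D.transpose v) =
        inner ℝ u (Matrix.toEuclideanLin (S * D.transpose) v) := by
      have := inner_toEuclideanLin_transpose S.transpose u (Matrix.toEuclideanLin D.transpose v)
      rw [Matrix.transpose_transpose] at this
      rw [← this]
      congr 1
      ext i
      simp [Matrix.mulVec_mulVec]
    rw [hF, hG, expKernel, hin, ENNReal.ofReal_rpow_of_pos (by positivity),
      ENNReal.ofReal_rpow_of_pos (by positivity), ENNReal.ofReal_rpow_of_pos hu,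
      ENNReal.ofReal_rpow_of_pos hv]
    simp only [zero_mul, zero_div, add_zero]
    rw [← ENNReal.ofReal_mul (by positivity), ← ENNReal.ofReal_mul (by positivity),
      ← ENNReal.ofReal_mul (by positivity), ← ENNReal.ofReal_mul (by positivity),
      ← ENNReal.ofReal_mul (by positivity), ← ENNReal.ofReal_mul (by positivity),
      ← ENNReal.ofReal_mul (by positivity)]
    congr 1
    rw [Real.mul_rpow (by positivity) hu.le, Real.mul_rpow (by positivity) hv.le, ← hdet,
      Real.mul_rpow (by positivity) (by positivity), Real.inv_rpow hS0.le, Real.inv_rpow hD0.le,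
      Real.rpow_sub hS0, Real.rpow_sub hD0, Real.rpow_one, Real.rpow_one]
    ring
  have hmain := det_rpow_le_lintegral ha hSD
  rw [← hr, ← hlam] at hmain
  simp_rw [lintegral_const_mul' _ _ ENNReal.ofReal_ne_top] at hmain
  rw [hform]
  set W := ∫⁻ u : 𝔼, ∫⁻ v : 𝔼, ENNReal.ofReal
        (Real.exp (lam * inner ℝ u (Matrix.toEuclideanLin (S * D.transpose) v))) *
        (ENNReal.ofReal (stdDensity u) ^ r * ENNReal.ofReal (stdDensity v) ^ r)
  calc (1 : ℝ≥0∞) = ENNReal.ofReal ((S * D.transpose).det ^ (1 - r)) *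
        ENNReal.ofReal ((S * D.transpose).det ^ (r - 1)) := by
        rw [← ENNReal.ofReal_mul (by positivity), ← Real.rpow_add hdp]
        simp
    _ ≤ ENNReal.ofReal ((S * D.transpose).det ^ (1 - r)) *
        (ENNReal.ofReal (mehlerConst n a) * W) := by gcongr
    _ = _ := by ring

end GaussianPair

/-! ### Gaussian mollification and its effect on the form. -/

section Mollification

variable {n : ℕ}

local notation "𝔼" => EuclideanSpace ℝ (Fin n)

theorem rpow_lintegral_le {α : Type*} [MeasurableSpace α] {μ : Measure α} [IsProbabilityMeasure μ]
    {r : ℝ} (hr : 1 ≤ r) {f : α → ℝ≥0∞} (hf : Measurable f) :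
    (∫⁻ x, f x ∂μ) ^ r ≤ ∫⁻ x, f x ^ r ∂μ := by
  rcases hr.eq_or_lt with rfl | hr
  · simp
  have hr0 : 0 < r := by linarith
  have h := ENNReal.lintegral_mul_le_Lp_mul_Lq μ (Real.HolderConjugate.conjExponent hr)
    hf.aemeasurable (aemeasurable_const (b := (1 : ℝ≥0∞)))
  simp only [Pi.mul_apply, mul_one, ENNReal.one_rpow, lintegral_const, measure_univ] at h
  calc _ ≤ ((∫⁻ x, f x ^ r ∂μ) ^ (1 / r)) ^ r := by gcongr
    _ = _ := by rw [← ENNReal.rpow_mul, one_div_mul_cancel hr0.ne', ENNReal.rpow_one]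

theorem gaussConv_rpow_le {ε r : ℝ} (hε : 0 < ε) (hr : 1 ≤ r) {f : 𝔼 → ℝ≥0∞} (hf : Measurable f)
    (x : 𝔼) : gaussConv ε f x ^ r ≤ gaussConv ε (fun z => f z ^ r) x := by
  have hp : IsProbabilityMeasure
      ((volume : Measure 𝔼).withDensity fun z => ENNReal.ofReal (gaussianDensity ε (x - z))) := by
    refine ⟨?_⟩
    rw [withDensity_apply _ MeasurableSet.univ, Measure.restrict_univ,
      lintegral_sub_left_eq_self (fun z => ENNReal.ofReal (gaussianDensity ε z)) x,
      lintegral_gaussianDensity hε]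
  have h := rpow_lintegral_le (μ := (volume : Measure 𝔼).withDensity
    fun z => ENNReal.ofReal (gaussianDensity ε (x - z))) hr hf
  rw [lintegral_withDensity_eq_lintegral_mul _ (by fun_prop) (by fun_prop),
    lintegral_withDensity_eq_lintegral_mul _ (by fun_prop) (by fun_prop)] at h
  simpa only [gaussConv, Pi.mul_apply, mul_comm] using h

theorem lintegral_exp_mul_gaussianDensity {ε τ : ℝ} (hε : 0 < ε) (hτ : 2 * ε * τ < 1) :
    ∫⁻ z : 𝔼, ENNReal.ofReal (Real.exp (τ * ‖z‖ ^ 2) * gaussianDensity ε z) =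
      ENNReal.ofReal ((1 - 2 * ε * τ) ^ (-((n : ℝ) / 2))) := by
  have hpi := Real.pi_pos
  have h0 : 0 < 1 - 2 * ε * τ := by linarith
  have h1 : ∀ z : 𝔼, Real.exp (τ * ‖z‖ ^ 2) * gaussianDensity ε z =
      (1 - 2 * ε * τ) ^ (-((n : ℝ) / 2)) * gaussianDensity (ε / (1 - 2 * ε * τ)) z := by
    intro z
    have he : Real.exp (-(‖z‖ ^ 2 / (2 * (ε / (1 - 2 * ε * τ))))) =
        Real.exp (τ * ‖z‖ ^ 2) * Real.exp (-(‖z‖ ^ 2 / (2 * ε))) := by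
      rw [← Real.exp_add]
      congr 1
      field_simp
      ring
    unfold gaussianDensity
    rw [he, show 2 * Real.pi * ε = (1 - 2 * ε * τ) * (2 * Real.pi * (ε / (1 - 2 * ε * τ))) by
      field_simp, Real.mul_rpow h0.le (by positivity)]
    ring
  simp_rw [h1]
  simp_rw [ENNReal.ofReal_mul (show 0 ≤ (1 - 2 * ε * τ) ^ (-((n : ℝ) / 2)) by positivity)]
  rw [lintegral_const_mul _ (by fun_prop), lintegral_gaussianDensity (by positivity), mul_one]

/-- Here z, w are the noises. Young's inequality charges δ/2 of |x|² and |y|² from the cross terms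
to the weight of the kernel, at a cost λ²/(2δ) on the noise. -/
theorem expKernel_add_le {lam δ : ℝ} (hl : 0 ≤ lam) (hδ : 0 < δ) (x y z w : 𝔼) :
    expKernel lam 0 (z + x) (w + y) ≤ expKernel lam δ x y *
      (ENNReal.ofReal (Real.exp ((lam ^ 2 / (2 * δ) + lam / 2) * ‖z‖ ^ 2)) *
        ENNReal.ofReal (Real.exp ((lam ^ 2 / (2 * δ) + lam / 2) * ‖w‖ ^ 2))) := by
  unfold expKernel
  rw [← ENNReal.ofReal_mul (by positivity), ← ENNReal.ofReal_mul (by positivity), ← Real.exp_add,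
    ← Real.exp_add]
  apply ENNReal.ofReal_le_ofReal
  apply Real.exp_le_exp.2
  have key : ∀ p q : 𝔼, lam * inner ℝ p q ≤ δ * ‖p‖ ^ 2 / 2 + lam ^ 2 / (2 * δ) * ‖q‖ ^ 2 := by
    intro p q
    have h1 : lam * inner ℝ p q ≤ lam * (‖p‖ * ‖q‖) := by
      gcongr; exact real_inner_le_norm p q
    have h2 : 0 ≤ (δ * ‖p‖ - lam * ‖q‖) ^ 2 / (2 * δ) := by positivity
    have h3 : (δ * ‖p‖ - lam * ‖q‖) ^ 2 / (2 * δ) =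
        δ * ‖p‖ ^ 2 / 2 + lam ^ 2 / (2 * δ) * ‖q‖ ^ 2 - lam * (‖p‖ * ‖q‖) := by
      field_simp; ring
    linarith
  have h1 := key x w
  have h2 := key y z
  have h3 : lam * inner ℝ z w ≤ lam / 2 * ‖z‖ ^ 2 + lam / 2 * ‖w‖ ^ 2 := by
    have h := real_inner_le_norm z w
    have h' : lam * inner ℝ z w ≤ lam * (‖z‖ * ‖w‖) := by gcongr
    nlinarith [mul_nonneg hl (sq_nonneg (‖z‖ - ‖w‖))]
  rw [real_inner_comm] at h2
  simp only [inner_add_left, inner_add_right, zero_mul, zero_div, add_zero]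
  linarith

/-- Mollifying the two functions decreases the form, up to a slight change of the kernel. -/
theorem kernelForm_gaussConv_le {lam δ r : ℝ} (hl : 0 ≤ lam) (hδ : 0 < δ) (hr : 1 ≤ r)
    (hs : δ * lam ^ 2 + δ ^ 2 * lam < 1) {f g : 𝔼 → ℝ≥0∞} (hf : Measurable f) (hg : Measurable g) :
    kernelForm lam 0 r (gaussConv (δ ^ 2) f) (gaussConv (δ ^ 2) g) ≤
      ENNReal.ofReal ((1 - (δ * lam ^ 2 + δ ^ 2 * lam)) ^ (-(n : ℝ))) *
        kernelForm lam δ r f g := by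
  set ε := δ ^ 2 with hε
  have hε0 : 0 < ε := by positivity
  set τ := lam ^ 2 / (2 * δ) + lam / 2 with hτ
  -- The variance δ² beats the factor 1/δ in τ: the product 2ετ is of order δ, so the loss tends to
  -- 1 as δ → 0.
  have hετ : 2 * ε * τ = δ * lam ^ 2 + δ ^ 2 * lam := by rw [hε, hτ]; field_simp
  have h0 : 0 < 1 - (δ * lam ^ 2 + δ ^ 2 * lam) := by linarith
  have hker : ∀ a b : 𝔼, ∫⁻ x, ∫⁻ y, expKernel lam 0 x y *
      (ENNReal.ofReal (gaussianDensity ε (x - a)) * ENNReal.ofReal (gaussianDensity ε (y - b))) ≤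
      ENNReal.ofReal ((1 - (δ * lam ^ 2 + δ ^ 2 * lam)) ^ (-(n : ℝ))) * expKernel lam δ a b := by
    intro a b
    have hshift : ∀ h : 𝔼 → 𝔼 → ℝ≥0∞, ∫⁻ x, ∫⁻ y, h x y = ∫⁻ z, ∫⁻ w, h (z + a) (w + b) := by
      intro h
      rw [← lintegral_add_right_eq_self _ a]
      exact lintegral_congr fun x => (lintegral_add_right_eq_self (fun y => h (x + a) y) b).symm
    rw [hshift]
    simp_rw [add_sub_cancel_right]
    calc _ ≤ ∫⁻ z : 𝔼, ∫⁻ w : 𝔼, expKernel lam δ a b *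
          (ENNReal.ofReal (Real.exp (τ * ‖z‖ ^ 2) * gaussianDensity ε z) *
            ENNReal.ofReal (Real.exp (τ * ‖w‖ ^ 2) * gaussianDensity ε w)) := by
          refine lintegral_mono fun z => lintegral_mono fun w => ?_
          simp only
          rw [ENNReal.ofReal_mul (Real.exp_pos _).le, ENNReal.ofReal_mul (Real.exp_pos _).le]
          refine (mul_le_mul' (expKernel_add_le hl hδ a b z w) le_rfl).trans (le_of_eq ?_)
          ring
      _ = _ := by
          have hz : ∀ z : 𝔼, ∫⁻ w : 𝔼, expKernel lam δ a b *
              (ENNReal.ofReal (Real.exp (τ * ‖z‖ ^ 2) * gaussianDensity ε z) *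
                ENNReal.ofReal (Real.exp (τ * ‖w‖ ^ 2) * gaussianDensity ε w)) =
              expKernel lam δ a b *
              (ENNReal.ofReal (Real.exp (τ * ‖z‖ ^ 2) * gaussianDensity ε z) *
                ∫⁻ w : 𝔼, ENNReal.ofReal (Real.exp (τ * ‖w‖ ^ 2) * gaussianDensity ε w)) := by
            intro z
            rw [lintegral_const_mul _ (by fun_prop), lintegral_const_mul _ (by fun_prop)]
          rw [lintegral_congr hz]
          rw [lintegral_const_mul _ (by fun_prop), lintegral_mul_const _ (by fun_prop),
            lintegral_exp_mul_gaussianDensity hε0 (by linarith), hετ,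
            ← ENNReal.ofReal_mul (by positivity), ← Real.rpow_add h0, mul_comm]
          congr 3
          ring
  -- Jensen moves the power r inside the convolution; by Fubini the Gaussian kernels then act on the
  -- exponential kernel instead.
  have hfr : ∀ x, gaussConv ε f x ^ r ≤ gaussConv ε (fun z => f z ^ r) x :=
    gaussConv_rpow_le hε0 hr hf
  have hgr : ∀ x, gaussConv ε g x ^ r ≤ gaussConv ε (fun z => g z ^ r) x :=
    gaussConv_rpow_le hε0 hr hg
  calc kernelForm lam 0 r (gaussConv ε f) (gaussConv ε g)
      ≤ ∫⁻ x, ∫⁻ y, expKernel lam 0 x y *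
        (gaussConv ε (fun z => f z ^ r) x * gaussConv ε (fun z => g z ^ r) y) := by
        unfold kernelForm
        gcongr with x y
        · exact hfr x
        · exact hgr y
    _ = ∫⁻ x, ∫⁻ y, ∫⁻ a, ∫⁻ b, f a ^ r * g b ^ r * (expKernel lam 0 x y *
      (ENNReal.ofReal (gaussianDensity ε (x - a)) * ENNReal.ofReal (gaussianDensity ε (y - b)))) := by
        refine lintegral_congr fun x => lintegral_congr fun y => ?_
        unfold gaussConv
        rw [← lintegral_mul_const _ (by fun_prop), ← lintegral_const_mul _ (by fun_prop)]
        refine lintegral_congr fun a => ?_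
        rw [← lintegral_const_mul _ (by fun_prop), ← lintegral_const_mul _ (by fun_prop)]
        refine lintegral_congr fun b => ?_
        ring
    _ = ∫⁻ a, ∫⁻ b, f a ^ r * g b ^ r * ∫⁻ x, ∫⁻ y, (expKernel lam 0 x y *
      (ENNReal.ofReal (gaussianDensity ε (x - a)) * ENNReal.ofReal (gaussianDensity ε (y - b)))) := by
        simp_rw [fun x => lintegral_lintegral_swap (μ := (volume : Measure 𝔼))
          (ν := (volume : Measure 𝔼)) (f := fun y a => ∫⁻ b, f a ^ r * g b ^ r *
          (expKernel lam 0 x y * (ENNReal.ofReal (gaussianDensity ε (x - a)) *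
            ENNReal.ofReal (gaussianDensity ε (y - b))))) (by fun_prop)]
        rw [lintegral_lintegral_swap (by fun_prop)]
        refine lintegral_congr fun a => ?_
        simp_rw [fun x => lintegral_lintegral_swap (μ := (volume : Measure 𝔼))
          (ν := (volume : Measure 𝔼)) (f := fun y b => f a ^ r * g b ^ r *
          (expKernel lam 0 x y * (ENNReal.ofReal (gaussianDensity ε (x - a)) *
            ENNReal.ofReal (gaussianDensity ε (y - b))))) (by fun_prop)]
        rw [lintegral_lintegral_swap (by fun_prop)]
        refine lintegral_congr fun b => ?_
        rw [← lintegral_const_mul _ (by fun_prop)]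
        refine lintegral_congr fun x => ?_
        rw [← lintegral_const_mul _ (by fun_prop)]
    _ ≤ ∫⁻ a, ∫⁻ b, f a ^ r * g b ^ r *
        (ENNReal.ofReal ((1 - (δ * lam ^ 2 + δ ^ 2 * lam)) ^ (-(n : ℝ))) *
          expKernel lam δ a b) := by
        gcongr with a b
        exact hker a b
    _ = _ := by
        unfold kernelForm
        rw [← lintegral_const_mul _ (by fun_prop)]
        refine lintegral_congr fun a => ?_
        rw [← lintegral_const_mul _ (by fun_prop)]
        refine lintegral_congr fun b => ?_
        ring

end Mollification

/-! ### The sharp bilinear inequality, by passage to the Gaussian limit. -/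

section CoreInequality

variable {n : ℕ}

local notation "𝔼" => EuclideanSpace ℝ (Fin n)

theorem posDef_add_smul_one {A : Matrix (Fin n) (Fin n) ℝ} (hA : A.PosSemidef) {ε : ℝ}
    (hε : 0 < ε) : (A + ε • (1 : Matrix (Fin n) (Fin n) ℝ)).PosDef :=
  Matrix.PosDef.posSemidef_add hA (Matrix.PosDef.one.smul hε)

/-- Fatou's lemma for `kernelForm`. -/
theorem kernelForm_le_of_tendsto {lam δ r : ℝ} (hr : 0 < r) {f g : ℕ → 𝔼 → ℝ≥0∞} {F G : 𝔼 → ℝ≥0∞}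
    (hf : ∀ j, Measurable (f j)) (hg : ∀ j, Measurable (g j))
    (hF : ∀ x, Filter.Tendsto (fun j => f j x) Filter.atTop (nhds (F x))) (hFt : ∀ x, F x ≠ ∞)
    (hG : ∀ x, Filter.Tendsto (fun j => g j x) Filter.atTop (nhds (G x))) (hGt : ∀ x, G x ≠ ∞)
    {L : ℝ≥0∞} (hL : ∀ j, kernelForm lam δ r (f j) (g j) ≤ L) : kernelForm lam δ r F G ≤ L := by
  have hlim : ∀ x y, Filter.Tendsto (fun j => expKernel lam δ x y * (f j x ^ r * g j y ^ r))
      Filter.atTop (nhds (expKernel lam δ x y * (F x ^ r * G y ^ r))) := by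
    intro x y
    refine ENNReal.Tendsto.const_mul ?_ (Or.inr ENNReal.ofReal_ne_top)
    refine ENNReal.Tendsto.mul ((ENNReal.continuous_rpow_const.tendsto _).comp (hF x))
      (Or.inr (ENNReal.rpow_ne_top_of_nonneg hr.le (hGt y)))
      ((ENNReal.continuous_rpow_const.tendsto _).comp (hG y))
      (Or.inr (ENNReal.rpow_ne_top_of_nonneg hr.le (hFt x)))
  unfold kernelForm at hL ⊢
  calc ∫⁻ x, ∫⁻ y, expKernel lam δ x y * (F x ^ r * G y ^ r)
      = ∫⁻ x, ∫⁻ y, Filter.liminf (fun j => expKernel lam δ x y * (f j x ^ r * g j y ^ r))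
          Filter.atTop :=
        lintegral_congr fun x => lintegral_congr fun y => (hlim x y).liminf_eq.symm
    _ ≤ ∫⁻ x, Filter.liminf (fun j => ∫⁻ y, expKernel lam δ x y * (f j x ^ r * g j y ^ r))
          Filter.atTop := by
        refine lintegral_mono fun x => lintegral_liminf_le fun j => ?_
        have := hf j; have := hg j
        fun_prop
    _ ≤ Filter.liminf (fun j => ∫⁻ x, ∫⁻ y, expKernel lam δ x y * (f j x ^ r * g j y ^ r))
          Filter.atTop := by
        refine lintegral_liminf_le fun j => ?_
        have := hf j; have := hg j
        fun_prop
    _ ≤ Filter.liminf (fun _ : ℕ => L) Filter.atTop :=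
        Filter.liminf_le_liminf (Filter.Eventually.of_forall hL)
    _ = L := Filter.liminf_const L

/-- Below any value above the infimum there are pairs whose `k`-fold doublings also stay below. -/
theorem exists_kernelForm_iterate_le {lam δ r : ℝ} (hr : 0 < r)
    (h0 : kernelConst 𝔼 lam δ r ≠ 0) {L : ℝ≥0∞} (hL : kernelConst 𝔼 lam δ r < L) (hLt : L ≠ ∞)
    (k : ℕ) : ∃ f g : 𝔼 → ℝ≥0∞, IsEvenDensity f ∧ IsEvenDensity g ∧ kernelForm lam δ r f g ≤ L ∧
      kernelForm lam δ r (selfRot^[k] f) (selfRot^[k] g) ≤ L := by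
  set I := kernelConst 𝔼 lam δ r with hI
  have hIt : I ≠ ∞ := hL.ne_top
  have hq1 : 1 < L / I := by
    rw [ENNReal.lt_div_iff_mul_lt (Or.inl h0) (Or.inl hIt), one_mul]; exact hL
  have hqt : L / I ≠ ∞ := ENNReal.div_ne_top hLt h0
  -- Doubling k times raises the ratio to the infimum to the power 2^k, so a 2^k-th root of L/I is
  -- the tolerance needed at the start.
  set t : ℝ≥0∞ := (L / I) ^ ((2 ^ k : ℕ) : ℝ)⁻¹ with ht
  have ht1 : 1 < t := ENNReal.one_lt_rpow hq1 (by positivity)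
  have htk : t ^ (2 ^ k) = L / I := by
    rw [ht, ← ENNReal.rpow_natCast, ← ENNReal.rpow_mul, inv_mul_cancel₀ (by positivity),
      ENNReal.rpow_one]
  have htL : t ≤ L / I := by
    rw [← htk]; exact le_self_pow₀ ht1.le (by positivity)
  have hlt : I < I * t := by
    conv_lhs => rw [← mul_one I]
    exact (ENNReal.mul_lt_mul_iff_right h0 hIt).2 ht1
  obtain ⟨f, g, hf, hg, hfg⟩ : ∃ f g : 𝔼 → ℝ≥0∞, IsEvenDensity f ∧ IsEvenDensity g ∧
      kernelForm lam δ r f g < I * t := by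
    conv at hlt => lhs; rw [hI, kernelConst]
    simp only [iInf_lt_iff] at hlt
    obtain ⟨f, g, hf, hg, h⟩ := hlt
    exact ⟨f, g, hf, hg, h⟩
  have hIL : I * (L / I) = L := ENNReal.mul_div_cancel h0 hIt
  refine ⟨f, g, hf, hg, hfg.le.trans ?_, ?_⟩
  · calc I * t ≤ I * (L / I) := by gcongr
      _ = L := hIL
  · have h := kernelForm_iterate_selfRot_le lam δ hr hf hg h0 hIt k
    have h2 : kernelForm lam δ r f g / I ≤ t := by
      rw [ENNReal.div_le_iff h0 hIt, mul_comm]; exact hfg.le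
    have h3 := h.trans (pow_le_pow_left₀ (zero_le) h2 _)
    rw [htk, ENNReal.div_le_iff h0 hIt, mul_comm, hIL] at h3
    exact h3

/-- Otherwise some L above the infimum satisfies cKL < 1, with K the mollification loss. Doublings
of pairs ever closer to optimal stay below L and, once mollified, converge to nondegenerate
Gaussians whose form is at most KL by Fatou, contradicting the Gaussian bound. -/
theorem one_le_mehlerConst_mul_kernelConst {a δ : ℝ} (ha0 : 0 < a) (ha : 0 < 1 - a ^ 2) (hδ : 0 < δ)
    (hs : δ * (a / (1 - a ^ 2)) ^ 2 + δ ^ 2 * (a / (1 - a ^ 2)) < 1) :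
    1 ≤ ENNReal.ofReal (mehlerConst n a) *
      (ENNReal.ofReal ((1 - (δ * (a / (1 - a ^ 2)) ^ 2 + δ ^ 2 * (a / (1 - a ^ 2)))) ^ (-(n : ℝ))) *
        kernelConst 𝔼 (a / (1 - a ^ 2)) δ (1 - a ^ 2)⁻¹) := by
  set lam := a / (1 - a ^ 2) with hlam
  set r := (1 - a ^ 2)⁻¹ with hr
  have hr1 : 1 < r := (one_lt_inv₀ ha).2 (by nlinarith)
  have hr0 : 0 < r := by linarith
  have hl0 : 0 < lam := by positivity
  have hc := mehlerConst_pos (n := n) ha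
  have h0 : 0 < 1 - (δ * lam ^ 2 + δ ^ 2 * lam) := by linarith
  set K := ENNReal.ofReal ((1 - (δ * lam ^ 2 + δ ^ 2 * lam)) ^ (-(n : ℝ))) with hK
  have hK0 : K ≠ 0 := by
    rw [hK, ne_eq, ENNReal.ofReal_eq_zero, not_le]; positivity
  set c := ENNReal.ofReal (mehlerConst n a) with hcdef
  have hc0 : c ≠ 0 := by
    rw [hcdef, ne_eq, ENNReal.ofReal_eq_zero, not_le]; exact hc
  have hcK0 : c * K ≠ 0 := mul_ne_zero hc0 hK0
  have hcKt : c * K ≠ ∞ := ENNReal.mul_ne_top ENNReal.ofReal_ne_top ENNReal.ofReal_ne_top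
  by_contra hcon
  rw [not_le, ← mul_assoc] at hcon
  have hI0 := kernelConst_ne_zero (E := 𝔼) lam hδ hr1
  have hlt : kernelConst 𝔼 lam δ r < (c * K)⁻¹ := by
    rw [← ENNReal.mul_lt_mul_iff_right hcK0 hcKt, ENNReal.mul_inv_cancel hcK0 hcKt]
    exact hcon
  obtain ⟨L, hIL, hLK⟩ := exists_between hlt
  have hLt : L ≠ ∞ := hLK.ne_top
  choose f g hf hg hfg hfgk using fun k => exists_kernelForm_iterate_le hr0 hI0 hIL hLt k
  -- Moments are bounded for the initial pairs, not for their doublings; this is why those pairs are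
  -- also required to lie below L.
  obtain ⟨M, hM, hMb⟩ := exists_fourthMoment_bound (E := 𝔼) lam hδ hr1 hLt
  obtain ⟨φ, -, A, B, hA, hB, hfl, hgl⟩ := exists_subseq_tendsto_cosTransform hf hg hM
    (fun j => hMb _ _ (hf j) (hg j) (hfg j))
    (fun j => hMb _ _ (hg j) (hf j) (by
      rw [kernelForm_swap lam δ r (hg j).measurable (hf j).measurable]; exact hfg j))
  have hε : 0 < δ ^ 2 := by positivity
  obtain ⟨S, D, hS, hD, hAS, hBD, hSD⟩ := exists_factorization (posDef_add_smul_one hA hε)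
    (posDef_add_smul_one hB hε)
  have hfk : ∀ j, IsEvenDensity (selfRot^[φ j] (f (φ j))) := fun j =>
    iterate_selfRot_isEvenDensity (hf _) _
  have hgk : ∀ j, IsEvenDensity (selfRot^[φ j] (g (φ j))) := fun j =>
    iterate_selfRot_isEvenDensity (hg _) _
  have hF := tendsto_gaussConv hε hfk hfl
  have hG := tendsto_gaussConv hε hgk hgl
  have hfm : ∀ j, Measurable (gaussConv (δ ^ 2) (selfRot^[φ j] (f (φ j)))) := fun j =>
    measurable_gaussConv _ (hfk j).measurable
  have hgm : ∀ j, Measurable (gaussConv (δ ^ 2) (selfRot^[φ j] (g (φ j)))) := fun j =>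
    measurable_gaussConv _ (hgk j).measurable
  have hbound : ∀ j, kernelForm lam 0 r (gaussConv (δ ^ 2) (selfRot^[φ j] (f (φ j))))
      (gaussConv (δ ^ 2) (selfRot^[φ j] (g (φ j)))) ≤ K * L := by
    intro j
    refine (kernelForm_gaussConv_le hl0.le hδ hr1.le hs (hfk j).measurable
      (hgk j).measurable).trans ?_
    gcongr
    exact hfgk (φ j)
  have hlimit := kernelForm_le_of_tendsto (lam := lam) (δ := 0) hr0 hfm hgm hF
    (fun _ => ENNReal.ofReal_ne_top) hG (fun _ => ENNReal.ofReal_ne_top) hbound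
  have hone := one_le_kernelForm_gaussian ha hS hD hSD
    (measurable_of_tendsto_metrizable hfm (tendsto_pi_nhds.2 hF))
    (measurable_of_tendsto_metrizable hgm (tendsto_pi_nhds.2 hG))
    (fun u => by rw [integral_cos_gaussian_transpose hS hAS u])
    (fun u => by rw [integral_cos_gaussian_transpose hD hBD u])
  have : c * (K * L) < 1 := by
    rw [← mul_assoc, ← ENNReal.mul_inv_cancel hcK0 hcKt]
    exact (ENNReal.mul_lt_mul_iff_right hcK0 hcKt).2 hLK
  exact absurd (hone.trans (by gcongr)) (not_le.2 this)

/-- On bounded supports the auxiliary weight costs a factor that tends to 1 as δ → 0, so δ can be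
removed. -/
theorem kernelForm_le_of_support {lam δ r R : ℝ} (hδ : 0 ≤ δ) (hr : 0 < r) {f g : 𝔼 → ℝ≥0∞}
    (hg : Measurable g) (hf0 : ∀ x, R < ‖x‖ → f x = 0) (hg0 : ∀ x, R < ‖x‖ → g x = 0) :
    kernelForm lam δ r f g ≤ ENNReal.ofReal (Real.exp (δ * R ^ 2)) * kernelForm lam 0 r f g := by
  unfold kernelForm
  rw [← lintegral_const_mul' _ _ ENNReal.ofReal_ne_top]
  refine lintegral_mono fun x => ?_
  rw [← lintegral_const_mul _ (by fun_prop)]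
  refine lintegral_mono fun y => ?_
  by_cases hx : R < ‖x‖
  · simp [hf0 x hx, ENNReal.zero_rpow_of_pos hr]
  by_cases hy : R < ‖y‖
  · simp [hg0 y hy, ENNReal.zero_rpow_of_pos hr]
  rw [← mul_assoc (ENNReal.ofReal _)]
  refine mul_le_mul' ?_ le_rfl
  unfold expKernel
  rw [← ENNReal.ofReal_mul (Real.exp_pos _).le, ← Real.exp_add]
  apply ENNReal.ofReal_le_ofReal
  apply Real.exp_le_exp.2
  have h1 : ‖x‖ ^ 2 ≤ R ^ 2 := pow_le_pow_left₀ (norm_nonneg x) (not_lt.1 hx) 2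
  have h2 : ‖y‖ ^ 2 ≤ R ^ 2 := pow_le_pow_left₀ (norm_nonneg y) (not_lt.1 hy) 2
  nlinarith

/-- The sharp inequality for even, compactly supported functions. -/
theorem rpow_mul_rpow_le_kernelForm {a : ℝ} (ha0 : 0 < a) (ha : 0 < 1 - a ^ 2) {f g : 𝔼 → ℝ≥0∞}
    (hf : Measurable f) (hg : Measurable g) (hfe : ∀ x, f (-x) = f x) (hge : ∀ x, g (-x) = g x)
    (hfin : ∫⁻ x, f x ≠ ∞) (hgin : ∫⁻ x, g x ≠ ∞) {R : ℝ} (hf0 : ∀ x, R < ‖x‖ → f x = 0)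
    (hg0 : ∀ x, R < ‖x‖ → g x = 0) :
    (∫⁻ x, f x) ^ (1 - a ^ 2)⁻¹ * (∫⁻ x, g x) ^ (1 - a ^ 2)⁻¹ ≤
      ENNReal.ofReal (mehlerConst n a) *
        kernelForm (a / (1 - a ^ 2)) 0 (1 - a ^ 2)⁻¹ f g := by
  set lam := a / (1 - a ^ 2) with hlam
  set r := (1 - a ^ 2)⁻¹ with hr
  have hr0 : 0 < r := by positivity
  have hc := mehlerConst_pos (n := n) ha
  set X := (∫⁻ x, f x) ^ r * (∫⁻ x, g x) ^ r with hX
  set κ : ℝ → ℝ := fun δ => (1 - (δ * lam ^ 2 + δ ^ 2 * lam)) ^ (-(n : ℝ)) * Real.exp (δ * R ^ 2)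
    with hκ
  have hκc : Filter.Tendsto (fun δ => ENNReal.ofReal (mehlerConst n a * κ δ))
      (nhdsWithin 0 (Set.Ioi 0)) (nhds (ENNReal.ofReal (mehlerConst n a))) := by
    have hcont : ContinuousAt (fun δ => mehlerConst n a * κ δ) 0 := by
      refine ContinuousAt.mul continuousAt_const (ContinuousAt.mul ?_ (by fun_prop))
      exact ContinuousAt.rpow_const (by fun_prop) (Or.inl (by simp))
    have h := ENNReal.tendsto_ofReal (hcont.tendsto.mono_left
      (nhdsWithin_le_nhds (s := Set.Ioi (0 : ℝ))))
    simpa [hκ] using h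
  have hsmall : ∀ᶠ δ in nhdsWithin (0 : ℝ) (Set.Ioi 0), δ * lam ^ 2 + δ ^ 2 * lam < 1 := by
    have hcont : ContinuousAt (fun δ : ℝ => δ * lam ^ 2 + δ ^ 2 * lam) 0 := by fun_prop
    exact (hcont.eventually_lt continuousAt_const (by simp)).filter_mono nhdsWithin_le_nhds
  have hT := ENNReal.Tendsto.mul_const (b := kernelForm lam 0 r f g) hκc
    (Or.inl (by simpa using hc))
  refine ge_of_tendsto hT ?_
  filter_upwards [hsmall, self_mem_nhdsWithin] with δ hδs hδ
  have hδ0 : 0 < δ := hδ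
  have h0 : 0 < 1 - (δ * lam ^ 2 + δ ^ 2 * lam) := by linarith
  have h1 := one_le_mehlerConst_mul_kernelConst (n := n) ha0 ha hδ0 hδs
  rw [← hlam, ← hr] at h1
  have h2 := kernelConst_mul_le lam δ hr0 hf hg hfe hge hfin hgin
  have h3 := kernelForm_le_of_support (lam := lam) hδ0.le hr0 hg hf0 hg0
  rw [← hX] at h2
  calc X ≤ ENNReal.ofReal (mehlerConst n a) *
      (ENNReal.ofReal ((1 - (δ * lam ^ 2 + δ ^ 2 * lam)) ^ (-(n : ℝ))) * kernelConst 𝔼 lam δ r) * X :=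
        le_mul_of_one_le_left' h1
    _ = ENNReal.ofReal (mehlerConst n a) *
      (ENNReal.ofReal ((1 - (δ * lam ^ 2 + δ ^ 2 * lam)) ^ (-(n : ℝ))) *
        (kernelConst 𝔼 lam δ r * X)) := by ring
    _ ≤ ENNReal.ofReal (mehlerConst n a) *
      (ENNReal.ofReal ((1 - (δ * lam ^ 2 + δ ^ 2 * lam)) ^ (-(n : ℝ))) *
        (ENNReal.ofReal (Real.exp (δ * R ^ 2)) * kernelForm lam 0 r f g)) := by
        exact mul_le_mul' le_rfl (mul_le_mul' le_rfl (h2.trans h3))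
    _ = _ := by
        rw [← mul_assoc (ENNReal.ofReal ((1 - (δ * lam ^ 2 + δ ^ 2 * lam)) ^ (-(n : ℝ)))),
          ← ENNReal.ofReal_mul (by positivity), ← mul_assoc, ← ENNReal.ofReal_mul hc.le]

end CoreInequality

/-! ### From the bilinear form to the Ornstein–Uhlenbeck inequality. -/

theorem ennreal_rpow_le_rpow_of_nonpos {z : ℝ} (hz : z ≤ 0) {x y : ℝ≥0∞} (h : x ≤ y) :
    y ^ z ≤ x ^ z := by
  have := ENNReal.inv_le_inv.2 (ENNReal.rpow_le_rpow h (neg_nonneg.2 hz))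
  simpa only [ENNReal.rpow_neg, inv_inv] using this

section OrnsteinUhlenbeck

variable {n : ℕ}

local notation "𝔼" => EuclideanSpace ℝ (Fin n)

theorem exp_neg_two_mul (s : ℝ) : Real.exp (-(2 * s)) = Real.exp (-s) ^ 2 := by
  rw [← Real.exp_nat_mul]; congr 1; push_cast; ring

theorem one_sub_exp_sq_pos {s : ℝ} (hs : 0 < s) : 0 < 1 - Real.exp (-s) ^ 2 := by
  rw [← exp_neg_two_mul, sub_pos, Real.exp_lt_one_iff]; linarith

theorem ouSemigroup_eq {s : ℝ} (hs : 0 < s) (g : 𝔼 → ℝ≥0∞) (x : 𝔼) :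
    ouSemigroup s g x = ∫⁻ y, ENNReal.ofReal
      (gaussianDensity (1 - Real.exp (-s) ^ 2) (y - Real.exp (-s) • x)) * g y := by
  have h0 := one_sub_exp_sq_pos hs
  have hpi := Real.pi_pos
  unfold ouSemigroup gaussianDensity
  refine lintegral_congr fun y => ?_
  rw [exp_neg_two_mul, norm_sub_rev, Real.rpow_neg (by positivity), div_eq_inv_mul]

theorem measurable_ouSemigroup {s : ℝ} (hs : 0 < s) {g : 𝔼 → ℝ≥0∞} (hg : Measurable g) :
    Measurable (ouSemigroup s g) := by
  rw [show ouSemigroup s g = _ from funext (ouSemigroup_eq hs g)]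
  fun_prop

theorem ouSemigroup_neg {s : ℝ} (hs : 0 < s) {g : 𝔼 → ℝ≥0∞} (hg : ∀ x, g (-x) = g x) (x : 𝔼) :
    ouSemigroup s g (-x) = ouSemigroup s g x := by
  rw [ouSemigroup_eq hs, ouSemigroup_eq hs, ← lintegral_neg_eq_self]
  refine lintegral_congr fun y => ?_
  rw [hg, ← gaussianDensity_neg]
  congr 3
  module

/-- By the Mehler identity the normalised kernel times the r-th powers of γ is γ(x) times the
transition density of the semigroup. -/
theorem kernelForm_eq_ouSemigroup {s : ℝ} (hs : 0 < s) {f g : 𝔼 → ℝ≥0∞} (hf : Measurable f) :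
    ENNReal.ofReal (mehlerConst n (Real.exp (-s))) *
      kernelForm (Real.exp (-s) / (1 - Real.exp (-s) ^ 2)) 0 (1 - Real.exp (-s) ^ 2)⁻¹ g f =
      ∫⁻ x, ENNReal.ofReal (stdDensity x) *
        ((g x / ENNReal.ofReal (stdDensity x)) ^ (1 - Real.exp (-s) ^ 2)⁻¹ *
          ouSemigroup s (fun y => (f y / ENNReal.ofReal (stdDensity y)) ^ (1 - Real.exp (-s) ^ 2)⁻¹)
            x) := by
  have ha := one_sub_exp_sq_pos hs
  set a := Real.exp (-s) with ha_def
  set r := (1 - a ^ 2)⁻¹ with hr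
  have hr0 : 0 < r := by positivity
  have hpow : ∀ (h : 𝔼 → ℝ≥0∞) (x : 𝔼), h x ^ r =
      (h x / ENNReal.ofReal (stdDensity x)) ^ r * ENNReal.ofReal (stdDensity x ^ r) := by
    intro h x
    have hx := stdDensity_pos x
    rw [← ENNReal.ofReal_rpow_of_pos hx, ← ENNReal.mul_rpow_of_nonneg _ _ hr0.le,
      ENNReal.div_mul_cancel (by simpa using hx) ENNReal.ofReal_ne_top]
  unfold kernelForm
  rw [← lintegral_const_mul' _ _ ENNReal.ofReal_ne_top]
  refine lintegral_congr fun x => ?_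
  rw [ouSemigroup_eq hs, ← lintegral_const_mul' _ _ ENNReal.ofReal_ne_top, ← mul_assoc,
    ← lintegral_const_mul _ (by fun_prop)]
  refine lintegral_congr fun y => ?_
  have hx := stdDensity_pos x
  have hy := stdDensity_pos y
  rw [hpow g, hpow f]
  have hid : ENNReal.ofReal (mehlerConst n a) * (expKernel (a / (1 - a ^ 2)) 0 x y *
      (ENNReal.ofReal (stdDensity x ^ r) * ENNReal.ofReal (stdDensity y ^ r))) =
      ENNReal.ofReal (stdDensity x) * ENNReal.ofReal (gaussianDensity (1 - a ^ 2) (y - a • x)) := by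
    rw [expKernel, ← ENNReal.ofReal_mul (by positivity), ← ENNReal.ofReal_mul (by positivity),
      ← ENNReal.ofReal_mul (mehlerConst_pos ha).le, ← ENNReal.ofReal_mul hx.le,
      ← mehler_identity ha]
    simp [hr]
  calc _ = (g x / ENNReal.ofReal (stdDensity x)) ^ r * (f y / ENNReal.ofReal (stdDensity y)) ^ r *
        (ENNReal.ofReal (mehlerConst n a) * (expKernel (a / (1 - a ^ 2)) 0 x y *
        (ENNReal.ofReal (stdDensity x ^ r) * ENNReal.ofReal (stdDensity y ^ r)))) := by ring
    _ = _ := by rw [hid]; ring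

/-- Truncation of a function, both in space and in height. -/
def truncate (k : ℕ) (f : 𝔼 → ℝ≥0∞) (x : 𝔼) : ℝ≥0∞ :=
  (Metric.closedBall (0 : 𝔼) k).indicator (fun x => min (f x) k) x

theorem measurable_truncate (k : ℕ) {f : 𝔼 → ℝ≥0∞} (hf : Measurable f) :
    Measurable (truncate k f) :=
  (hf.min measurable_const).indicator measurableSet_closedBall

theorem truncate_le (k : ℕ) (f : 𝔼 → ℝ≥0∞) (x : 𝔼) : truncate k f x ≤ f x := by
  unfold truncate
  refine Set.indicator_le (fun x _ => min_le_left _ _) x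

theorem truncate_neg (k : ℕ) {f : 𝔼 → ℝ≥0∞} (hf : ∀ x, f (-x) = f x) (x : 𝔼) :
    truncate k f (-x) = truncate k f x := by
  simp [truncate, Set.indicator, hf]

theorem truncate_eq_zero {k : ℕ} {f : 𝔼 → ℝ≥0∞} {x : 𝔼} (hx : (k : ℝ) < ‖x‖) :
    truncate k f x = 0 := by
  simp [truncate, hx]

theorem lintegral_truncate_ne_top (k : ℕ) (f : 𝔼 → ℝ≥0∞) : ∫⁻ x, truncate k f x ≠ ∞ := by
  unfold truncate
  rw [lintegral_indicator measurableSet_closedBall]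
  refine ne_top_of_le_ne_top (b := k * volume (Metric.closedBall (0 : 𝔼) k))
    (ENNReal.mul_ne_top (by simp) measure_closedBall_lt_top.ne) ?_
  rw [← setLIntegral_const]
  exact lintegral_mono fun x => min_le_right _ _

theorem tendsto_lintegral_truncate {f : 𝔼 → ℝ≥0∞} (hf : Measurable f) :
    Filter.Tendsto (fun k => ∫⁻ x, truncate k f x) Filter.atTop (nhds (∫⁻ x, f x)) := by
  refine lintegral_tendsto_of_tendsto_of_monotone (fun k => (measurable_truncate k hf).aemeasurable)
    (Filter.Eventually.of_forall fun x => ?_) (Filter.Eventually.of_forall fun x => ?_)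
  · intro k l hkl
    have hkl' : (k : ℝ) ≤ l := by exact_mod_cast hkl
    have hkl'' : (k : ℝ≥0∞) ≤ l := by exact_mod_cast hkl
    refine (Set.indicator_le_indicator_of_subset (Metric.closedBall_subset_closedBall hkl')
      (fun _ => zero_le) x).trans (Set.indicator_le_indicator ?_)
    gcongr
  · have h1 : Filter.Tendsto (fun k : ℕ => min (f x) (k : ℝ≥0∞)) Filter.atTop (nhds (f x)) := by
      have := (tendsto_const_nhds (x := f x)).min ENNReal.tendsto_nat_nhds_top
      simpa using this
    refine h1.congr' ?_
    filter_upwards [Filter.eventually_ge_atTop ⌈‖x‖⌉₊] with k hk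
    have : ‖x‖ ≤ k := (Nat.le_ceil _).trans (by exact_mod_cast hk)
    simp [truncate, this]

/-- The endpoint inequality for even functions. -/
theorem rpow_lintegral_le_gaussLpNorm {s : ℝ} (hs : 0 < s) {f : 𝔼 → ℝ≥0∞} (hf : Measurable f)
    (hfe : ∀ x, f (-x) = f x) :
    (∫⁻ x, f x) ^ (1 - Real.exp (-s) ^ 2)⁻¹ ≤ gaussLpNorm (1 - Real.exp (2 * s))
      (ouSemigroup s fun y => (f y / ENNReal.ofReal (stdDensity y)) ^ (1 - Real.exp (-s) ^ 2)⁻¹) := by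
  have ha := one_sub_exp_sq_pos hs
  have ha0 := Real.exp_pos (-s)
  have hq0 : 1 - Real.exp (2 * s) = -((1 - Real.exp (-s) ^ 2) / Real.exp (-s) ^ 2) := by
    have : Real.exp (2 * s) = (Real.exp (-s) ^ 2)⁻¹ := by
      rw [← exp_neg_two_mul, ← Real.exp_neg, neg_neg]
    rw [this]
    field_simp
    ring
  rw [hq0]
  set a := Real.exp (-s) with ha_def
  set r := (1 - a ^ 2)⁻¹ with hr
  have hr0 : 0 < r := by positivity
  have hr1 : 0 < r - 1 := by
    rw [sub_pos]; exact (one_lt_inv₀ ha).2 (by nlinarith [sq_pos_of_pos ha0])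
  set q := -((1 - a ^ 2) / a ^ 2) with hq
  -- The conjugacy of the endpoint exponents: qr + 1 = q, hence γ(F^q)^r F = γF^q wherever F is
  -- finite and positive. This singles out G = γF^q as the test function.
  have hqr : q * (r - 1) = -1 := by rw [hq, hr]; field_simp; ring
  have hq1 : 1 / q = 1 - r := by
    have : q ≠ 0 := by intro h; rw [h] at hqr; norm_num at hqr
    field_simp; linarith
  set F := ouSemigroup s fun y => (f y / ENNReal.ofReal (stdDensity y)) ^ r with hF
  have hFm : Measurable F := measurable_ouSemigroup hs (by fun_prop)
  have hγe : ∀ x : 𝔼, stdDensity (-x) = stdDensity x := fun x => by simp [stdDensity]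
  have hFe : ∀ x, F (-x) = F x := ouSemigroup_neg hs (fun x => by rw [hfe, hγe])
  set G : 𝔼 → ℝ≥0∞ := fun x => ENNReal.ofReal (stdDensity x) * F x ^ q with hG
  have hGm : Measurable G := by fun_prop
  have hGe : ∀ x, G (-x) = G x := fun x => by simp only [hG]; rw [hFe, hγe]
  have key : ∀ k : ℕ, (∫⁻ x, truncate k f x) ^ r ≤ (∫⁻ x, truncate k G x) ^ (1 - r) := by
    intro k
    have h1 := rpow_mul_rpow_le_kernelForm ha0 ha (measurable_truncate k hGm)
      (measurable_truncate k hf) (truncate_neg k hGe) (truncate_neg k hfe)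
      (lintegral_truncate_ne_top k G) (lintegral_truncate_ne_top k f) (R := k)
      (fun x hx => truncate_eq_zero hx) (fun x hx => truncate_eq_zero hx)
    rw [← hr] at h1
    have h2 : ENNReal.ofReal (mehlerConst n a) * kernelForm (a / (1 - a ^ 2)) 0 r
        (truncate k G) (truncate k f) ≤ ∫⁻ x, truncate k G x := by
      have hmono : kernelForm (a / (1 - a ^ 2)) 0 r (truncate k G) (truncate k f) ≤
          kernelForm (a / (1 - a ^ 2)) 0 r (truncate k G) f := by
        unfold kernelForm
        gcongr with x y
        exact truncate_le k f y
      refine (mul_le_mul' le_rfl hmono).trans ?_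
      rw [hr, ha_def, kernelForm_eq_ouSemigroup hs hf]
      refine lintegral_mono fun x => ?_
      rw [← ha_def, ← hr]
      change ENNReal.ofReal (stdDensity x) *
        ((truncate k G x / ENNReal.ofReal (stdDensity x)) ^ r * F x) ≤ truncate k G x
      have hx : ENNReal.ofReal (stdDensity x) ≠ 0 := by simpa using stdDensity_pos x
      set u := truncate k G x / ENNReal.ofReal (stdDensity x) with hu
      have hγu : ENNReal.ofReal (stdDensity x) * u = truncate k G x :=
        ENNReal.mul_div_cancel hx ENNReal.ofReal_ne_top
      have huF : u ≤ F x ^ q := by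
        rw [hu, ENNReal.div_le_iff hx ENNReal.ofReal_ne_top, mul_comm]
        exact truncate_le k G x
      rw [← hγu]
      refine mul_le_mul' le_rfl ?_
      calc u ^ r * F x = u ^ (1 + (r - 1)) * F x := by rw [add_sub_cancel]
        _ = u * (u ^ (r - 1) * F x) := by
          rw [ENNReal.rpow_add_of_nonneg _ _ zero_le_one hr1.le, ENNReal.rpow_one, mul_assoc]
        _ ≤ u * ((F x ^ q) ^ (r - 1) * F x) := by gcongr
        _ = u * ((F x)⁻¹ * F x) := by
          rw [← ENNReal.rpow_mul, hqr, ENNReal.rpow_neg_one]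
        _ ≤ u * 1 := by gcongr; exact ENNReal.inv_mul_le_one _
        _ = u := mul_one u
    have h3 := h1.trans h2
    -- Truncation makes the mass X of G finite, so X^r can be cancelled from (∫f)^r X^r ≤ X, f being
    -- truncated as well; if X = 0 then X^{1-r} = ∞ and nothing is needed.
    have hGt := lintegral_truncate_ne_top k G
    set X := ∫⁻ x, truncate k G x
    by_cases hX0 : X = 0
    · rw [hX0, ENNReal.zero_rpow_of_neg (by linarith)]
      exact le_top
    rw [← ENNReal.mul_le_mul_iff_right
      (by simp [hX0, hGt] : X ^ r ≠ 0) (by simp [hX0, hGt] : X ^ r ≠ ∞),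
      ← ENNReal.rpow_add _ _ hX0 hGt, add_sub_cancel, ENNReal.rpow_one]
    exact h3
  have hlim := le_of_tendsto_of_tendsto'
    ((ENNReal.continuous_rpow_const (y := r)).tendsto _ |>.comp (tendsto_lintegral_truncate hf))
    ((ENNReal.continuous_rpow_const (y := 1 - r)).tendsto _ |>.comp
      (tendsto_lintegral_truncate hGm)) key
  unfold gaussLpNorm
  rw [hq1, lintegral_stdMeasure (by fun_prop)]
  exact hlim

/-- Jensen for the power q₀/q ≥ 1 on a probability space; the outer exponent 1/q₀ is negative and
reverses the inequality. -/
theorem gaussLpNorm_mono_exponent {q₀ q : ℝ} (h : q₀ ≤ q) (hq : q < 0) {F : 𝔼 → ℝ≥0∞}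
    (hF : Measurable F) : gaussLpNorm q₀ F ≤ gaussLpNorm q F := by
  have hq₀ : q₀ < 0 := h.trans_lt hq
  have h1 : 1 ≤ q₀ / q := by rw [one_le_div_of_neg hq]; exact h
  have h2 := rpow_lintegral_le (μ := stdMeasure n) h1 (f := fun x => F x ^ q) (by fun_prop)
  simp_rw [← ENNReal.rpow_mul, mul_div_cancel₀ q₀ hq.ne] at h2
  unfold gaussLpNorm
  calc _ ≤ ((∫⁻ x, F x ^ q ∂(stdMeasure n)) ^ (q₀ / q)) ^ (1 / q₀) :=
        ennreal_rpow_le_rpow_of_nonpos (by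
          rw [one_div]; exact inv_nonpos.2 hq₀.le) h2
    _ = _ := by
        rw [← ENNReal.rpow_mul]
        congr 1
        have := hq.ne
        have := hq₀.ne
        field_simp

theorem gaussLpNorm_mono {q : ℝ} (hq : q < 0) {F G : 𝔼 → ℝ≥0∞} (h : ∀ x, F x ≤ G x) :
    gaussLpNorm q F ≤ gaussLpNorm q G := by
  unfold gaussLpNorm
  refine ennreal_rpow_le_rpow_of_nonpos (by rw [one_div]; exact inv_nonpos.2 hq.le) ?_
  exact lintegral_mono fun x => ennreal_rpow_le_rpow_of_nonpos hq.le (h x)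

/-- The inequality for even functions with values in `[0, ∞]`. -/
theorem rpow_lintegral_le_gaussLpNorm_of_le {s p q : ℝ} (hs : 0 < s) (hq : q < 0) (hp : 0 < p)
    (hqs : 1 - Real.exp (2 * s) ≤ q) (hps : p ≤ 1 - Real.exp (-(2 * s))) {f : 𝔼 → ℝ≥0∞}
    (hf : Measurable f) (hfe : ∀ x, f (-x) = f x) :
    (∫⁻ x, f x) ^ (1 / p) ≤ gaussLpNorm q
      (ouSemigroup s fun y => (f y / ENNReal.ofReal (stdDensity y)) ^ (1 / p)) := by
  rw [exp_neg_two_mul] at hps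
  have ha := one_sub_exp_sq_pos hs
  set p₀ := 1 - Real.exp (-s) ^ 2 with hp₀
  have hpp : 1 ≤ p₀ / p := (one_le_div hp).2 hps
  set γ : 𝔼 → ℝ≥0∞ := fun x => ENNReal.ofReal (stdDensity x) with hγ
  have hγ0 : ∀ x, γ x ≠ 0 := fun x => by simpa [hγ] using stdDensity_pos x
  have hγt : ∀ x, γ x ≠ ∞ := fun x => ENNReal.ofReal_ne_top
  have hγm : Measurable γ := by fun_prop
  have hγe : ∀ x : 𝔼, γ (-x) = γ x := fun x => by simp [hγ, stdDensity]
  -- Chosen so that (h/γ)^{1/p₀} = (f/γ)^{1/p}: the endpoint case for h has the wanted semigroup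
  -- term, and Jensen compares the masses of h and f.
  set h : 𝔼 → ℝ≥0∞ := fun x => γ x * (f x / γ x) ^ (p₀ / p) with hh
  have hcancel : ∀ x, h x / γ x = (f x / γ x) ^ (p₀ / p) := fun x => by
    simp only [hh]; rw [mul_comm, ENNReal.mul_div_cancel_right (hγ0 x) (hγt x)]
  have h1 := rpow_lintegral_le_gaussLpNorm hs (f := h) (by fun_prop)
    (fun x => by simp only [hh]; rw [hγe, hfe])
  have h2 : (fun y => (h y / ENNReal.ofReal (stdDensity y)) ^ p₀⁻¹) =
      fun y => (f y / ENNReal.ofReal (stdDensity y)) ^ (1 / p) := by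
    funext y
    change (h y / γ y) ^ p₀⁻¹ = (f y / γ y) ^ (1 / p)
    rw [hcancel, ← ENNReal.rpow_mul]
    congr 1
    field_simp
  rw [← hp₀, h2] at h1
  have h3 := rpow_lintegral_le (μ := stdMeasure n) hpp (f := fun x => f x / γ x) (by fun_prop)
  rw [lintegral_stdMeasure (by fun_prop), lintegral_stdMeasure (by fun_prop)] at h3
  have h4 : ∫⁻ x, ENNReal.ofReal (stdDensity x) * (f x / γ x) = ∫⁻ x, f x :=
    lintegral_congr fun x => ENNReal.mul_div_cancel (hγ0 x) (hγt x)
  rw [h4] at h3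
  calc (∫⁻ x, f x) ^ (1 / p) = ((∫⁻ x, f x) ^ (p₀ / p)) ^ p₀⁻¹ := by
        rw [← ENNReal.rpow_mul]
        congr 1
        field_simp
    _ ≤ (∫⁻ x, h x) ^ p₀⁻¹ := by gcongr
    _ ≤ _ := h1
    _ ≤ _ := gaussLpNorm_mono_exponent hqs hq (measurable_ouSemigroup hs (by fun_prop))

theorem rpow_integral_le_hcNorm {s p q : ℝ} (hs : 0 < s) (hq : q < 0) (hp : 0 < p)
    (hqs : 1 - Real.exp (2 * s) ≤ q) (hps : p ≤ 1 - Real.exp (-(2 * s))) {f : 𝔼 → ℝ}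
    (hf : Integrable f) (hf0 : ∀ᵐ x, 0 ≤ f x) (hfe : ∀ᵐ x, f (-x) = f x) :
    ENNReal.ofReal (∫ x, f x) ^ (1 / p) ≤ hcNorm s p q f := by
  have hm : AEMeasurable (fun x => ENNReal.ofReal (f x)) := hf.aemeasurable.ennreal_ofReal
  set g := hm.mk with hg
  have hgm : Measurable g := hm.measurable_mk
  have hgf : (fun x => ENNReal.ofReal (f x)) =ᵐ[volume] g := hm.ae_eq_mk
  have hgf' : ∀ᵐ x : 𝔼, ENNReal.ofReal (f (-x)) = g (-x) :=
    (Measure.measurePreserving_neg (volume : Measure 𝔼)).quasiMeasurePreserving.ae hgf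
  have hae : ∀ᵐ x : 𝔼, ENNReal.ofReal (f x) = max (g x) (g (-x)) := by
    filter_upwards [hgf, hgf', hfe] with x h1 h2 h3
    rw [← h1, ← h2, h3, max_self]
  -- A measurable representative need be even only almost everywhere; the maximum with its
  -- reflection is even everywhere and agrees with f almost everywhere.
  have h := rpow_lintegral_le_gaussLpNorm_of_le hs hq hp hqs hps
    (f := fun x : 𝔼 => max (g x) (g (-x))) (by fun_prop)
    (fun x => by rw [neg_neg, max_comm])
  rw [ofReal_integral_eq_lintegral_ofReal hf hf0, lintegral_congr_ae hae]
  refine h.trans (le_of_eq ?_)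
  unfold hcNorm
  congr 1
  funext x
  unfold ouSemigroup
  refine lintegral_congr_ae ?_
  filter_upwards [hae] with y hy
  rw [ENNReal.ofReal_div_of_pos (stdDensity_pos y), hy]

theorem hcNorm_stdDensity {s : ℝ} (hs : 0 < s) (p q : ℝ) :
    hcNorm s p q (stdDensity (n := n)) = 1 := by
  have h0 := one_sub_exp_sq_pos hs
  have h1 : ∀ x : 𝔼, ouSemigroup s
      (fun y => ENNReal.ofReal (stdDensity y / stdDensity y) ^ (1 / p)) x = 1 := by
    intro x
    rw [ouSemigroup_eq hs]
    simp_rw [fun y : 𝔼 => div_self (stdDensity_pos y).ne', ENNReal.ofReal_one, ENNReal.one_rpow,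
      mul_one]
    rw [lintegral_sub_right_eq_self (fun y => ENNReal.ofReal (gaussianDensity _ y)),
      lintegral_gaussianDensity h0]
  unfold hcNorm gaussLpNorm
  simp_rw [h1]
  simp

end OrnsteinUhlenbeck

/-! ### Gaussian counterexamples outside the range of exponents. -/

section Necessity

variable {n : ℕ}

local notation "𝔼" => EuclideanSpace ℝ (Fin n)

theorem gaussianDensity_div_stdDensity_rpow {β p : ℝ} (hβ : 0 < β) (y : 𝔼) :
    (gaussianDensity β y / stdDensity y) ^ (1 / p) =
      (β ^ (-((n : ℝ) / 2))) ^ (1 / p) * Real.exp (-((β⁻¹ - 1) / p) * ‖y‖ ^ 2 / 2) := by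
  have hpi := Real.pi_pos
  have h : gaussianDensity β y / stdDensity y =
      β ^ (-((n : ℝ) / 2)) * Real.exp (-(β⁻¹ - 1) * ‖y‖ ^ 2 / 2) := by
    have hP : 0 < (2 * Real.pi) ^ (-((n : ℝ) / 2)) := by positivity
    unfold gaussianDensity stdDensity
    rw [Real.mul_rpow (by positivity) hβ.le, mul_assoc, mul_div_mul_left _ _ hP.ne', mul_div_assoc,
      ← Real.exp_sub]
    congr 2
    field_simp
    ring
  rw [h, Real.mul_rpow (by positivity) (Real.exp_pos _).le, ← Real.exp_mul]
  congr 2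
  ring

/-- Complete the square in y. The positivity hypothesis is the convergence condition, and b may be
negative. -/
theorem ouSemigroup_exp {s b : ℝ} (hs : 0 < s) (hb : 0 < 1 + b * (1 - Real.exp (-s) ^ 2)) (x : 𝔼) :
    ouSemigroup s (fun y => ENNReal.ofReal (Real.exp (-b * ‖y‖ ^ 2 / 2))) x =
      ENNReal.ofReal ((1 + b * (1 - Real.exp (-s) ^ 2)) ^ (-((n : ℝ) / 2)) *
        Real.exp (-(Real.exp (-s) ^ 2 * b / (2 * (1 + b * (1 - Real.exp (-s) ^ 2)))) * ‖x‖ ^ 2)) := by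
  have h0 := one_sub_exp_sq_pos hs
  have hpi := Real.pi_pos
  rw [ouSemigroup_eq hs]
  set a := Real.exp (-s)
  set v := 1 - a ^ 2
  set d := 1 + b * v with hd
  have hpt : ∀ y : 𝔼, gaussianDensity v (y - a • x) * Real.exp (-b * ‖y‖ ^ 2 / 2) =
      d ^ (-((n : ℝ) / 2)) * Real.exp (-(a ^ 2 * b / (2 * d)) * ‖x‖ ^ 2) *
        gaussianDensity (v / d) (y - (a / d) • x) := by
    intro y
    unfold gaussianDensity
    rw [show 2 * Real.pi * v = d * (2 * Real.pi * (v / d)) by field_simp,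
      Real.mul_rpow hb.le (by positivity)]
    have he : Real.exp (-(‖y - a • x‖ ^ 2 / (2 * v))) * Real.exp (-b * ‖y‖ ^ 2 / 2) =
        Real.exp (-(a ^ 2 * b / (2 * d)) * ‖x‖ ^ 2) *
          Real.exp (-(‖y - (a / d) • x‖ ^ 2 / (2 * (v / d)))) := by
      rw [← Real.exp_add, ← Real.exp_add]
      congr 1
      simp only [norm_sub_sq_real, norm_smul, mul_pow, Real.norm_eq_abs, sq_abs, inner_smul_right,
        div_pow]
      field_simp
      rw [hd]
      ring
    calc _ = d ^ (-((n : ℝ) / 2)) * (2 * Real.pi * (v / d)) ^ (-((n : ℝ) / 2)) *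
          (Real.exp (-(‖y - a • x‖ ^ 2 / (2 * v))) * Real.exp (-b * ‖y‖ ^ 2 / 2)) := by ring
      _ = _ := by rw [he]; ring
  simp_rw [fun y : 𝔼 => (ENNReal.ofReal_mul (p := gaussianDensity v (y - a • x))
    (q := Real.exp (-b * ‖y‖ ^ 2 / 2)) (gaussianDensity_pos h0 _).le).symm, hpt]
  simp_rw [ENNReal.ofReal_mul (p := d ^ (-((n : ℝ) / 2)) *
    Real.exp (-(a ^ 2 * b / (2 * d)) * ‖x‖ ^ 2)) (by positivity)]
  rw [lintegral_const_mul _ (by fun_prop),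
    lintegral_sub_right_eq_self (fun y => ENNReal.ofReal (gaussianDensity _ y)),
    lintegral_gaussianDensity (by positivity), mul_one]

theorem ouSemigroup_const_mul {s : ℝ} {c : ℝ≥0∞} (hc : c ≠ ∞) (g : 𝔼 → ℝ≥0∞) (x : 𝔼) :
    ouSemigroup s (fun y => c * g y) x = c * ouSemigroup s g x := by
  unfold ouSemigroup
  rw [← lintegral_const_mul' _ _ hc]
  exact lintegral_congr fun y => by ring

theorem hcNorm_gaussianDensity_eq {s p q β : ℝ} (hp : 0 < p) (hβ : 0 < β) :
    hcNorm s p q (gaussianDensity (n := n) β) = gaussLpNorm q fun x : 𝔼 =>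
      ENNReal.ofReal ((β ^ (-((n : ℝ) / 2))) ^ (1 / p)) * ouSemigroup s
        (fun y => ENNReal.ofReal (Real.exp (-((β⁻¹ - 1) / p) * ‖y‖ ^ 2 / 2))) x := by
  unfold hcNorm
  congr 1
  funext x
  rw [← ouSemigroup_const_mul ENNReal.ofReal_ne_top]
  congr 1
  funext y
  have h1 := gaussianDensity_pos hβ y
  have h2 := stdDensity_pos y
  rw [ENNReal.ofReal_rpow_of_nonneg (by positivity) (by positivity),
    gaussianDensity_div_stdDensity_rpow hβ, ENNReal.ofReal_mul (by positivity)]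

/-- For `q` below the critical exponent, some Gaussian has vanishing norm. -/
theorem exists_hcNorm_eq_zero (hn : 1 ≤ n) {s p q : ℝ} (hs : 0 < s) (hp : 0 < p)
    (hqs : q < 1 - Real.exp (2 * s)) :
    ∃ β : ℝ, 0 < β ∧ hcNorm s p q (gaussianDensity (n := n) β) = 0 := by
  have h0 := one_sub_exp_sq_pos hs
  have ha0 := Real.exp_pos (-s)
  have hpi := Real.pi_pos
  have hinv : Real.exp (2 * s) * Real.exp (-s) ^ 2 = 1 := by
    rw [← exp_neg_two_mul, ← Real.exp_add]; simp
  have hq0 : q < 0 := hqs.trans (by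
    rw [sub_neg]; exact Real.one_lt_exp_iff.2 (by linarith))
  set a := Real.exp (-s)
  have hgap : 0 < -q * a ^ 2 - (1 - a ^ 2) := by nlinarith [sq_pos_of_pos ha0]
  -- This b solves -q a² b = 1 + b(1-a²), so that F^q grows exactly like e^{|x|²/2} and γF^q is
  -- constant. It is positive precisely because q is below the critical value.
  set b := (-q * a ^ 2 - (1 - a ^ 2))⁻¹ with hb
  have hb0 : 0 < b := by positivity
  set d := 1 + b * (1 - a ^ 2) with hd
  have hd0 : 0 < d := by positivity
  have hκ : -q * (a ^ 2 * b / (2 * d)) = 1 / 2 := by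
    have hbg : b * (-q * a ^ 2 - (1 - a ^ 2)) = 1 := inv_mul_cancel₀ hgap.ne'
    have : d = b * (-q * a ^ 2) := by
      rw [hd]; linear_combination -hbg
    have hqa : 0 < -q * a ^ 2 := by nlinarith
    rw [this]
    have hqn : q ≠ 0 := hq0.ne
    field_simp
  refine ⟨(1 + p * b)⁻¹, by positivity, ?_⟩
  rw [hcNorm_gaussianDensity_eq hp (by positivity)]
  have hbb : ((1 + p * b)⁻¹⁻¹ - 1) / p = b := by rw [inv_inv]; field_simp; ring
  simp_rw [hbb, ouSemigroup_exp hs hd0]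
  set B := (((1 + p * b)⁻¹ : ℝ) ^ (-((n : ℝ) / 2))) ^ (1 / p) with hB
  have hB0 : 0 < B := by positivity
  have hC0 : 0 < B * d ^ (-((n : ℝ) / 2)) := by positivity
  set C := (B * d ^ (-((n : ℝ) / 2))) ^ q * (2 * Real.pi) ^ (-((n : ℝ) / 2)) with hC
  have hCp : 0 < C := by positivity
  -- In dimension 0 a constant has finite integral; n ≥ 1 makes the volume of the space infinite.
  have hne : Nonempty (Fin n) := ⟨⟨0, hn⟩⟩
  have hnt : Nontrivial 𝔼 := by
    have : Nontrivial (Fin n → ℝ) := inferInstance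
    exact (WithLp.equiv 2 (Fin n → ℝ)).nontrivial
  have hint : ∫⁻ x : 𝔼, (ENNReal.ofReal B * ENNReal.ofReal (d ^ (-((n : ℝ) / 2)) *
      Real.exp (-(a ^ 2 * b / (2 * d)) * ‖x‖ ^ 2))) ^ q ∂(stdMeasure n) = ∞ := by
    rw [lintegral_stdMeasure (by fun_prop)]
    have hpt : ∀ x : 𝔼, ENNReal.ofReal (stdDensity x) *
        (ENNReal.ofReal B * ENNReal.ofReal (d ^ (-((n : ℝ) / 2)) *
          Real.exp (-(a ^ 2 * b / (2 * d)) * ‖x‖ ^ 2))) ^ q = ENNReal.ofReal C := by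
      intro x
      rw [← ENNReal.ofReal_mul hB0.le, ENNReal.ofReal_rpow_of_pos (by positivity),
        ← ENNReal.ofReal_mul (stdDensity_pos x).le]
      congr 1
      rw [← mul_assoc, Real.mul_rpow hC0.le (Real.exp_pos _).le, ← Real.exp_mul,
        show -(a ^ 2 * b / (2 * d)) * ‖x‖ ^ 2 * q = (-q * (a ^ 2 * b / (2 * d))) * ‖x‖ ^ 2 by ring,
        hκ, stdDensity]
      have hexp : Real.exp (-(‖x‖ ^ 2 / 2)) * Real.exp (1 / 2 * ‖x‖ ^ 2) = 1 := by
        rw [← Real.exp_add]; simp; ring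
      calc _ = C * (Real.exp (-(‖x‖ ^ 2 / 2)) * Real.exp (1 / 2 * ‖x‖ ^ 2)) := by rw [hC]; ring
        _ = C := by rw [hexp, mul_one]
    simp_rw [hpt]
    rw [lintegral_const, measure_univ_of_isAddLeftInvariant]
    exact ENNReal.mul_top (by simpa using hCp)
  unfold gaussLpNorm
  rw [hint, ENNReal.top_rpow_of_neg (by rw [one_div]; exact inv_lt_zero.2 hq0)]

/-- For `p` above the critical exponent, the norms of wide Gaussians tend to zero. -/
theorem iInf_hcNorm_eq_zero (hn : 1 ≤ n) {s p q : ℝ} (hs : 0 < s) (hq : q < 0) (hp : 0 < p)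
    (hps : 1 - Real.exp (-(2 * s)) < p) :
    ⨅ (β : ℝ) (_ : 0 < β), hcNorm s p q (gaussianDensity (n := n) β) = 0 := by
  have h0 := one_sub_exp_sq_pos hs
  rw [exp_neg_two_mul] at hps
  have hd : 0 < 1 + (-(1 / p)) * (1 - Real.exp (-s) ^ 2) := by
    have : 1 / p * (1 - Real.exp (-s) ^ 2) < 1 := by
      rw [one_div_mul_eq_div, div_lt_one hp]; exact hps
    linarith
  -- Up to its normalising factor, (γ_β/γ)^{1/p} increases with β to e^{|y|²/(2p)}. The semigroup
  -- term H of this limit is finite because p exceeds the critical value, so the factor β^{-n/(2p)}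
  -- alone forces decay.
  set H : 𝔼 → ℝ≥0∞ := ouSemigroup s (fun y => ENNReal.ofReal (Real.exp (-(-(1 / p)) * ‖y‖ ^ 2 / 2)))
    with hH
  have hHm : Measurable H := measurable_ouSemigroup hs (by fun_prop)
  have hHt : ∀ x, H x ≠ ∞ := fun x => by
    rw [hH, ouSemigroup_exp hs hd]; exact ENNReal.ofReal_ne_top
  have hN : gaussLpNorm q H ≠ ∞ := by
    unfold gaussLpNorm
    have hpos : ∫⁻ x, H x ^ q ∂(stdMeasure n) ≠ 0 := by
      rw [ne_eq, lintegral_eq_zero_iff (by fun_prop)]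
      intro h
      obtain ⟨x, hx⟩ := h.exists
      rw [Pi.zero_apply, ENNReal.rpow_eq_zero_iff] at hx
      rcases hx with hx | hx
      · linarith [hx.2]
      · exact hHt x hx.1
    rw [ne_eq, ENNReal.rpow_eq_top_iff, not_or]
    exact ⟨fun h => hpos h.1, fun h => by
      have : 1 / q < 0 := by rw [one_div]; exact inv_lt_zero.2 hq
      linarith [h.2]⟩
  have hbound : ∀ β : ℝ, 0 < β → hcNorm s p q (gaussianDensity (n := n) β) ≤
      ENNReal.ofReal ((β ^ (-((n : ℝ) / 2))) ^ (1 / p)) * gaussLpNorm q H := by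
    intro β hβ
    have hc0 : ENNReal.ofReal ((β ^ (-((n : ℝ) / 2))) ^ (1 / p)) ≠ 0 := by
      rw [ne_eq, ENNReal.ofReal_eq_zero, not_le]; positivity
    rw [hcNorm_gaussianDensity_eq hp hβ]
    set c := ENNReal.ofReal ((β ^ (-((n : ℝ) / 2))) ^ (1 / p)) with hc
    have hct : c ≠ ∞ := ENNReal.ofReal_ne_top
    calc _ ≤ gaussLpNorm q (fun x => c * H x) := by
          refine gaussLpNorm_mono hq fun x => ?_
          rw [hH]
          unfold ouSemigroup
          refine mul_le_mul' le_rfl (lintegral_mono fun y => mul_le_mul' le_rfl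
            (ENNReal.ofReal_le_ofReal (Real.exp_le_exp.2 ?_)))
          rw [neg_neg, show -((β⁻¹ - 1) / p) = 1 / p - β⁻¹ / p by ring]
          have : 0 < β⁻¹ / p := by positivity
          nlinarith [sq_nonneg ‖y‖]
      _ = _ := by
          unfold gaussLpNorm
          have h1 : ∀ x, (c * H x) ^ q = c ^ q * H x ^ q := fun x => by
            rw [ENNReal.mul_rpow_of_ne_top hct (hHt x)]
          simp_rw [h1]
          have hcq0 : c ^ q ≠ 0 := by simp [ENNReal.rpow_eq_zero_iff, hc0, hct]
          have hcqt : c ^ q ≠ ∞ := by simp [ENNReal.rpow_eq_top_iff, hc0, hct]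
          rw [lintegral_const_mul' _ _ hcqt]
          have hr : (c ^ q) ^ (1 / q) = c := by
            rw [← ENNReal.rpow_mul, mul_one_div_cancel hq.ne, ENNReal.rpow_one]
          conv_rhs => rw [← hr]
          rw [← inv_inv ((_ * _ : ℝ≥0∞) ^ (1 / q)), ← ENNReal.rpow_neg,
            ENNReal.mul_rpow_of_nonneg _ _ (by
              rw [one_div, ← inv_neg]; exact inv_nonneg.2 (by linarith)),
            ENNReal.mul_inv (Or.inl (by simp [ENNReal.rpow_eq_zero_iff, hcq0, hcqt]))
              (Or.inl (by simp [ENNReal.rpow_eq_top_iff, hcq0, hcqt])),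
            ENNReal.rpow_neg, ENNReal.rpow_neg, inv_inv, inv_inv]
  have hlim : Filter.Tendsto (fun β : ℝ => ENNReal.ofReal ((β ^ (-((n : ℝ) / 2))) ^ (1 / p)) *
      gaussLpNorm q H) Filter.atTop (nhds 0) := by
    have hn' : (0 : ℝ) < (n : ℝ) / 2 := by
      have : (1 : ℝ) ≤ n := by exact_mod_cast hn
      positivity
    have h1 : Filter.Tendsto (fun β : ℝ => (β ^ (-((n : ℝ) / 2))) ^ (1 / p)) Filter.atTop
        (nhds 0) := by
      have := (tendsto_rpow_neg_atTop hn').rpow_const (p := 1 / p) (Or.inr (by positivity))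
      rwa [Real.zero_rpow (by positivity)] at this
    have h2 := ENNReal.Tendsto.mul_const (b := gaussLpNorm q H) (ENNReal.tendsto_ofReal h1)
      (Or.inr hN)
    simpa using h2
  refine le_antisymm (ge_of_tendsto hlim ?_) zero_le
  filter_upwards [Filter.eventually_gt_atTop 0] with β hβ
  exact (iInf₂_le β hβ).trans (hbound β hβ)

end Necessity

end SymmHC

end

/-! ### Assembly of the two assertions. -/

theorem theorem1p6 (n : ℕ) (hn : 1 ≤ n) (s p q : ℝ) (hs : 0 < s) (hq : q < 0) (hp : 0 < p) :
    ((1 - Real.exp (2 * s) ≤ q ∧ p ≤ 1 - Real.exp (-(2 * s))) →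
      (∀ f : EuclideanSpace ℝ (Fin n) → ℝ, MeasureTheory.Integrable f MeasureTheory.volume →
        (∀ᵐ x ∂MeasureTheory.volume, 0 ≤ f x) →
        (∀ᵐ x ∂MeasureTheory.volume, f (-x) = f x) →
        ENNReal.ofReal (∫ x, f x) ^ (1 / p) ≤ SymmHC.hcNorm s p q f) ∧
      SymmHC.hcNorm s p q (SymmHC.stdDensity (n := n)) =
        ENNReal.ofReal (∫ x, SymmHC.stdDensity (n := n) x) ^ (1 / p)) ∧
    (0 < (⨅ (β : ℝ) (_ : 0 < β), SymmHC.hcNorm s p q (SymmHC.gaussianDensity (n := n) β)) ↔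
      (1 - Real.exp (2 * s) ≤ q ∧ p ≤ 1 - Real.exp (-(2 * s)))) := by
  refine ⟨fun ⟨hqs, hps⟩ => ⟨fun f hf hf0 hfe =>
    SymmHC.rpow_integral_le_hcNorm hs hq hp hqs hps hf hf0 hfe, ?_⟩, ?_, ?_⟩
  · rw [SymmHC.hcNorm_stdDensity hs]
    simp_rw [SymmHC.stdDensity_eq_gaussianDensity]
    rw [SymmHC.integral_gaussianDensity one_pos]
    simp
  · intro h
    by_contra hcon
    rw [not_and_or, not_le, not_le] at hcon
    rcases hcon with hcon | hcon
    · obtain ⟨β, hβ, hβ0⟩ := SymmHC.exists_hcNorm_eq_zero hn hs hp hcon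
      have := h.trans_le (iInf₂_le β hβ)
      rw [hβ0] at this
      exact lt_irrefl _ this
    · rw [SymmHC.iInf_hcNorm_eq_zero hn hs hq hp hcon] at h
      exact lt_irrefl _ h
  · rintro ⟨hqs, hps⟩
    refine lt_of_lt_of_le zero_lt_one (le_iInf₂ fun β hβ => ?_)
    have h := SymmHC.rpow_integral_le_hcNorm hs hq hp hqs hps
      (SymmHC.integrable_gaussianDensity (n := n) hβ)
      (Filter.Eventually.of_forall fun x => (SymmHC.gaussianDensity_pos hβ x).le)
      (Filter.Eventually.of_forall fun x => SymmHC.gaussianDensity_neg β x)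
    rwa [SymmHC.integral_gaussianDensity hβ, ENNReal.ofReal_one, ENNReal.one_rpow] at h
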